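/- Let $k$ be an algebraically closed field of characteristic $p>0$, let $C$ be a smooth curve over $k$ (integral, separated, of finite type, smooth of dimension $1$), let $F:C\to C^{(p)}$ be the relative Frobenius morphism to the Frobenius twist, and let $\mathscr E$ be a vector bundle of rank $r$ on $C$. A \emph{rational connection} on $\mathscr E$ is a connection $\nabla:\mathscr E|_U\to(\mathscr E\otimes\Omega^1_{C/k})|_U$ on a dense open subset $U\subseteq C$, two such being identified if they agree on a dense open subset; a point is a \emph{pole} if $\nabla$ does not extend to a connection on any neighbourhood of it. Its $p$-curvature is $\psi(D)=(\nabla_D)^p-\nabla_{D^p}$ for derivations $D$. A section of $\mathscr E$ is \emph{horizontal} if $\nabla$ kills it where $\nabla$ is defined. A \emph{pre-kernel map} to $\mathscr E$ is a pair $(\mathscr F,\varphi)$ with $\mathscr F$ a vector bundle of rank $r$ on $C^{(p)}$ and $\varphi:F^*\mathscr F\hookrightarrow\mathscr E$ an injection. For each pre-kernel map there is a unique rational connection on $\mathscr E$, the \emph{induced} one, for which all sections in $\varphi(F^{-1}\mathscr F)$ are horizontal. The pair is a \emph{kernel map} if moreover $\varphi(F^{-1}\mathscr F)$ consists of all the horizontal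 sections of the induced rational connection. Kernel maps $(\mathscr F,\varphi)$ and $(\mathscr F',\varphi')$ are identified modulo automorphisms of $\mathscr F$ if $\varphi=\varphi'\circ F^*\beta$ for some isomorphism $\beta:\mathscr F\cong\mathscr F'$. Then: (i) There is a one-to-one correspondence between rational connections $\nabla$ on $\mathscr E$ with vanishing $p$-curvature and kernel maps $(\mathscr F,\varphi)$ to $\mathscr E$ modulo automorphisms of $\mathscr F$. It sends $\nabla$ to the class of those $(\mathscr F,\varphi)$ for which $\varphi(F^{-1}\mathscr F)$ is the sheaf $\mathscr E^\nabla$ of horizontal sections, and its inverse sends the class of $(\mathscr F,\varphi)$ to the rational connection that it induces. (ii) If $\nabla$ corresponds to $(\mathscr F,\varphi)$, then the poles of $\nabla$ are precisely the points of $C$ at which $\varphi$ is not surjective (on stalks). (iii) If $\nabla$ corresponds to $(\mathscr F,\varphi)$ and $\alpha$ is an automorphism of $\mathscr E$, then the transported rational connection $(\alpha\otimes 1)\circ\nabla\circ\alpha^{-1}$ has vanishing $p$-curvature, $(\mathscr F,\alpha\circ\varphi)$ is a kernel map, and the two correspond to each other. -/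

import Mathlib

open CategoryTheory AlgebraicGeometry TopologicalSpace Opposite
open scoped TensorProduct

universe u

noncomputable section

namespace CurveConn

/-! ### Powers of derivations and restriction of Kähler differentials -/

section Algebra

variable {k A B M N : Type u} [CommRing k] [CommRing A] [Algebra k A]

/-- In characteristic `p`, the `p`-th iterate of a derivation is again a derivation. -/
def derivationPow (p : ℕ) [hp : Fact p.Prime] [CharP k p] (D : Derivation k A A) :
    Derivation k A A :=
  Derivation.mk' ((D : A →ₗ[k] A) ^ p) (by
    intro a b
    set L : A →ₗ[k] A := (D : A →ₗ[k] A) with hL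
    let X : Module.End k (A ⊗[k] A) := LinearMap.rTensor A L
    let Y : Module.End k (A ⊗[k] A) := LinearMap.lTensor A L
    have hXY : Commute X Y := by
      refine TensorProduct.ext' fun x y => ?_
      simp [X, Y]
    have hX : ∀ n : ℕ, ∀ x y : A, (X ^ n) (x ⊗ₜ[k] y) = ((L ^ n) x) ⊗ₜ[k] y := by
      intro n x y
      simp [X, LinearMap.rTensor_pow]
    have hY : ∀ n : ℕ, ∀ x y : A, (Y ^ n) (x ⊗ₜ[k] y) = x ⊗ₜ[k] ((L ^ n) y) := by
      intro n x y
      simp [Y, LinearMap.lTensor_pow]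
    have hmul : ∀ n : ℕ, ∀ z : A ⊗[k] A,
        (LinearMap.mul' k A) (((X + Y) ^ n) z) = (L ^ n) ((LinearMap.mul' k A) z) := by
      intro n
      induction n with
      | zero => intro z; simp
      | succ n ih =>
        intro z
        rw [pow_succ, pow_succ, Module.End.mul_apply, Module.End.mul_apply, ih]
        congr 1
        induction z with
        | zero => simp
        | tmul x y => simp [X, Y, hL, D.leibniz, mul_comm, add_comm]
        | add x y hx hy => simp only [map_add, hx, hy]
    obtain ⟨r, hr⟩ := hXY.exists_add_pow_prime_eq hp.out
    have hp0 : ((p : ℕ) : Module.End k (A ⊗[k] A)) = 0 := by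
      ext1
      ext x y
      simp [← Nat.cast_smul_eq_nsmul k, CharP.cast_eq_zero]
    rw [hp0, zero_mul, zero_mul, zero_mul, add_zero] at hr
    have h := hmul p (a ⊗ₜ[k] b)
    rw [hr, LinearMap.add_apply, hX, hY, map_add, LinearMap.mul'_apply, LinearMap.mul'_apply,
      LinearMap.mul'_apply] at h
    rw [← h, smul_eq_mul, smul_eq_mul]
    ring)

@[simp] lemma derivationPow_apply (p : ℕ) [Fact p.Prime] [CharP k p] (D : Derivation k A A)
    (a : A) : derivationPow p D a = D^[p] a := by
  change ((D : A →ₗ[k] A) ^ p) a = _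
  rw [Module.End.pow_apply]
  rfl

variable [CommRing B] [Algebra k B]

/-- The map `a db ↦ f(a) d(f(b))` on Kähler differentials induced by a map of `k`-algebras. -/
def kaehlerMap (f : A →ₐ[k] B) : Ω[A⁄k] →+ Ω[B⁄k] :=
  letI := f.toRingHom.toAlgebra
  haveI : IsScalarTower k A B := IsScalarTower.of_algebraMap_eq' f.comp_algebraMap.symm
  (KaehlerDifferential.map k k A B).toAddMonoidHom

lemma kaehlerMap_D (f : A →ₐ[k] B) (a : A) :
    kaehlerMap f (KaehlerDifferential.D k A a) = KaehlerDifferential.D k B (f a) :=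
  let _ := f.toRingHom.toAlgebra
  have : IsScalarTower k A B := IsScalarTower.of_algebraMap_eq' f.comp_algebraMap.symm
  KaehlerDifferential.map_D k k A B a

lemma kaehlerMap_smul (f : A →ₐ[k] B) (a : A) (ω : Ω[A⁄k]) :
    kaehlerMap f (a • ω) = f a • kaehlerMap f ω := by
  let _ := f.toRingHom.toAlgebra
  have : IsScalarTower k A B := IsScalarTower.of_algebraMap_eq' f.comp_algebraMap.symm
  change KaehlerDifferential.map k k A B (a • ω) = f a • KaehlerDifferential.map k k A B ω
  rw [map_smul]
  exact algebra_compatible_smul B a _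

variable [AddCommGroup M] [Module A M] [AddCommGroup N] [Module B N]

/-- The map `M ⊗ Ω¹_A → N ⊗ Ω¹_B`, `m ⊗ ω ↦ g(m) ⊗ f(ω)`, for `g : M → N` semilinear over
the `k`-algebra map `f : A → B`. -/
def tensorKaehlerMap (f : A →ₐ[k] B) (g : M →+ N) (hg : ∀ (a : A) (m : M), g (a • m) = f a • g m) :
    M ⊗[A] Ω[A⁄k] →+ N ⊗[B] Ω[B⁄k] :=
  TensorProduct.liftAddHom
    (AddMonoidHom.mk' (fun m => AddMonoidHom.mk' (fun ω => g m ⊗ₜ[B] kaehlerMap f ω)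
        (fun x y => by rw [map_add, TensorProduct.tmul_add]))
      (fun x y => by ext ω; simp [TensorProduct.add_tmul]))
    (fun a m ω => by simp [hg, kaehlerMap_smul, TensorProduct.smul_tmul])

@[simp] lemma tensorKaehlerMap_tmul (f : A →ₐ[k] B) (g : M →+ N)
    (hg : ∀ (a : A) (m : M), g (a • m) = f a • g m) (m : M) (ω : Ω[A⁄k]) :
    tensorKaehlerMap f g hg (m ⊗ₜ[A] ω) = g m ⊗ₜ[B] kaehlerMap f ω := rfl

/-- Contraction `M ⊗ Ω¹_A → M`, `m ⊗ da ↦ D(a) m`, with a derivation `D`. -/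
def contract (M : Type u) [AddCommGroup M] [Module A M] (D : Derivation k A A) :
    M ⊗[A] Ω[A⁄k] →ₗ[A] M :=
  (TensorProduct.rid A M).toLinearMap ∘ₗ LinearMap.lTensor M D.liftKaehlerDifferential

end Algebra

/-! ### The Frobenius morphism of a scheme over a field of characteristic `p` -/

section Frobenius

/-- The `k`-algebra structure on the sections of the structure sheaf of a `k`-scheme. -/
abbrev sectionsAlgebra (k : Type u) [Field k] {C : Scheme.{u}} [C.Over (Spec (.of k))]
    (V : C.Opens) : Algebra k Γ(C, V) :=
  ((Scheme.ΓSpecIso (.of k)).inv ≫ (C ↘ Spec (.of k)).appTop ≫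
    C.presheaf.map (homOfLE le_top).op).hom.toAlgebra

attribute [local instance] sectionsAlgebra

/-- Restriction of functions as a map of `k`-algebras. -/
def resAlgHom (k : Type u) [Field k] {C : Scheme.{u}} [C.Over (Spec (.of k))]
    {V W : C.Opens} (h : W ≤ V) : Γ(C, V) →ₐ[k] Γ(C, W) where
  toRingHom := (C.presheaf.map (homOfLE h).op).hom
  commutes' a := by
    change ((Scheme.ΓSpecIso (.of k)).inv ≫ (C ↘ Spec (.of k)).appTop ≫
      C.presheaf.map (homOfLE le_top).op ≫ C.presheaf.map (homOfLE h).op).hom a =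
      ((Scheme.ΓSpecIso (.of k)).inv ≫ (C ↘ Spec (.of k)).appTop ≫
        C.presheaf.map (homOfLE le_top).op).hom a
    rw [← Functor.map_comp]
    rfl

lemma natCast_sections_eq_zero (k : Type u) [Field k] (p : ℕ) [CharP k p] {C : Scheme.{u}}
    [C.Over (Spec (.of k))] (V : C.Opens) : (p : Γ(C, V)) = 0 := by
  have h := map_natCast (algebraMap k Γ(C, V)) p
  rw [CharP.cast_eq_zero, map_zero] at h
  exact h.symm

/-- The `p`-power map as a ring homomorphism of a ring in which `p = 0`. -/
def powRingHom (p : ℕ) [hp : Fact p.Prime] {R : Type u} [CommRing R] (h : (p : R) = 0) :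
    R →+* R where
  toFun x := x ^ p
  map_one' := one_pow p
  map_mul' x y := mul_pow x y p
  map_zero' := zero_pow hp.out.ne_zero
  map_add' x y := by
    obtain ⟨r, hr⟩ := (Commute.all x y).exists_add_pow_prime_eq hp.out
    rw [hr, h, zero_mul, zero_mul, zero_mul, add_zero]

variable (k : Type u) [Field k] (p : ℕ) [hp : Fact p.Prime] [CharP k p]
  (C : Scheme.{u}) [C.Over (Spec (.of k))]

/-- The absolute Frobenius of a `k`-scheme as a morphism of presheafed spaces: the identity on
points and the `p`-th power map on functions. -/
def absFrobeniusPresheafed : C.toPresheafedSpace ⟶ C.toPresheafedSpace where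
  base := 𝟙 _
  c :=
    { app := fun V => CommRingCat.ofHom
        (powRingHom p (natCast_sections_eq_zero k p (C := C) V.unop))
      naturality := by
        intro V W f
        ext x
        exact (map_pow (C.presheaf.map f).hom x p).symm }

lemma absFrobeniusPresheafed_stalkMap (x : C) (a : C.presheaf.stalk x) :
    ((absFrobeniusPresheafed k p C).stalkMap x).hom a = a ^ p := by
  obtain ⟨U, hx, s, rfl⟩ := C.presheaf.exists_germ_eq a
  have h := PresheafedSpace.stalkMap_germ_apply (absFrobeniusPresheafed k p C) U x hx s
  refine h.trans ?_
  exact map_pow (C.presheaf.germ U x hx).hom s p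

/-- The absolute Frobenius of a `k`-scheme. -/
def absFrobenius : C ⟶ C where
  toHom := absFrobeniusPresheafed k p C
  prop x := ⟨fun a ha => by
    have h := absFrobeniusPresheafed_stalkMap k p C x a
    exact (isUnit_pow_iff hp.out.ne_zero).mp (h ▸ ha)⟩

lemma absFrobenius_comp : absFrobenius k p C ≫ (C ↘ Spec (.of k)) =
    (C ↘ Spec (.of k)) ≫ Spec.map (CommRingCat.ofHom (frobenius k p)) := by
  apply ext_of_isAffine
  ext x
  change ((C ↘ Spec (.of k)).appTop.hom x) ^ p = _
  rw [Scheme.Hom.comp_appTop]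
  change _ = (C ↘ Spec (.of k)).appTop.hom
    ((Spec.map (CommRingCat.ofHom (frobenius k p))).appTop.hom x)
  rw [← map_pow]
  congr 1
  obtain ⟨y, rfl⟩ : ∃ y : k, (Scheme.ΓSpecIso (.of k)).inv.hom y = x :=
    ⟨(Scheme.ΓSpecIso (.of k)).hom.hom x, congr($((Scheme.ΓSpecIso (.of k)).hom_inv_id).hom x)⟩
  have h := congr($(Scheme.ΓSpecIso_inv_naturality (CommRingCat.ofHom (frobenius k p))).hom y)
  refine Eq.trans ?_ h
  exact (map_pow (Scheme.ΓSpecIso (.of k)).inv.hom y p).symm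

/-- The Frobenius twist `C^{(p)}`: base change of `C` along the Frobenius of `k`. -/
def frobeniusTwist : Scheme.{u} :=
  Limits.pullback (C ↘ Spec (.of k)) (Spec.map (CommRingCat.ofHom (frobenius k p)))

/-- The relative Frobenius `F : C ⟶ C^{(p)}`. -/
def relFrobenius : C ⟶ frobeniusTwist k p C :=
  Limits.pullback.lift (absFrobenius k p C) (C ↘ Spec (.of k)) (absFrobenius_comp k p C)

end Frobenius

/-! ### Vector bundles, rational connections and `p`-curvature -/

section Connections

/-- `E` is a vector bundle of rank `r`: every point has an open neighbourhood `U` on which `E` has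
a frame, i.e. sections `e₁, …, e_r` giving an isomorphism `𝒪_U^r ≅ E|_U`. -/
def IsVectorBundle {X : Scheme.{u}} (r : ℕ) (E : X.Modules) : Prop :=
  ∀ x : X, ∃ U : X.Opens, x ∈ U ∧ ∃ e : Fin r → Γ(E, U), ∀ (V : X.Opens) (h : V ≤ U),
    Function.Bijective (fun a : Fin r → Γ(X, V) =>
      ∑ i, a i • E.presheaf.map (homOfLE h).op (e i))

attribute [local instance] sectionsAlgebra

variable (k : Type u) [Field k] {C : Scheme.{u}} [C.Over (Spec (.of k))] (E : C.Modules)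

/-- Over an affine open `V`, the sections of `E ⊗ Ω¹_{C/k}` for quasi-coherent `E`. -/
abbrev FormSections (V : C.Opens) : Type u := Γ(E, V) ⊗[Γ(C, V)] Ω[Γ(C, V)⁄k]

/-- Restriction of sections of `E ⊗ Ω¹_{C/k}`. -/
def FormSections.res {V W : C.Opens} (h : W ≤ V) : FormSections k E V →+ FormSections k E W :=
  tensorKaehlerMap (resAlgHom k h) (E.presheaf.map (homOfLE h).op).hom
    (fun a m => Scheme.Modules.map_smul E (homOfLE h) a m)

/-- A connection `∇ : E|_U → (E ⊗ Ω¹_{C/k})|_U` on the restriction of `E` to an open subset `U`,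
given by its values over the affine open subsets of `U`. Being additive and satisfying the
Leibniz rule over the `k`-algebra `𝒪`, it is `k`-linear. -/
@[ext]
structure Connection (U : C.Opens) where
  /-- the connection on sections over an affine open subset of `U` -/
  nabla (V : C.Opens) (hV : IsAffineOpen V) (hVU : V ≤ U) : Γ(E, V) →+ FormSections k E V
  leibniz (V : C.Opens) (hV : IsAffineOpen V) (hVU : V ≤ U) (a : Γ(C, V)) (s : Γ(E, V)) :
    nabla V hV hVU (a • s) =
      a • nabla V hV hVU s + s ⊗ₜ[Γ(C, V)] KaehlerDifferential.D k Γ(C, V) a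
  res_nabla (V W : C.Opens) (hV : IsAffineOpen V) (hW : IsAffineOpen W) (hVU : V ≤ U)
    (h : W ≤ V) (s : Γ(E, V)) :
    nabla W hW (h.trans hVU) (E.presheaf.map (homOfLE h).op s) =
      FormSections.res k E h (nabla V hV hVU s)

variable {k E}

/-- The covariant derivative `∇_D` along a vector field `D` on an affine open subset `V`. -/
def Connection.covariant {U : C.Opens} (c : Connection k E U) {V : C.Opens} (hV : IsAffineOpen V)
    (hVU : V ≤ U) (D : Derivation k Γ(C, V) Γ(C, V)) : Γ(E, V) →+ Γ(E, V) :=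
  (contract Γ(E, V) D).toAddMonoidHom.comp (c.nabla V hV hVU)

/-- The `p`-curvature `ψ(D) = (∇_D)^p - ∇_{D^p}`. -/
def Connection.pCurvature {U : C.Opens} (c : Connection k E U) (p : ℕ) [Fact p.Prime] [CharP k p]
    {V : C.Opens} (hV : IsAffineOpen V) (hVU : V ≤ U) (D : Derivation k Γ(C, V) Γ(C, V))
    (s : Γ(E, V)) : Γ(E, V) :=
  (c.covariant hV hVU D)^[p] s - c.covariant hV hVU (derivationPow p D) s

variable (k E)

/-- A representative of a rational connection: a connection on a dense open subset. -/
structure PartialConnection where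
  /-- the open subset on which the connection is defined -/
  domain : C.Opens
  dense_domain : Dense (domain : Set C)
  /-- the connection -/
  conn : Connection k E domain

variable {k E}

/-- Two partial connections are equivalent if they agree on a dense open subset. -/
def PartialConnection.Equivalent (P Q : PartialConnection k E) : Prop :=
  ∃ (W : C.Opens) (_ : Dense (W : Set C)) (hP : W ≤ P.domain) (hQ : W ≤ Q.domain),
    ∀ (V : C.Opens) (hV : IsAffineOpen V) (hVW : V ≤ W),
      P.conn.nabla V hV (hVW.trans hP) = Q.conn.nabla V hV (hVW.trans hQ)

lemma PartialConnection.equivalence :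
    Equivalence (PartialConnection.Equivalent (k := k) (E := E)) where
  refl P := ⟨P.domain, P.dense_domain, le_rfl, le_rfl, fun _ _ _ => rfl⟩
  symm := fun ⟨W, hW, hP, hQ, h⟩ => ⟨W, hW, hQ, hP, fun V hV hVW => (h V hV hVW).symm⟩
  trans := fun ⟨W, hW, hP, _, h⟩ ⟨W', hW', _, hR, h'⟩ =>
    ⟨W ⊓ W', hW.inter_of_isOpen_left hW' W.isOpen, inf_le_left.trans hP, inf_le_right.trans hR,
      fun V hV hVW => (h V hV (hVW.trans inf_le_left)).trans
        (h' V hV (hVW.trans inf_le_right))⟩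

instance PartialConnection.setoid : Setoid (PartialConnection k E) :=
  ⟨PartialConnection.Equivalent, PartialConnection.equivalence⟩

variable (k E) in
/-- A rational connection on `E`: a connection on a dense open subset, two of them being
identified when they agree on a dense open subset. -/
def RationalConnection : Type u := Quotient (PartialConnection.setoid (k := k) (E := E))

/-- A point is a pole if the rational connection is not defined (i.e. does not extend to a
connection) on any open neighbourhood of it. -/
def RationalConnection.IsPole (c : RationalConnection k E) (x : C) : Prop :=
  ∀ P : PartialConnection k E, Quotient.mk _ P = c → x ∉ P.domain

/-- The `p`-curvature of the rational connection vanishes on its domain of definition. -/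
def RationalConnection.HasVanishingPCurvature (c : RationalConnection k E) (p : ℕ)
    [Fact p.Prime] [CharP k p] : Prop :=
  ∃ P : PartialConnection k E, Quotient.mk _ P = c ∧
    ∀ (V : C.Opens) (hV : IsAffineOpen V) (hVU : V ≤ P.domain)
      (D : Derivation k Γ(C, V) Γ(C, V)) (s : Γ(E, V)), P.conn.pCurvature p hV hVU D s = 0

/-- The section `s` of `E` over `U` is horizontal, `∇ s = 0`, where `∇` is defined. -/
def RationalConnection.IsHorizontal (c : RationalConnection k E) {U : C.Opens} (s : Γ(E, U)) :
    Prop :=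
  ∃ P : PartialConnection k E, Quotient.mk _ P = c ∧
    ∀ (V : C.Opens) (hV : IsAffineOpen V) (hVP : V ≤ P.domain) (hVU : V ≤ U),
      P.conn.nabla V hV hVP (E.presheaf.map (homOfLE hVU).op s) = 0

/-- The action of a morphism of `𝒪`-modules on sections, as a linear map. -/
def appLinear {X : Scheme.{u}} {M N : X.Modules} (φ : M ⟶ N) (V : X.Opens) :
    Γ(M, V) →ₗ[Γ(X, V)] Γ(N, V) where
  toFun := Scheme.Modules.Hom.app φ V
  map_add' x y := map_add _ x y
  map_smul' a x := Scheme.Modules.Hom.app_smul φ a x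

/-- The transport `(α ⊗ 1) ∘ ∇ ∘ α⁻¹` of a connection along an automorphism `α` of `E`. -/
def Connection.transport {U : C.Opens} (α : E ≅ E) (c : Connection k E U) :
    Connection k E U where
  nabla V hV hVU := (LinearMap.rTensor (Ω[Γ(C, V)⁄k]) (appLinear α.hom V)).toAddMonoidHom.comp
    ((c.nabla V hV hVU).comp (appLinear α.inv V).toAddMonoidHom)
  leibniz V hV hVU a s := by
    have h : appLinear α.hom V (appLinear α.inv V s) = s := by
      change (Scheme.Modules.Hom.app α.inv V ≫ Scheme.Modules.Hom.app α.hom V) s = s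
      rw [← Scheme.Modules.Hom.comp_app, α.inv_hom_id]
      rfl
    simp [c.leibniz, h]
  res_nabla V W hV hW hVU h s := by
    have hn : ∀ t, appLinear α.inv W (E.presheaf.map (homOfLE h).op t) =
        E.presheaf.map (homOfLE h).op (appLinear α.inv V t) := fun t =>
      congr($((Scheme.Modules.Hom.mapPresheaf α.inv).naturality (homOfLE h).op) t)
    have hn' : ∀ t, appLinear α.hom W (E.presheaf.map (homOfLE h).op t) =
        E.presheaf.map (homOfLE h).op (appLinear α.hom V t) := fun t =>
      congr($((Scheme.Modules.Hom.mapPresheaf α.hom).naturality (homOfLE h).op) t)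
    change LinearMap.rTensor _ (appLinear α.hom W) (c.nabla W hW _ (appLinear α.inv W _)) =
      FormSections.res k E h (LinearMap.rTensor _ (appLinear α.hom V)
        (c.nabla V hV hVU (appLinear α.inv V s)))
    rw [hn, c.res_nabla V W hV hW hVU h]
    generalize c.nabla V hV hVU (appLinear α.inv V s) = z
    induction z using TensorProduct.induction_on with
    | zero => simp
    | add x y hx hy => simp only [map_add, hx, hy]
    | tmul x y =>
      change appLinear α.hom W (E.presheaf.map (homOfLE h).op x) ⊗ₜ _ =
        E.presheaf.map (homOfLE h).op (appLinear α.hom V x) ⊗ₜ _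
      rw [hn']
      rfl

/-- The transport of a partial connection along an automorphism of `E`. -/
def PartialConnection.transport (α : E ≅ E) (P : PartialConnection k E) :
    PartialConnection k E where
  domain := P.domain
  dense_domain := P.dense_domain
  conn := P.conn.transport α

/-- The transport of a rational connection along an automorphism of `E`. -/
def RationalConnection.transport (α : E ≅ E) :
    RationalConnection k E → RationalConnection k E :=
  Quotient.map (PartialConnection.transport α) (by
    rintro P Q ⟨W, hW, hP, hQ, h⟩
    refine ⟨W, hW, hP, hQ, fun V hV hVW => ?_⟩
    simp only [PartialConnection.transport, Connection.transport]
    rw [h V hV hVW])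

end Connections

/-! ### Kernel maps -/

section KernelMaps

variable (k : Type u) [Field k] (p : ℕ) [Fact p.Prime] [CharP k p]
  {C : Scheme.{u}} [C.Over (Spec (.of k))] (r : ℕ) (E : C.Modules)

/-- A pre-kernel map to `E`: a vector bundle `𝓕` of rank `r` on `C^{(p)}` and an injection
`φ : F^* 𝓕 ↪ E`. -/
structure PreKernelMap where
  /-- the bundle on the Frobenius twist -/
  bundle : (frobeniusTwist k p C).Modules
  isVectorBundle : IsVectorBundle r bundle
  /-- the injection -/
  φ : (Scheme.Modules.pullback (relFrobenius k p C)).obj bundle ⟶ E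
  mono : Mono φ

variable {k p r E}

/-- The map `Γ(V, 𝓕) = Γ(F⁻¹ V, F⁻¹ 𝓕) → Γ(F⁻¹ V, F^* 𝓕) → Γ(F⁻¹ V, E)` induced by `φ`. As `F` is
a homeomorphism, every open subset of `C` is of the form `F⁻¹ V`. -/
def PreKernelMap.onSections (K : PreKernelMap k p r E) (V : (frobeniusTwist k p C).Opens)
    (f : Γ(K.bundle, V)) : Γ(E, relFrobenius k p C ⁻¹ᵁ V) :=
  Scheme.Modules.Hom.app K.φ (relFrobenius k p C ⁻¹ᵁ V)
    (Scheme.Modules.Hom.app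
      ((Scheme.Modules.pullbackPushforwardAdjunction (relFrobenius k p C)).unit.app K.bundle) V f)

/-- `c` is the rational connection induced by the pre-kernel map: the sections in
`φ(F⁻¹ 𝓕)` are horizontal. -/
def PreKernelMap.Induces (K : PreKernelMap k p r E) (c : RationalConnection k E) : Prop :=
  ∀ (V : (frobeniusTwist k p C).Opens) (f : Γ(K.bundle, V)), c.IsHorizontal (K.onSections V f)

/-- `φ(F⁻¹ 𝓕)` is the sheaf of all horizontal sections of the rational connection `c`. -/
def PreKernelMap.IsKernelOf (K : PreKernelMap k p r E) (c : RationalConnection k E) : Prop :=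
  ∀ (V : (frobeniusTwist k p C).Opens) (s : Γ(E, relFrobenius k p C ⁻¹ᵁ V)),
    c.IsHorizontal s ↔ s ∈ Set.range (K.onSections V)

/-- A pre-kernel map is a kernel map if `φ(F⁻¹ 𝓕)` is the entire sheaf of horizontal sections of
the induced rational connection. -/
def PreKernelMap.IsKernelMap (K : PreKernelMap k p r E) : Prop :=
  ∃ c : RationalConnection k E, K.Induces c ∧ K.IsKernelOf c

variable (k p r E) in
/-- A kernel map to `E`. -/
def KernelMap : Type (u + 1) := {K : PreKernelMap k p r E // K.IsKernelMap}

/-- Two kernel maps `(𝓕, φ)`, `(𝓕', φ')` are identified if there is an isomorphism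
`β : 𝓕 ≅ 𝓕'` with `φ' ∘ F^*β = φ`; for `𝓕 = 𝓕'` this is modification of `φ` by an automorphism
of `𝓕`. -/
def KernelMap.Equivalent (K K' : KernelMap k p r E) : Prop :=
  ∃ β : K.1.bundle ≅ K'.1.bundle,
    (Scheme.Modules.pullback (relFrobenius k p C)).map β.hom ≫ K'.1.φ = K.1.φ

lemma KernelMap.equivalence : Equivalence (KernelMap.Equivalent (k := k) (p := p) (r := r)
    (E := E)) where
  refl K := ⟨Iso.refl _, by simp⟩
  symm := fun {K K'} ⟨β, h⟩ => ⟨β.symm, by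
    rw [← h, ← Category.assoc, ← Functor.map_comp]
    simp⟩
  trans := fun ⟨β, h⟩ ⟨β', h'⟩ => ⟨β ≪≫ β', by
    rw [Iso.trans_hom, Functor.map_comp, Category.assoc, h', h]⟩

instance KernelMap.setoid : Setoid (KernelMap k p r E) :=
  ⟨KernelMap.Equivalent, KernelMap.equivalence⟩

variable (k p r E) in
/-- Kernel maps `(𝓕, φ)` to `E` modulo automorphisms of `𝓕`. -/
def KernelMapClass : Type (u + 1) := Quotient (KernelMap.setoid (k := k) (p := p) (r := r) (E := E))

/-- The class of a kernel map modulo automorphisms of `𝓕`. -/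
def KernelMap.toClass (K : KernelMap k p r E) : KernelMapClass k p r E := Quotient.mk _ K

/-- The pre-kernel map `(𝓕, α ∘ φ)` for an automorphism `α` of `E`. -/
def PreKernelMap.postcomp (K : PreKernelMap k p r E) (α : E ≅ E) : PreKernelMap k p r E where
  bundle := K.bundle
  isVectorBundle := K.isVectorBundle
  φ := K.φ ≫ α.hom
  mono := by
    have := K.mono
    infer_instance

/-- `φ` is surjective at the point `x`, i.e. on stalks at `x`. -/
def PreKernelMap.IsSurjectiveAt (K : PreKernelMap k p r E) (x : C) : Prop :=
  Function.Surjective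
    ((TopCat.Presheaf.stalkFunctor Ab x).map (Scheme.Modules.Hom.mapPresheaf K.φ))

end KernelMaps

end CurveConn

end

/-!
The theorem is Cartier descent along the relative Frobenius `F`, with poles allowed. As `k` is
perfect, `F` is a homeomorphism and the functions on `C^{(p)}` are, seen on `C`, exactly the
`p`-th powers.

*From pre-kernel maps to connections.* Over a suitable dense open subset, a frame `f` of `𝓕`
becomes a frame `φ(f)` of `E`: the determinant of `φ` in local frames is nonzero, because `φ` is
injective (`PreKernelMap.exists_image_frame`). The connection for which this frame is horizontal,
`IsFrame.flatConnection`, annihilates every section of `F⁻¹ 𝓕`, as these have `p`-th powers as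
coordinates, and its `p`-curvature is zero; a connection is determined by a horizontal frame, so it
is the only one. Near a point where `φ` is surjective on stalks the determinant is invertible, so
that the same formula shows that the point is not a pole (`PreKernelMap.Induces.not_isPole`).

*From connections to kernel maps.* A smooth curve has, locally, a coordinate `t` with a derivation
`D = d/dt`, for which `D ^ p = 0`, so that vanishing `p`-curvature gives `(∇_D) ^ p = 0`. An
operator `T` satisfying the Leibniz rule over `D` with `T ^ p m = 0` has `m` in the span of `ker T`:
one subtracts `t ^ n / n! • T ^ n m`, where `T ^ (n + 1) m = 0`, and goes on by induction on `n < p`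
(`Coordinate.mem_span_of_iterate_eq_zero`). Hence at the generic point, with function field `K`, the
horizontal vectors span `K ^ r`, and as the constants of `D` in `K` are `K ^ p`
(`Coordinate.exists_pow_eq_of_D_eq_zero`) they are the combinations `∑ c_i ^ p • w_i` of a basis
`w` of horizontal vectors. The tuples `c` for which this combination lies in the lattice `A ^ r`
given by a frame of `E` over `Spec A` form an `A`-module which is finite, since Frobenius is, and
torsion-free, hence free of rank `r` at each closed point, where the local ring of `A` is a principal
ideal domain (`Coordinate.exists_horizontal_lattice_basis`). So the horizontal sections form a vector
bundle of rank `r` on `C^{(p)}`, and its frames are independent over `K`, so that the map from its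
pullback to `E` is injective (`RationalConnection.exists_isKernelOf`).

*The correspondence.* A kernel map is determined, up to a unique isomorphism, by the sheaf
`φ(F⁻¹ 𝓕)` of sections of `E` (`PreKernelMap.IsKernelOf.exists_iso`). Where the connection has no
pole, horizontal sections span `E` even locally, by the same subtraction argument over `A`, so that
`φ` is surjective (`PreKernelMap.IsKernelOf.isSurjectiveAt`). Transport along an automorphism `α` of
`E` composes the horizontal sections with `α`.

Modules are handled through their sections: `resO` and `resM` restrict functions and sections, and
`IsFrame` is the notion of a local basis used in the definition of a vector bundle. What is needed
about pullbacks is that frames pull back to frames (`IsFrame.pullback`) and that maps out of `F^* 𝓕`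
are determined by pulled back sections (`pullback_hom_ext`).
-/

noncomputable section

namespace CurveConn

/-! ### Coordinates on smooth algebras of relative dimension one -/

section Coordinates

/-- A coordinate of a `k`-algebra `A`: an element `t` such that `dt` freely generates the Kähler
differentials of `A`. The freeness is encoded by the derivation `D = d/dt` with `D t = 1`. -/
structure Coordinate (k A : Type u) [CommRing k] [CommRing A] [Algebra k A] where
  /-- the coordinate -/
  t : A
  /-- the derivation `d/dt` -/
  D : Derivation k A A
  D_t : D t = 1
  span (ω : Ω[A⁄k]) : ω = D.liftKaehlerDifferential ω • KaehlerDifferential.D k A t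

namespace Coordinate

variable {k A : Type u} [CommRing k] [CommRing A] [Algebra k A]

/-- The coordinate `t` for which `dt` is the unique element of a basis of the differentials. -/
def ofBasis {ι : Type*} [Unique ι] (b : Module.Basis ι A Ω[A⁄k]) (t : A)
    (h : b default = KaehlerDifferential.D k A t) : Coordinate k A where
  t := t
  D := (b.coord default).compDer (KaehlerDifferential.D k A)
  D_t := by simp [← h]
  span ω := by
    have : ((b.coord default).compDer (KaehlerDifferential.D k A)).liftKaehlerDifferential
        = b.coord default := by
      apply Derivation.liftKaehlerDifferential_unique
      ext; simp
    rw [this, ← h]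
    conv_lhs => rw [← b.sum_repr ω]
    simp

/-- Coordinates pull back along formally étale extensions. -/
def ofFormallyEtale (x : Coordinate k A) (B : Type u) [CommRing B] [Algebra k B]
    [Algebra A B] [IsScalarTower k A B] [Algebra.FormallyEtale A B] : Coordinate k B :=
  let h := KaehlerDifferential.isBaseChange_of_formallyEtale k A B
  let l : Ω[B⁄k] →ₗ[B] B :=
    h.lift ((Algebra.linearMap A B) ∘ₗ x.D.liftKaehlerDifferential)
  have hl (ω : Ω[A⁄k]) : l (KaehlerDifferential.map k k A B ω) =
      algebraMap A B (x.D.liftKaehlerDifferential ω) := by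
    exact h.lift_eq _ _
  { t := algebraMap A B x.t
    D := l.compDer (KaehlerDifferential.D k B)
    D_t := by
      have := hl (KaehlerDifferential.D k A x.t)
      rw [KaehlerDifferential.map_D] at this
      simp [this, x.D_t]
    span := fun ω => by
      have h1 : (l.compDer (KaehlerDifferential.D k B)).liftKaehlerDifferential = l := by
        apply Derivation.liftKaehlerDifferential_unique
        ext; simp
      rw [h1]
      induction ω using h.inductionOn with
      | zero => simp
      | tmul ω =>
        rw [hl]
        conv_lhs => rw [x.span ω]
        rw [map_smul, KaehlerDifferential.map_D, algebraMap_smul]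
      | smul b ω hω =>
        conv_lhs => rw [hω]
        simp [mul_smul]
      | add ω₁ ω₂ h₁ h₂ =>
        conv_lhs => rw [h₁, h₂]
        rw [map_add, add_smul] }

lemma ofFormallyEtale_D (x : Coordinate k A) (B : Type u) [CommRing B] [Algebra k B]
    [Algebra A B] [IsScalarTower k A B] [Algebra.FormallyEtale A B] (a : A) :
    (x.ofFormallyEtale B).D (algebraMap A B a) = algebraMap A B (x.D a) := by
  have h := KaehlerDifferential.isBaseChange_of_formallyEtale k A B
  have := h.lift_eq ((Algebra.linearMap A B) ∘ₗ x.D.liftKaehlerDifferential)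
    (KaehlerDifferential.D k A a)
  rw [KaehlerDifferential.map_D] at this
  have h2 : (x.ofFormallyEtale B).D (algebraMap A B a) = h.lift
      ((Algebra.linearMap A B) ∘ₗ x.D.liftKaehlerDifferential)
      (KaehlerDifferential.D k B (algebraMap A B a)) := rfl
  rw [h2]
  simpa using this

/-- Any derivation is a multiple of `d/dt`. -/
lemma derivation_apply (x : Coordinate k A) {M : Type*} [AddCommGroup M] [Module A M] [Module k M]
    [IsScalarTower k A M] (δ : Derivation k A M) (a : A) :
    δ a = x.D a • δ x.t := by
  have := congrArg δ.liftKaehlerDifferential (x.span (KaehlerDifferential.D k A a))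
  simpa using this

end Coordinate

lemma exists_coordinate {k A : Type u} [CommRing k] [CommRing A] [Algebra k A]
    [h : Algebra.IsStandardSmoothOfRelativeDimension 1 k A] : Nonempty (Coordinate k A) := by
  obtain ⟨ι, σ, _, _, P, hP⟩ := h
  have : Finite ι := inferInstance
  have hc : Nat.card ((Set.range P.map)ᶜ : Set ι) = 1 := by
    have := Set.ncard_compl (Set.range P.map)
    rw [Set.ncard_range_of_injective P.map_inj] at this
    exact this.trans hP
  have := (Nat.card_eq_one_iff_unique.mp hc)
  obtain ⟨h1, ⟨j⟩⟩ := this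
  let : Unique ((Set.range P.map)ᶜ : Set ι) := ⟨⟨j⟩, fun _ => h1.elim _ _⟩
  exact ⟨.ofBasis P.basisKaehler (P.val j) (by simp; rfl)⟩

end Coordinates

/-! ### Derivations in characteristic `p`: constants and Cartier's descent -/

section Constants

variable {k K : Type u} [Field k] [IsAlgClosed k] (p : ℕ) [hp : Fact p.Prime] [CharP k p]
  [Field K] [Algebra k K]

open IntermediateField in
/-- A finitely generated field `K` over `k` with coordinate `t` is generated by `t` over `K ^ p`:
it is purely inseparable over the field generated by `k`, `t` and `K ^ p`, and also separable, since
the differentials over that field vanish. -/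
lemma Coordinate.adjoin_frobenius_eq_top [CharP K p] [Algebra.EssFiniteType k K]
    (x : Coordinate k K) :
    Algebra.adjoin (frobenius K p).fieldRange {x.t} = ⊤ := by
  let F := (frobenius K p).fieldRange
  let L : IntermediateField k K := IntermediateField.adjoin k ({x.t} ∪ Set.range (frobenius K p))
  have htL : x.t ∈ L := IntermediateField.subset_adjoin _ _ (by simp)
  have hpL (a : K) : a ^ p ∈ L :=
    IntermediateField.subset_adjoin _ _ (Or.inr ⟨a, rfl⟩)
  have : Algebra.EssFiniteType L K := Algebra.EssFiniteType.of_comp k L K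
  have : Algebra.FormallyUnramified L K := by
    refine ⟨?_⟩
    refine subsingleton_of_forall_eq 0 fun ω => ?_
    have hω : ω ∈ Submodule.span K (Set.range (KaehlerDifferential.D L K)) := by
      rw [KaehlerDifferential.span_range_derivation]; trivial
    refine Submodule.span_induction ?_ rfl ?_ ?_ hω
    · rintro _ ⟨a, rfl⟩
      have h := x.derivation_apply ((KaehlerDifferential.D L K).restrictScalars k) a
      have h0 := (KaehlerDifferential.D L K).map_algebraMap ⟨x.t, htL⟩
      change KaehlerDifferential.D L K x.t = 0 at h0
      change KaehlerDifferential.D L K a = x.D a • KaehlerDifferential.D L K x.t at h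
      rw [h, h0, smul_zero]
    · intro a b _ _ ha hb
      rw [ha, hb, add_zero]
    · intro a b _ hb
      rw [hb, smul_zero]
  have : Algebra.IsSeparable L K := Algebra.FormallyUnramified.isSeparable L K
  have : IsPurelyInseparable L K := by
    have : ExpChar L p := expChar_of_injective_algebraMap (algebraMap k L).injective p
    rw [isPurelyInseparable_iff_pow_mem L p]
    intro a
    exact ⟨1, ⟨⟨a ^ p, hpL a⟩, by simp⟩⟩
  have hL : L = ⊤ := by
    refine eq_top_iff.mpr fun a _ => ?_
    obtain ⟨b, rfl⟩ := IsPurelyInseparable.surjective_algebraMap_of_isSeparable L K a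
    exact b.2
  have htint : IsIntegral F x.t := by
    refine ⟨Polynomial.X ^ p - Polynomial.C ⟨x.t ^ p, ⟨x.t, rfl⟩⟩,
      Polynomial.monic_X_pow_sub_C _ hp.out.ne_zero, ?_⟩
    simp [Subfield.algebraMap_ofSubfield]
  rw [← IntermediateField.adjoin_simple_toSubalgebra_of_isAlgebraic htint.isAlgebraic]
  refine eq_top_iff.mpr fun a _ => ?_
  have ha : a ∈ L.toSubfield := by rw [hL]; trivial
  rw [IntermediateField.adjoin_toSubfield] at ha
  have hle : Subfield.closure (Set.range (algebraMap k K) ∪ ({x.t} ∪ Set.range (frobenius K p))) ≤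
      (F⟮x.t⟯).toSubfield := by
    rw [Subfield.closure_le]
    have hF (b : K) (hb : b ∈ F) : b ∈ F⟮x.t⟯ :=
      (F⟮x.t⟯).algebraMap_mem ⟨b, hb⟩
    rintro b (⟨c, rfl⟩ | (hb | ⟨c, rfl⟩))
    · obtain ⟨d, rfl⟩ := (PerfectRing.bijective_frobenius (R := k) (p := p)).surjective c
      exact hF _ ⟨algebraMap k K d, by simp [frobenius_def]⟩
    · rw [Set.mem_singleton_iff.mp hb]
      exact IntermediateField.mem_adjoin_simple_self _ _
    · exact hF _ ⟨c, rfl⟩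
  exact hle ha

omit [IsAlgClosed k] hp in
lemma derivation_pow_prime {A M : Type u} [CommRing A] [Algebra k A] [AddCommGroup M] [Module A M]
    [Module k M] (D : Derivation k A M) (a : A) : D (a ^ p) = 0 := by
  have h : ((p : ℕ) : A) = 0 := by
    rw [← map_natCast (algebraMap k A), CharP.cast_eq_zero, map_zero]
  rw [Derivation.leibniz_pow, ← Nat.cast_smul_eq_nsmul A, h, zero_smul]

omit [IsAlgClosed k] hp in
/-- The powers `1, …, t^(n-1)` are independent over constants for `n ≤ p`. -/
lemma Coordinate.eq_zero_of_sum_eq_zero (x : Coordinate k K) (n : ℕ) (hn : n ≤ p)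
    (c : ℕ → K) (hc : ∀ i, x.D (c i) = 0)
    (h : ∑ i ∈ Finset.range n, c i * x.t ^ i = 0) : ∀ i < n, c i = 0 := by
  have : CharP K p := charP_of_injective_algebraMap (algebraMap k K).injective p
  induction n generalizing c with
  | zero => simp
  | succ n ih =>
    have h1 := congrArg x.D h
    rw [map_zero, map_sum, Finset.sum_range_succ'] at h1
    have h2 : ∑ i ∈ Finset.range n, (((i + 1 : ℕ) : K) * c (i + 1)) * x.t ^ i = 0 := by
      rw [← h1]
      simp only [Derivation.leibniz, Derivation.leibniz_pow, hc, x.D_t, pow_zero,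
        Derivation.map_one_eq_zero]
      simp only [smul_zero, add_zero]
      refine Finset.sum_congr rfl fun i _ => ?_
      simp
      ring
    have h3 := ih (by omega) (fun i => ((i + 1 : ℕ) : K) * c (i + 1)) (fun i => by
      rw [Derivation.leibniz, hc, Derivation.map_natCast]; simp) h2
    have h4 : ∀ i < n, c (i + 1) = 0 := by
      intro i hi
      refine (mul_eq_zero.mp (h3 i hi)).resolve_left ?_
      rw [CharP.cast_eq_zero_iff K p]
      exact fun hd => absurd (Nat.le_of_dvd (by omega) hd) (by omega)
    rw [Finset.sum_range_succ'] at h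
    rw [Finset.sum_eq_zero (fun i hi => by rw [h4 i (Finset.mem_range.mp hi), zero_mul])] at h
    intro i hi
    cases i with
    | zero => simpa using h
    | succ i => exact h4 i (by omega)

/-- In the function field of a curve, the constants of a nonzero derivation are `p`-th powers. -/
theorem Coordinate.exists_pow_eq_of_D_eq_zero [Algebra.EssFiniteType k K]
    (x : Coordinate k K) {a : K} (ha : x.D a = 0) : ∃ b, b ^ p = a := by
  have : CharP K p := charP_of_injective_algebraMap (algebraMap k K).injective p
  let F := (frobenius K p).fieldRange
  have hmem : a ∈ Algebra.adjoin F {x.t} := by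
    rw [x.adjoin_frobenius_eq_top p]; trivial
  rw [Algebra.adjoin_singleton_eq_range_aeval] at hmem
  obtain ⟨q, hq⟩ := hmem
  let f : Polynomial F := Polynomial.X ^ p - Polynomial.C ⟨x.t ^ p, ⟨x.t, rfl⟩⟩
  have hf : f.Monic := Polynomial.monic_X_pow_sub_C _ hp.out.ne_zero
  have hft : Polynomial.aeval x.t f = 0 := by
    simp [f, Subfield.algebraMap_ofSubfield]
  have hfd : f.natDegree = p := Polynomial.natDegree_X_pow_sub_C
  have hqa : Polynomial.aeval x.t (q %ₘ f) = a := by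
    rw [Polynomial.aeval_modByMonic_eq_self_of_root hft]
    exact hq
  have hdeg : (q %ₘ f).natDegree < p := by
    conv_rhs => rw [← hfd]
    refine Polynomial.natDegree_modByMonic_lt q hf fun h => ?_
    rw [h, Polynomial.natDegree_one] at hfd
    exact hp.out.ne_zero hfd.symm
  rw [Polynomial.aeval_eq_sum_range' hdeg] at hqa
  have hcf (i : ℕ) : ∃ b : K, b ^ p = ((q %ₘ f).coeff i : K) := by
    obtain ⟨b, hb⟩ := ((q %ₘ f).coeff i).2
    exact ⟨b, hb⟩
  choose b hb using hcf
  have hpos := hp.out.pos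
  -- `a = ∑ b i ^ p * t ^ i`; as `a` is a constant, comparing coefficients gives `a = b 0 ^ p`
  have hsum : ∑ i ∈ Finset.range p,
      (if i = 0 then b 0 ^ p - a else b i ^ p) * x.t ^ i = 0 := by
    obtain ⟨n, hn⟩ : ∃ n, p = n + 1 := ⟨p - 1, by omega⟩
    rw [hn, Finset.sum_range_succ'] at hqa ⊢
    simp only [Nat.add_eq_zero_iff, one_ne_zero, and_false, if_false, if_true, pow_zero, mul_one]
    rw [← hqa]
    simp only [Algebra.smul_def]
    rw [← hn]
    simp only [hb, pow_zero, mul_one]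
    simp only [Subfield.algebraMap_ofSubfield, Subfield.subtype_apply]
    ring
  have h := x.eq_zero_of_sum_eq_zero p p le_rfl _ (fun i => by
    split_ifs
    · rw [map_sub, derivation_pow_prime p, ha, sub_zero]
    · exact derivation_pow_prime p _ _) hsum 0 hpos
  exact ⟨b 0, by simpa [sub_eq_zero] using h⟩

end Constants

section Cartier

variable {k A M : Type u} [Field k] (p : ℕ) [hp : Fact p.Prime] [CharP k p]
  [CommRing A] [Algebra k A] [AddCommGroup M] [Module A M]

/-- Cartier's descent argument: if `T` satisfies the Leibniz rule over `d/dt` and `T ^ p m = 0`,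
then `m` is a combination of elements annihilated by `T`. -/
theorem Coordinate.mem_span_of_iterate_eq_zero (x : Coordinate k A) (T : M →+ M)
    (hT : ∀ (a : A) (m : M), T (a • m) = x.D a • m + a • T m) {m : M} (hm : T^[p] m = 0) :
    m ∈ Submodule.span A {u : M | T u = 0} := by
  have key : ∀ n ≤ p, ∀ m : M, T^[n] m = 0 → m ∈ Submodule.span A {u : M | T u = 0} := by
    intro n
    induction n with
    | zero => rintro - m hm; rw [show m = 0 from hm]; exact zero_mem _
    | succ n ih =>
      intro hn m hm
      rw [Function.iterate_succ_apply'] at hm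
      have hu : ∀ (j : ℕ) (u : M), T u = 0 → T^[j] (x.t ^ j • u) = (j.factorial : A) • u := by
        intro j
        induction j with
        | zero => intro u _; simp
        | succ j ihj =>
          intro u hu
          rw [Function.iterate_succ_apply, hT, hu, smul_zero, add_zero, Derivation.leibniz_pow,
            x.D_t]
          have : ((j + 1) • x.t ^ (j + 1 - 1) • (1 : A)) • u = x.t ^ j • (((j + 1 : ℕ) : A) • u) := by
            rw [smul_smul]
            congr 1
            simp
            ring
          rw [this, ihj, smul_smul, Nat.factorial_succ]
          · push_cast; rw [mul_comm]
          · rw [hT, hu, Derivation.map_natCast]; simp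
      have hfac : ((n.factorial : ℕ) : k) ≠ 0 := by
        rw [Ne, CharP.cast_eq_zero_iff k p, hp.out.dvd_factorial]
        omega
      set u := T^[n] m with hu_def
      -- `T ^ n` maps `t ^ n / n! • u` to `u`, so subtracting it from `m` lowers the exponent
      let c : A := algebraMap k A ((n.factorial : k)⁻¹)
      have hTc : T (c • u) = 0 := by rw [hT, hm, Derivation.map_algebraMap]; simp
      have hmem : m - x.t ^ n • (c • u) ∈ Submodule.span A {u : M | T u = 0} := by
        refine ih (by omega) _ ?_
        rw [iterate_map_sub, hu n _ hTc, smul_smul, ← map_natCast (algebraMap k A), ← map_mul,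
          mul_inv_cancel₀ hfac, map_one, one_smul, sub_self]
      have hmem2 : x.t ^ n • (c • u) ∈ Submodule.span A {u : M | T u = 0} :=
        Submodule.smul_mem _ _ (Submodule.subset_span hTc)
      simpa using add_mem hmem hmem2
  exact key p le_rfl m hm

lemma Coordinate.derivationPow_D (x : Coordinate k A) : derivationPow p x.D = 0 := by
  ext a
  rw [x.derivation_apply (derivationPow p x.D), derivationPow_apply]
  obtain ⟨n, hn⟩ : ∃ n, p = n + 2 := ⟨p - 2, by have := hp.out.two_le; omega⟩
  have : x.D^[p] x.t = 0 := by
    rw [hn, Function.iterate_succ_apply, Function.iterate_succ_apply, x.D_t,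
      Derivation.map_one_eq_zero]
    exact iterate_map_zero x.D n
  rw [this]; simp

end Cartier

/-! ### Local structure of a smooth affine curve -/

section LocalStructure

variable {k A : Type u} [Field k] [IsAlgClosed k] [CommRing A] [Algebra k A]

/-- The cotangent space at a closed point `m` is generated by the class of `t - t(m)`. It is seen by
applying `δ a = D a • δ t` to the derivation `a ↦ a - a(m)` with values in `m / m²`. -/
lemma Coordinate.maximalIdeal_le [Algebra.FiniteType k A] (x : Coordinate k A) (m : Ideal A)
    [m.IsMaximal] : ∃ c : k, x.t - algebraMap k A c ∈ m ∧
      m ≤ Ideal.span {x.t - algebraMap k A c} ⊔ m ^ 2 := by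
  let _ : Field (A ⧸ m) := Ideal.Quotient.field m
  have : Module.Finite k (A ⧸ m) := finite_of_finite_type_of_isJacobsonRing k (A ⧸ m)
  have hbij : Function.Bijective (algebraMap k (A ⧸ m)) :=
    IsAlgClosed.algebraMap_bijective_of_isIntegral
  have hex (a : A) : ∃ c : k, a - algebraMap k A c ∈ m := by
    obtain ⟨c, hc⟩ := hbij.surjective (Ideal.Quotient.mk m a)
    refine ⟨c, ?_⟩
    rw [← Ideal.Quotient.eq_zero_iff_mem, map_sub, ← hc]
    exact sub_self _
  choose ev hev using hex
  have hev_unique (a : A) (c : k) (h : a - algebraMap k A c ∈ m) : ev a = c := by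
    apply hbij.injective
    have h1 := Ideal.Quotient.eq_zero_iff_mem.mpr (hev a)
    have h2 := Ideal.Quotient.eq_zero_iff_mem.mpr h
    rw [map_sub, sub_eq_zero] at h1 h2
    exact h1.symm.trans h2
  have hev_add (a b : A) : ev (a + b) = ev a + ev b := by
    apply hev_unique
    convert! add_mem (hev a) (hev b) using 1
    rw [map_add]; ring
  have hev_smul (c : k) (a : A) : ev (c • a) = c * ev a := by
    apply hev_unique
    convert! m.mul_mem_left (algebraMap k A c) (hev a) using 1
    rw [map_mul, Algebra.smul_def]; ring
  have hev_one : ev 1 = 1 := by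
    apply hev_unique; simp
  have hev_mul (a b : A) : ev (a * b) = ev a * ev b := by
    apply hev_unique
    convert! add_mem (m.mul_mem_left a (hev b)) (m.mul_mem_left (algebraMap k A (ev b)) (hev a))
      using 1
    rw [map_mul]; ring
  -- the derivation `a ↦ a - a(m)` into `m / m²`
  let q : A →ₗ[A] (A ⧸ (m ^ 2)) := (Ideal.Quotient.mkₐ A (m ^ 2)).toLinearMap
  let I : Submodule A (A ⧸ (m ^ 2)) := Submodule.map q m
  let L : A →ₗ[k] I :=
    { toFun a := ⟨q (a - algebraMap k A (ev a)), Submodule.mem_map_of_mem (hev a)⟩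
      map_add' a b := by
        ext
        change q _ = q _ + q _
        rw [← map_add, hev_add, map_add]; congr 1; ring
      map_smul' c a := by
        ext
        change q _ = c • q _
        rw [hev_smul, ← algebraMap_smul A c (q _), ← map_smul, map_mul, Algebra.smul_def, smul_eq_mul]
        congr 1; ring }
  have hq (a : A) (ha : a ∈ m) (b : A) (hb : b ∈ m) : q (a * b) = 0 := by
    change Ideal.Quotient.mk (m ^ 2) (a * b) = 0
    rw [Ideal.Quotient.eq_zero_iff_mem, pow_two]
    exact Ideal.mul_mem_mul ha hb
  let δ : Derivation k A I := Derivation.mk' L (by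
    intro a b
    ext
    change q _ = a • q _ + b • q _
    rw [← map_smul, ← map_smul, ← map_add, ← sub_eq_zero, ← map_sub, hev_mul, map_mul]
    rw [← neg_zero, ← neg_eq_iff_eq_neg, ← map_neg, ← hq _ (hev a) _ (hev b)]
    congr 1
    simp only [smul_eq_mul]
    ring)
  refine ⟨ev x.t, hev _, fun a ha => ?_⟩
  have h := congrArg Subtype.val (x.derivation_apply δ a)
  change q (a - algebraMap k A (ev a)) = x.D a • q (x.t - algebraMap k A (ev x.t)) at h
  have hea : ev a = 0 := hev_unique a 0 (by simpa using ha)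
  rw [hea, map_zero, sub_zero, ← map_smul, ← sub_eq_zero, ← map_sub] at h
  have h' : a - x.D a • (x.t - algebraMap k A (ev x.t)) ∈ m ^ 2 :=
    Ideal.Quotient.eq_zero_iff_mem.mp h
  rw [← sub_add_cancel a (x.D a • (x.t - algebraMap k A (ev x.t))), add_comm]
  exact Submodule.add_mem_sup (Ideal.mul_mem_left _ _ (Ideal.mem_span_singleton_self _)) h'

/-- The local ring at a closed point of a smooth affine curve is a principal ideal domain, by
Nakayama's lemma and the description of the cotangent space. -/
theorem Coordinate.isPrincipalIdealRing_localization [Algebra.FiniteType k A] [IsDomain A]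
    (x : Coordinate k A) (m : Ideal A) [m.IsMaximal] :
    IsPrincipalIdealRing (Localization.AtPrime m) := by
  have : IsNoetherianRing A := Algebra.FiniteType.isNoetherianRing k A
  have : IsNoetherianRing (Localization.AtPrime m) :=
    IsLocalization.isNoetherianRing m.primeCompl _ inferInstance
  have : IsDomain (Localization.AtPrime m) :=
    IsLocalization.isDomain_localization m.primeCompl_le_nonZeroDivisors
  obtain ⟨c, hc, hm⟩ := x.maximalIdeal_le m
  have htfae := tfae_of_isNoetherianRing_of_isLocalRing_of_isDomain (Localization.AtPrime m)
  refine (htfae.out 4 0).mp ?_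
  set R := Localization.AtPrime m
  have hmap : Ideal.map (algebraMap A R) m = IsLocalRing.maximalIdeal R :=
    Localization.AtPrime.map_eq_maximalIdeal
  have h1 : IsLocalRing.maximalIdeal R ≤
      Ideal.span {algebraMap A R (x.t - algebraMap k A c)} ⊔
        IsLocalRing.maximalIdeal R • IsLocalRing.maximalIdeal R := by
    have := Ideal.map_mono (f := algebraMap A R) hm
    rwa [Ideal.map_sup, Ideal.map_span, Set.image_singleton, Ideal.map_pow, hmap, pow_two] at this
  have h2 : IsLocalRing.maximalIdeal R ≤ Ideal.span {algebraMap A R (x.t - algebraMap k A c)} :=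
    Submodule.le_of_le_smul_of_le_jacobson_bot (IsNoetherian.noetherian _)
      (IsLocalRing.jacobson_eq_maximalIdeal ⊥ bot_ne_top).ge h1
  refine ⟨⟨algebraMap A R (x.t - algebraMap k A c), le_antisymm h2 ?_⟩⟩
  rw [← hmap]
  exact (Ideal.span_singleton_le_iff_mem _).mpr (Ideal.mem_map_of_mem _ hc)

lemma frobenius_finite (p : ℕ) [Fact p.Prime] [CharP k p] [ExpChar A p] [Algebra.FiniteType k A] :
    (frobenius A p).Finite := by
  refine RingHom.IsIntegral.to_finite ?_ ?_
  · intro a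
    exact ⟨Polynomial.X ^ p - Polynomial.C a,
      Polynomial.monic_X_pow_sub_C _ (Fact.out : p.Prime).ne_zero, by simp [frobenius_def]⟩
  · have h1 : (algebraMap k A).FiniteType := by
      rwa [RingHom.finiteType_algebraMap]
    have h2 : ((frobenius A p).comp (algebraMap k A)).FiniteType := by
      have : (frobenius A p).comp (algebraMap k A) = (algebraMap k A).comp (frobenius k p) := by
        ext; simp [frobenius_def]
      rw [this]
      exact h1.comp (RingHom.FiniteType.of_surjective _
        (PerfectRing.bijective_frobenius (R := k) (p := p)).surjective)
    exact RingHom.FiniteType.of_comp_finiteType h2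

end LocalStructure

/-! ### The lattice of horizontal vectors -/

section Lattice

/-- A module embedding semilinearly into a finite free module over a finite extension is finite. -/
lemma finite_of_semilinear_injective {A B M : Type u} [CommRing A] [IsNoetherianRing A]
    [CommRing B] (φ : A →+* B) (hφ : φ.Finite) [AddCommGroup M] [Module A M] {r : ℕ}
    (ν : M →+ (Fin r → B)) (hν : ∀ (a : A) (m : M), ν (a • m) = φ a • ν m)
    (hinj : Function.Injective ν) : Module.Finite A M := by
  let _ : Algebra A B := φ.toAlgebra
  have : Module.Finite A B := hφ
  have : Module.Finite A (Fin r → B) := inferInstance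
  let ν' : M →ₗ[A] (Fin r → B) :=
    { ν with
      map_smul' := fun a m => by
        ext i
        change ν (a • m) i = φ a * ν m i
        rw [hν]; rfl }
  exact Module.Finite.of_injective ν' hinj

variable {k A K : Type u} [Field k] [IsAlgClosed k] (p : ℕ) [hp : Fact p.Prime] [CharP k p]
  [CommRing A] [IsDomain A] [Algebra k A] [Algebra.FiniteType k A] [Field K] [Algebra A K]
  [IsFractionRing A K] [Algebra k K] [IsScalarTower k A K] {r : ℕ}

omit [IsDomain A] in
/-- A vector in the span over `A_m` of an `A`-module lies in that module up to a denominator. -/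
lemma exists_smul_mem_of_mem_span {R V : Type u} [CommRing R] [Algebra A R] (m : Ideal A)
    [m.IsPrime] [IsLocalization.AtPrime R m] [AddCommGroup V] [Module A V] [Module R V]
    [IsScalarTower A R V] (M : Submodule A V) {v : V} (hv : v ∈ Submodule.span R (M : Set V)) :
    ∃ s ∈ m.primeCompl, s • v ∈ M := by
  induction hv using Submodule.span_induction with
  | mem v hv => exact ⟨1, one_mem _, by simpa using hv⟩
  | zero => exact ⟨1, one_mem _, by simp⟩
  | add v w _ _ hv hw =>
    obtain ⟨s, hs, hsv⟩ := hv
    obtain ⟨t, ht, htw⟩ := hw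
    refine ⟨s * t, mul_mem hs ht, ?_⟩
    rw [smul_add]
    refine add_mem ?_ ?_
    · rw [mul_comm, mul_smul]; exact M.smul_mem _ hsv
    · rw [mul_smul]; exact M.smul_mem _ htw
  | smul a v _ hv =>
    obtain ⟨s, hs, hsv⟩ := hv
    obtain ⟨⟨b, t⟩, hbt⟩ := IsLocalization.surj m.primeCompl a
    refine ⟨t * s, mul_mem t.2 hs, ?_⟩
    have : ((t : A) * s) • a • v = b • s • v := by
      rw [mul_smul, smul_comm s a v, ← smul_assoc, Algebra.smul_def, mul_comm, hbt,
        algebraMap_smul]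
    rw [this]
    exact M.smul_mem _ hsv

/-- Let `T` be an operator on `K ^ r` that satisfies the Leibniz rule over `d/dt` and whose kernel
spans. Then, near a given closed point of `Spec A`, there are `r` independent vectors of `A ^ r` in
the kernel such that, up to the denominator `g ^ p`, the vectors of `A ^ r` in the kernel are their
combinations with `p`-th powers as coefficients. -/
theorem Coordinate.exists_horizontal_lattice_basis (x : Coordinate k A) (y : Coordinate k K)
    (T : (Fin r → K) →+ (Fin r → K)) (hT : ∀ (a : K) v, T (a • v) = y.D a • v + a • T v)
    (hspan : Submodule.span K {v | T v = 0} = ⊤) (m : Ideal A) [m.IsMaximal] :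
    ∃ (f : Fin r → Fin r → A), ∃ g ∉ m, (∀ i, T (algebraMap A K ∘ f i) = 0) ∧
      LinearIndependent K (fun i => algebraMap A K ∘ f i) ∧
      ∀ n : Fin r → A, T (algebraMap A K ∘ n) = 0 →
        ∃ d : Fin r → A, g ^ p • n = ∑ i, d i ^ p • f i := by
  classical
  have hinjA : Function.Injective (algebraMap A K) := IsFractionRing.injective A K
  have hcharA : CharP A p := charP_of_injective_algebraMap (algebraMap k A).injective p
  have hcharK : CharP K p := charP_of_injective_algebraMap (algebraMap k K).injective p
  have : IsNoetherianRing A := Algebra.FiniteType.isNoetherianRing k A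
  have : Algebra.EssFiniteType A K := Algebra.EssFiniteType.of_isLocalization K (nonZeroDivisors A)
  have : Algebra.EssFiniteType k K := Algebra.EssFiniteType.comp k A K
  -- a basis of horizontal vectors
  obtain ⟨w, hw⟩ : ∃ w : Module.Basis (Fin r) K (Fin r → K), ∀ i, T (w i) = 0 := by
    obtain ⟨b, hb, hbs, hli⟩ := exists_linearIndependent K {v : Fin r → K | T v = 0}
    rw [hspan] at hbs
    let w0 : Module.Basis b K (Fin r → K) := Module.Basis.mk hli (by simpa using hbs.ge)
    have : Finite b := Module.Finite.finite_basis w0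
    have : Fintype b := Fintype.ofFinite b
    have hcard : Fintype.card b = Fintype.card (Fin r) := by
      rw [← Module.finrank_eq_card_basis w0]; simp
    refine ⟨w0.reindex (Fintype.equivOfCardEq hcard), fun i => ?_⟩
    rw [Module.Basis.reindex_apply, Module.Basis.mk_apply]
    exact hb (Subtype.mem _)
  -- horizontal vectors are the combinations of the `w i` with `p`-th powers as coefficients
  let θ : (Fin r → K) →+ (Fin r → K) := AddMonoidHom.mk' (fun c => ∑ i, c i ^ p • w i) (by
    intro c d
    simp only [Pi.add_apply, add_pow_char, add_smul, Finset.sum_add_distrib])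
  have hθ (c) : θ c = ∑ i, c i ^ p • w i := rfl
  have hθ_smul (a : K) (c) : θ (a • c) = a ^ p • θ c := by
    rw [hθ, hθ, Finset.smul_sum]
    exact Finset.sum_congr rfl fun i _ => by
      rw [Pi.smul_apply, smul_eq_mul, mul_pow, mul_smul]
  have hθ_inj : Function.Injective θ := by
    refine (injective_iff_map_eq_zero _).mpr fun c hc => ?_
    ext i
    have := Fintype.linearIndependent_iff.mp w.linearIndependent _ hc i
    exact pow_eq_zero_iff hp.out.ne_zero |>.mp this
  have hTsum (c : Fin r → K) : T (∑ i, c i • w i) = ∑ i, y.D (c i) • w i := by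
    rw [map_sum]
    exact Finset.sum_congr rfl fun i _ => by rw [hT, hw, smul_zero, add_zero]
  have hTθ (c) : T (θ c) = 0 := by
    rw [hθ, hTsum (fun i => c i ^ p)]
    exact Finset.sum_eq_zero fun i _ => by rw [derivation_pow_prime p, zero_smul]
  have hθ_surj (v) (hv : T v = 0) : ∃ c, θ c = v := by
    rw [← w.sum_repr v, hTsum (fun i => w.repr v i)] at hv
    have h0 := Fintype.linearIndependent_iff.mp w.linearIndependent _ hv
    choose c hc using fun i => y.exists_pow_eq_of_D_eq_zero p (h0 i)
    refine ⟨c, ?_⟩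
    rw [hθ]
    simp only [hc, w.sum_repr]
  -- the lattice of those `c` for which `θ c` is integral
  let M : Submodule A (Fin r → K) :=
    { carrier := {c | ∃ n : Fin r → A, θ c = algebraMap A K ∘ n}
      zero_mem' := ⟨0, by rw [map_zero]; ext; simp⟩
      add_mem' := by
        rintro c d ⟨n, hn⟩ ⟨n', hn'⟩
        exact ⟨n + n', by rw [map_add, hn, hn']; ext; simp⟩
      smul_mem' := by
        rintro a c ⟨n, hn⟩
        refine ⟨a ^ p • n, ?_⟩
        rw [← algebraMap_smul K a c, hθ_smul, hn]
        ext; simp }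
  have hM (c : M) : ∃ n : Fin r → A, θ c = algebraMap A K ∘ n := c.2
  choose ν hν using hM
  have hcomp_inj : Function.Injective (fun n : Fin r → A => algebraMap A K ∘ n) :=
    hinjA.comp_left
  -- `c ↦ θ c` embeds `M` into `A ^ r`, semilinearly over the finite Frobenius map
  have hfin : Module.Finite A M := by
    refine finite_of_semilinear_injective (frobenius A p) (frobenius_finite (k := k) p)
      (AddMonoidHom.mk' ν ?_) ?_ ?_
    · intro c d
      apply hcomp_inj
      change algebraMap A K ∘ _ = algebraMap A K ∘ _
      rw [← hν, Submodule.coe_add, map_add, hν, hν]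
      ext; simp
    · intro a c
      apply hcomp_inj
      change algebraMap A K ∘ ν (a • c) = algebraMap A K ∘ (frobenius A p a • ν c)
      rw [← hν, Submodule.coe_smul, ← algebraMap_smul K a, hθ_smul, hν]
      ext; simp [frobenius_def]
    · intro c d h
      apply Subtype.ext
      apply hθ_inj
      rw [hν, hν]
      exact congrArg (algebraMap A K ∘ ·) h
  have hMspan : Submodule.span K (M : Set (Fin r → K)) = ⊤ := by
    refine eq_top_iff.mpr fun c _ => ?_
    obtain ⟨⟨b, hb⟩, hbc⟩ := IsLocalization.exist_integer_multiples_of_finite (nonZeroDivisors A) (θ c)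
    choose n hn using hbc
    have hmem : algebraMap A K b • c ∈ M := by
      refine ⟨fun i => b ^ (p - 1) * n i, ?_⟩
      rw [hθ_smul]
      ext i
      have := hn i
      simp only [Algebra.smul_def] at this
      obtain ⟨q, hq⟩ : ∃ q, p = q + 1 := ⟨p - 1, by have := hp.out.pos; omega⟩
      rw [Function.comp_apply, map_mul, this, hq, map_pow, Pi.smul_apply, smul_eq_mul, pow_succ,
        Nat.add_sub_cancel]
      ring
    have hb0 : algebraMap A K b ≠ 0 := by
      rw [Ne, FaithfulSMul.algebraMap_eq_zero_iff]
      exact nonZeroDivisors.ne_zero hb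
    have := Submodule.smul_mem (Submodule.span K (M : Set (Fin r → K))) (algebraMap A K b)⁻¹
      (Submodule.subset_span hmem)
    rwa [smul_smul, inv_mul_cancel₀ hb0, one_smul] at this
  -- pass to the local ring
  let R := Localization.AtPrime m
  have hle := m.primeCompl_le_nonZeroDivisors
  let _ : Algebra R K := IsLocalization.localizationAlgebraOfSubmonoidLe R K m.primeCompl
    (nonZeroDivisors A) hle
  have : IsScalarTower A R K := IsLocalization.localization_isScalarTower_of_submonoid_le R K
    m.primeCompl (nonZeroDivisors A) hle
  have : IsDomain R := IsLocalization.isDomain_localization hle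
  have : IsPrincipalIdealRing R := x.isPrincipalIdealRing_localization m
  have : IsFractionRing R K :=
    IsFractionRing.isFractionRing_of_isDomain_of_isLocalization m.primeCompl R K
  let L : Submodule R (Fin r → K) := Submodule.span R (M : Set (Fin r → K))
  have hMfg : M.FG := Module.Finite.iff_fg.mp hfin
  have hL : Submodule.IsLattice K L := by
    refine ⟨?_, ?_⟩
    · obtain ⟨S, hS⟩ := hMfg
      refine ⟨S, ?_⟩
      change _ = Submodule.span R (M : Set (Fin r → K))
      rw [← hS, Submodule.span_span_of_tower]
    · rw [eq_top_iff, ← hMspan]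
      exact Submodule.span_mono Submodule.subset_span
  have hfree : Module.Free R L := Submodule.IsLattice.free K L
  have hrank : Module.finrank R L = r := by
    rw [Submodule.IsLattice.finrank_of_pi (K := K) L, Fintype.card_fin]
  let b0 : Module.Basis (Fin r) R L := Module.finBasisOfFinrankEq R L hrank
  have hb0 (i : Fin r) : ∃ s ∈ m.primeCompl, s • (b0 i : Fin r → K) ∈ M :=
    exists_smul_mem_of_mem_span m M (b0 i).2
  choose s hs hsb using hb0
  let s' := ∏ i, s i
  have hs' : s' ∈ m.primeCompl := prod_mem fun i _ => hs i
  have hs'b (i : Fin r) : s' • (b0 i : Fin r → K) ∈ M := by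
    obtain ⟨q, hq⟩ := Finset.dvd_prod_of_mem s (Finset.mem_univ i)
    change (∏ i, s i) • _ ∈ M
    rw [hq, mul_comm, mul_smul]
    exact M.smul_mem _ (hsb i)
  let b (i : Fin r) : M := ⟨s' • (b0 i : Fin r → K), hs'b i⟩
  -- the basis of the localization has denominators: `b` generates `M` up to some `g ∉ m`
  let M1 : Submodule A (Fin r → K) := Submodule.span A (Set.range fun i => (b i : Fin r → K))
  have hM1 (v) (hv : v ∈ M) : ∃ g ∈ m.primeCompl, g • v ∈ M1 := by
    let v' : L := ⟨v, Submodule.subset_span hv⟩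
    obtain ⟨⟨c, hc⟩, hcρ⟩ := IsLocalization.exist_integer_multiples_of_finite m.primeCompl
      (b0.repr v' : Fin r → R)
    choose a ha using hcρ
    refine ⟨s' * c, mul_mem hs' hc, ?_⟩
    have h1 : v = ∑ i, b0.repr v' i • (b0 i : Fin r → K) := by
      have h0 := (congrArg L.subtype (b0.sum_repr v')).symm
      rwa [map_sum] at h0
    have h2 : (s' * c) • v = ∑ i, a i • (b i : Fin r → K) := by
      conv_lhs => rw [h1]
      rw [Finset.smul_sum]
      refine Finset.sum_congr rfl fun i _ => ?_
      change _ = a i • s' • (b0 i : Fin r → K)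
      rw [smul_comm (a i), mul_smul, ← algebraMap_smul R (a i), ha i, smul_assoc]
    rw [h2]
    exact sum_mem fun i _ => Submodule.smul_mem _ _ (Submodule.subset_span ⟨i, rfl⟩)
  obtain ⟨g, hg, hgM⟩ : ∃ g ∈ m.primeCompl, ∀ v ∈ M, g • v ∈ M1 := by
    obtain ⟨S, hS⟩ := hMfg
    have hSM (v : S) : (v : Fin r → K) ∈ M := by
      rw [← hS]; exact Submodule.subset_span v.2
    choose g hg hgv using fun v : S => hM1 v (hSM v)
    refine ⟨∏ v, g v, prod_mem fun v _ => hg v, ?_⟩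
    have hle : M ≤ M1.comap (LinearMap.lsmul A (Fin r → K) (∏ v, g v)) := by
      rw [← hS, Submodule.span_le]
      intro v hv
      obtain ⟨q, hq⟩ := Finset.dvd_prod_of_mem g (Finset.mem_univ ⟨v, hv⟩)
      change (∏ v, g v) • v ∈ M1
      rw [hq, mul_comm, mul_smul]
      exact M1.smul_mem _ (hgv ⟨v, hv⟩)
    exact fun v hv => hle hv
  have key (n : Fin r → A) (hn : T (algebraMap A K ∘ n) = 0) :
      ∃ d : Fin r → A, g ^ p • n = ∑ i, d i ^ p • ν (b i) := by
    obtain ⟨c, hc⟩ := hθ_surj _ hn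
    have h1 := hgM c ⟨n, hc⟩
    rw [Submodule.mem_span_range_iff_exists_fun] at h1
    obtain ⟨d, hd⟩ := h1
    refine ⟨d, hcomp_inj ?_⟩
    have h2 := congrArg θ hd
    rw [map_sum, ← algebraMap_smul K g, hθ_smul, hc] at h2
    simp only [← algebraMap_smul K (d _), hθ_smul, hν] at h2
    ext i
    have h3 := congrFun h2 i
    simp only [Finset.sum_apply, Pi.smul_apply, Function.comp_apply, smul_eq_mul, ← map_pow,
      ← map_mul, ← map_sum] at h3 ⊢
    exact h3.symm
  refine ⟨fun i => ν (b i), g, hg, fun i => by rw [← hν]; exact hTθ _, ?_, key⟩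
  -- the `r` vectors `θ (b i)` span, hence are independent
  refine linearIndependent_of_top_le_span_of_card_eq_finrank ?_ (by simp)
  rw [← hspan, Submodule.span_le]
  intro v hv
  obtain ⟨⟨a, ha⟩, hav⟩ := IsLocalization.exist_integer_multiples_of_finite (nonZeroDivisors A) v
  choose n hn using hav
  have hn' : (algebraMap A K a ^ p) • v = algebraMap A K ∘ (a ^ (p - 1) • n) := by
    ext i
    have := hn i
    simp only [Algebra.smul_def] at this
    obtain ⟨q, hq⟩ : ∃ q, p = q + 1 := ⟨p - 1, by have := hp.out.pos; omega⟩
    rw [Function.comp_apply, Pi.smul_apply, Pi.smul_apply, smul_eq_mul, smul_eq_mul, map_mul, this,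
      hq, map_pow, pow_succ, Nat.add_sub_cancel]
    ring
  have hTn : T (algebraMap A K ∘ (a ^ (p - 1) • n)) = 0 := by
    rw [← hn', hT, derivation_pow_prime p, show T v = 0 from hv, smul_zero, zero_smul, add_zero]
  obtain ⟨d, hd⟩ := key _ hTn
  have hne : algebraMap A K (g * a) ^ p ≠ 0 := by
    refine pow_ne_zero _ ?_
    rw [Ne, FaithfulSMul.algebraMap_eq_zero_iff]
    exact mul_ne_zero (fun h => hg (h ▸ m.zero_mem)) (nonZeroDivisors.ne_zero ha)
  have hmem : algebraMap A K (g * a) ^ p • v ∈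
      Submodule.span K (Set.range fun i => algebraMap A K ∘ ν (b i)) := by
    have : algebraMap A K (g * a) ^ p • v =
        ∑ i, algebraMap A K (d i) ^ p • (algebraMap A K ∘ ν (b i)) := by
      rw [map_mul, mul_pow, mul_smul, hn']
      ext j
      have := congrArg (algebraMap A K) (congrFun hd j)
      simpa using this
    rw [this]
    exact sum_mem fun i _ => Submodule.smul_mem _ _ (Submodule.subset_span ⟨i, rfl⟩)
  have := Submodule.smul_mem _ (algebraMap A K (g * a) ^ p)⁻¹ hmem
  rwa [smul_smul, inv_mul_cancel₀ hne, one_smul] at this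

end Lattice

/-! ### Sections of modules, subsheaves and frames -/

section Sections

variable {X : Scheme.{u}}

/-- Restriction of functions. -/
def resO {U V : X.Opens} (h : V ≤ U) : Γ(X, U) →+* Γ(X, V) :=
  (X.presheaf.map (homOfLE h).op).hom

/-- Restriction of sections of a module. -/
def resM (M : X.Modules) {U V : X.Opens} (h : V ≤ U) : Γ(M, U) →+ Γ(M, V) :=
  (M.presheaf.map (homOfLE h).op).hom

@[simp] lemma resO_self {U : X.Opens} (h : U ≤ U) (a : Γ(X, U)) : resO h a = a := by
  change (X.presheaf.map (𝟙 (op U))) a = a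
  rw [X.presheaf.map_id]; rfl

@[simp] lemma resO_resO {U V W : X.Opens} (h : V ≤ U) (h' : W ≤ V) (a : Γ(X, U)) :
    resO h' (resO h a) = resO (h'.trans h) a := by
  change (X.presheaf.map _ ≫ X.presheaf.map _) a = _
  rw [← X.presheaf.map_comp]; rfl

@[simp] lemma resM_self (M : X.Modules) {U : X.Opens} (h : U ≤ U) (s : Γ(M, U)) :
    resM M h s = s := by
  change (M.presheaf.map (𝟙 (op U))) s = s
  rw [M.presheaf.map_id]; rfl

@[simp] lemma resM_resM (M : X.Modules) {U V W : X.Opens} (h : V ≤ U) (h' : W ≤ V)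
    (s : Γ(M, U)) : resM M h' (resM M h s) = resM M (h'.trans h) s := by
  change (M.presheaf.map _ ≫ M.presheaf.map _) s = _
  rw [← M.presheaf.map_comp]; rfl

@[simp] lemma resM_smul (M : X.Modules) {U V : X.Opens} (h : V ≤ U) (a : Γ(X, U)) (s : Γ(M, U)) :
    resM M h (a • s) = resO h a • resM M h s :=
  Scheme.Modules.map_smul M (homOfLE h) a s

lemma app_resM {M N : X.Modules} (φ : M ⟶ N) {U V : X.Opens} (h : V ≤ U) (s : Γ(M, U)) :
    φ.app V (resM M h s) = resM N h (φ.app U s) :=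
  congr($((Scheme.Modules.Hom.mapPresheaf φ).naturality (homOfLE h).op) s)

lemma app_resO {Y : Scheme.{u}} (f : X ⟶ Y) {U V : Y.Opens} (h : V ≤ U) (a : Γ(Y, U)) :
    f.app V (resO h a) = resO (f.preimage_mono h) (f.app U a) :=
  congr($(f.naturality (homOfLE h).op) a)

lemma eq_of_locally_eq (M : X.Modules) {U : X.Opens} (s t : Γ(M, U))
    (h : ∀ x ∈ U, ∃ (V : X.Opens) (hV : V ≤ U), x ∈ V ∧ resM M hV s = resM M hV t) : s = t := by
  choose V hV hx hst using h
  refine TopCat.Sheaf.eq_of_locally_eq' ⟨M.presheaf, M.isSheaf⟩ (fun x : U => V x x.2) U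
    (fun x => homOfLE (hV x x.2)) ?_ s t (fun x => hst x x.2)
  intro x hxU
  exact Opens.mem_iSup.mpr ⟨⟨x, hxU⟩, hx x hxU⟩

lemma exists_glue_functions {U : X.Opens} {ι : Type u} (V : ι → X.Opens) (hV : ∀ i, V i ≤ U)
    (hcover : ∀ x ∈ U, ∃ i, x ∈ V i) (a : ∀ i, Γ(X, V i))
    (h : ∀ i j, resO (inf_le_left : V i ⊓ V j ≤ V i) (a i) = resO inf_le_right (a j)) :
    ∃ b : Γ(X, U), ∀ i, resO (hV i) b = a i := by
  obtain ⟨b, hb, -⟩ := TopCat.Sheaf.existsUnique_gluing' ⟨X.presheaf, X.IsSheaf⟩ V U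
    (fun i => homOfLE (hV i)) (fun x hx => Opens.mem_iSup.mpr (hcover x hx)) a h
  exact ⟨b, hb⟩

/-- A morphism of modules from compatible linear maps on sections. -/
def homOfLinear {M N : X.Modules} (φ : ∀ U : X.Opens, Γ(M, U) →ₗ[Γ(X, U)] Γ(N, U))
    (hφ : ∀ (U V : X.Opens) (h : V ≤ U) (s : Γ(M, U)), φ V (resM M h s) = resM N h (φ U s)) :
    M ⟶ N :=
  ⟨PresheafOfModules.homMk
    { app := fun U => AddCommGrpCat.ofHom (φ U.unop).toAddMonoidHom
      naturality := fun U V i => by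
        ext s
        exact hφ U.unop V.unop i.unop.le s }
    (fun U a s => (φ U.unop).map_smul a s)⟩

lemma hom_ext_sections {M N : X.Modules} {φ ψ : M ⟶ N}
    (h : ∀ (U : X.Opens) (s : Γ(M, U)), φ.app U s = ψ.app U s) : φ = ψ := by
  ext U s
  exact h U s

lemma mono_of_injective {M N : X.Modules} (φ : M ⟶ N)
    (h : ∀ U : X.Opens, Function.Injective (φ.app U)) : Mono φ := by
  refine ⟨fun g g' hg => hom_ext_sections fun U s => h U ?_⟩
  exact congr(($hg).app U s)

lemma injective_of_mono {M N : X.Modules} (φ : M ⟶ N) [Mono φ] (U : X.Opens) :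
    Function.Injective (φ.app U) := by
  have h1 : Mono ((Scheme.Modules.toPresheaf X).map φ) := inferInstance
  have h2 := (NatTrans.mono_iff_mono_app ((Scheme.Modules.toPresheaf X).map φ)).mp h1 (op U)
  exact (AddCommGrpCat.mono_iff_injective _).mp h2

/-- A subsheaf of modules of `M`, given by submodules of its sections that are stable under
restriction and whose membership is local. -/
structure SubModules (M : X.Modules) where
  /-- the sections of `M` over `U` that lie in the subsheaf -/
  carrier (U : X.Opens) : Submodule Γ(X, U) Γ(M, U)
  res_mem {U V : X.Opens} (h : V ≤ U) {s : Γ(M, U)} (hs : s ∈ carrier U) : resM M h s ∈ carrier V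
  of_local {U : X.Opens} (s : Γ(M, U))
    (h : ∀ x ∈ U, ∃ (V : X.Opens) (hV : V ≤ U), x ∈ V ∧ resM M hV s ∈ carrier V) : s ∈ carrier U

namespace SubModules

variable {M : X.Modules} (N : SubModules M)

/-- The underlying presheaf of submodules. -/
def toPresheafSubmodule : PresheafOfModules.Submodule M.val where
  obj U := N.carrier U.unop
  map f _ hs := N.res_mem f.unop.le hs

/-- A subsheaf of modules as a sheaf of modules. -/
def toModules : X.Modules where
  val := N.toPresheafSubmodule.toPresheafOfModules
  isSheaf := by
    refine (TopCat.Presheaf.isSheaf_iff_isSheafUniqueGluing (C := Ab) _).mpr ?_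
    intro ι U sf hsf
    obtain ⟨s, hs, huniq⟩ := TopCat.Presheaf.IsSheaf.isSheafUniqueGluing M.isSheaf U
      (fun i => (sf i).1) (fun i j => congrArg Subtype.val (hsf i j))
    refine ⟨⟨s, N.of_local s fun x hx => ?_⟩, fun i => Subtype.ext (hs i), fun t ht => ?_⟩
    · obtain ⟨i, hi⟩ := Opens.mem_iSup.mp hx
      refine ⟨U i, le_iSup U i, hi, ?_⟩
      have : resM M (le_iSup U i) s = (sf i).1 := hs i
      rw [this]
      exact (sf i).2
    · exact Subtype.ext (huniq t.1 fun i => congrArg Subtype.val (ht i))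

/-- The sections of a subsheaf are the given submodules. -/
def sectionsEquiv (U : X.Opens) : Γ(N.toModules, U) ≃ₗ[Γ(X, U)] N.carrier U :=
  LinearEquiv.refl _ _

/-- The inclusion of a subsheaf of modules. -/
def ι : N.toModules ⟶ M :=
  homOfLinear (fun U => (N.carrier U).subtype ∘ₗ (N.sectionsEquiv U).toLinearMap)
    (fun _ _ _ _ => rfl)

lemma ι_app (U : X.Opens) (s : Γ(N.toModules, U)) :
    N.ι.app U s = (N.sectionsEquiv U s : Γ(M, U)) := rfl

end SubModules

end Sections

section Frames

variable {X : Scheme.{u}} {r : ℕ}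

/-- Sections `e₁, …, e_r` of `M` over `U` form a frame if they are a basis of the sections over
every open subset of `U`. -/
def IsFrame (M : X.Modules) (U : X.Opens) (e : Fin r → Γ(M, U)) : Prop :=
  ∀ (V : X.Opens) (h : V ≤ U),
    Function.Bijective (fun a : Fin r → Γ(X, V) => ∑ i, a i • resM M h (e i))

namespace IsFrame

variable {M : X.Modules} {U : X.Opens} {e : Fin r → Γ(M, U)} (he : IsFrame M U e)

include he in
lemma mono {V : X.Opens} (h : V ≤ U) : IsFrame M V (fun i => resM M h (e i)) := by
  intro W hW
  simpa using he W (hW.trans h)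

/-- The coordinates of sections over an open subset of `U` with respect to a frame on `U`. -/
def coord {V : X.Opens} (h : V ≤ U) : Γ(M, V) ≃ₗ[Γ(X, V)] (Fin r → Γ(X, V)) :=
  (LinearEquiv.ofBijective
    (Fintype.linearCombination Γ(X, V) (fun i => resM M h (e i))) (he V h)).symm

lemma coord_symm {V : X.Opens} (h : V ≤ U) (a : Fin r → Γ(X, V)) :
    (he.coord h).symm a = ∑ i, a i • resM M h (e i) := rfl

lemma sum_coord {V : X.Opens} (h : V ≤ U) (s : Γ(M, V)) :
    ∑ i, he.coord h s i • resM M h (e i) = s := by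
  rw [← he.coord_symm, LinearEquiv.symm_apply_apply]

lemma coord_sum {V : X.Opens} (h : V ≤ U) (a : Fin r → Γ(X, V)) :
    he.coord h (∑ i, a i • resM M h (e i)) = a := by
  rw [← he.coord_symm, LinearEquiv.apply_symm_apply]

lemma coord_frame {V : X.Opens} (h : V ≤ U) (i : Fin r) :
    he.coord h (resM M h (e i)) = Pi.single i 1 := by
  rw [← LinearEquiv.eq_symm_apply, he.coord_symm]
  simp [Pi.single_apply]

lemma coord_res {V W : X.Opens} (h : V ≤ U) (h' : W ≤ V) (s : Γ(M, V)) (i : Fin r) :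
    he.coord (h'.trans h) (resM M h' s) i = resO h' (he.coord h s i) := by
  have : he.coord (h'.trans h) (resM M h' s) = fun i => resO h' (he.coord h s i) := by
    rw [← LinearEquiv.eq_symm_apply, he.coord_symm]
    conv_lhs => rw [← he.sum_coord h s]
    simp
  rw [this]

end IsFrame

/-- A family of sections is a frame if it is independent over all open subsets and spans locally;
by independence, local coefficients glue. -/
lemma IsFrame.of_local {M : X.Modules} {U : X.Opens} {e : Fin r → Γ(M, U)}
    (hinj : ∀ (V : X.Opens) (h : V ≤ U) (a : Fin r → Γ(X, V)),
      ∑ i, a i • resM M h (e i) = 0 → a = 0)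
    (hsurj : ∀ (V : X.Opens) (h : V ≤ U) (s : Γ(M, V)), ∀ x ∈ V,
      ∃ (W : X.Opens) (hW : W ≤ V) (a : Fin r → Γ(X, W)), x ∈ W ∧
        resM M hW s = ∑ i, a i • resM M (hW.trans h) (e i)) : IsFrame M U e := by
  intro V h
  have hinj' (V : X.Opens) (h : V ≤ U) :
      Function.Injective (fun a : Fin r → Γ(X, V) => ∑ i, a i • resM M h (e i)) := by
    intro a b hab
    rw [← sub_eq_zero]
    apply hinj V h
    have : ∑ i, a i • resM M h (e i) = ∑ i, b i • resM M h (e i) := hab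
    simp [sub_smul, this]
  refine ⟨hinj' V h, fun s => ?_⟩
  choose W hW a hx ha using fun x : V => hsurj V h s x x.2
  have hglue (i : Fin r) : ∃ b : Γ(X, V), ∀ x, resO (hW x) b = a x i := by
    refine exists_glue_functions W hW (fun x hx' => ⟨⟨x, hx'⟩, hx ⟨x, hx'⟩⟩) (fun x => a x i) ?_
    intro x y
    have : (fun i => resO (inf_le_left : W x ⊓ W y ≤ W x) (a x i)) =
        fun i => resO inf_le_right (a y i) := by
      apply hinj' (W x ⊓ W y) (inf_le_left.trans ((hW x).trans h))
      have h1 := congrArg (resM M (inf_le_left : W x ⊓ W y ≤ W x)) (ha x)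
      have h2 := congrArg (resM M (inf_le_right : W x ⊓ W y ≤ W y)) (ha y)
      simp only [resM_resM, map_sum, resM_smul] at h1 h2
      exact h1.symm.trans h2
    exact congrFun this i
  choose b hb using hglue
  refine ⟨b, eq_of_locally_eq M _ _ fun x hxV => ⟨W ⟨x, hxV⟩, hW _, hx _, ?_⟩⟩
  rw [ha]
  simp [hb]

/-- A family related to a frame by an invertible matrix is a frame. -/
lemma IsFrame.of_matrix {M : X.Modules} {U : X.Opens} {e : Fin r → Γ(M, U)} (he : IsFrame M U e)
    (f : Fin r → Γ(M, U)) (hf : IsUnit (Matrix.of fun i j => he.coord le_rfl (f i) j).det) :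
    IsFrame M U f := by
  intro V h
  set A : Matrix (Fin r) (Fin r) Γ(X, U) := Matrix.of fun i j => he.coord le_rfl (f i) j
  let B : Matrix (Fin r) (Fin r) Γ(X, V) := A.map (resO h)
  have hB : IsUnit B.det := by
    have : B.det = resO h A.det := by
      rw [RingHom.map_det]; rfl
    rw [this]
    exact hf.map _
  have hfun : (fun a : Fin r → Γ(X, V) => ∑ i, a i • resM M h (f i)) =
      (he.coord h).symm ∘ (fun a => Matrix.vecMul a B) := by
    ext a
    rw [Function.comp_apply, LinearEquiv.eq_symm_apply, map_sum]
    ext j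
    simp only [map_smul, Finset.sum_apply, Pi.smul_apply, smul_eq_mul, Matrix.vecMul, dotProduct]
    refine Finset.sum_congr rfl fun i _ => ?_
    rw [he.coord_res le_rfl h]
    rfl
  rw [hfun]
  refine (he.coord h).symm.bijective.comp ?_
  have hBu := (Matrix.isUnit_iff_isUnit_det B).mpr hB
  exact ⟨Matrix.vecMul_injective_of_isUnit hBu, Matrix.vecMul_surjective_iff_isUnit.mpr hBu⟩

lemma IsFrame.coord_mono {M : X.Modules} {U V W : X.Opens} {e : Fin r → Γ(M, U)}
    (he : IsFrame M U e) (h : V ≤ U) (h' : W ≤ V) (s : Γ(M, W)) :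
    (he.mono h).coord h' s = he.coord (h'.trans h) s := by
  rw [← LinearEquiv.eq_symm_apply, IsFrame.coord_symm]
  simp only [resM_resM]
  exact (he.sum_coord _ s).symm

/-- A family is a frame where its determinant with respect to a frame is invertible. -/
lemma IsFrame.of_isUnit_res {M : X.Modules} {U V : X.Opens} {e : Fin r → Γ(M, U)}
    (he : IsFrame M U e) (f : Fin r → Γ(M, U)) (h : V ≤ U)
    (hdet : IsUnit (resO h (Matrix.of fun i j => he.coord le_rfl (f i) j).det)) :
    IsFrame M V (fun i => resM M h (f i)) := by
  refine (he.mono h).of_matrix _ ?_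
  have : (Matrix.of fun i j => (he.mono h).coord le_rfl (resM M h (f i)) j) =
      (Matrix.of fun i j => he.coord le_rfl (f i) j).map (resO h) := by
    ext i j
    change (he.mono h).coord le_rfl (resM M h (f i)) j = resO h (he.coord le_rfl (f i) j)
    rw [he.coord_mono h le_rfl]
    exact he.coord_res le_rfl h (f i) j
  rw [this]
  rw [RingHom.map_det] at hdet
  exact hdet

end Frames

/-! ### Sections of pullbacks -/

section Cut

variable {X : Scheme.{u}} (U : X.Opens)

/-- The intersection `U ∩ W` as the image of the preimage of `W` in the open subscheme `U`. In this
form the sections of `j_* j^* M` over `W`, for the inclusion `j` of `U`, are by definition those of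
`M` over it. -/
def cut (W : X.Opens) : X.Opens := U.ι ''ᵁ (U.ι ⁻¹ᵁ W)

lemma cut_eq (W : X.Opens) : cut U W = U ⊓ W := by
  rw [cut, Scheme.Hom.image_preimage_eq_opensRange_inf, Scheme.Opens.opensRange_ι]

lemma cut_le_left (W : X.Opens) : cut U W ≤ U := (cut_eq U W).trans_le inf_le_left

lemma cut_le_right (W : X.Opens) : cut U W ≤ W := (cut_eq U W).trans_le inf_le_right

lemma le_cut {V W : X.Opens} (h : V ≤ U) (h' : V ≤ W) : V ≤ cut U W :=
  (le_inf h h').trans_eq (cut_eq U W).symm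

lemma cut_mono {V W : X.Opens} (h : V ≤ W) : cut U V ≤ cut U W :=
  le_cut U (cut_le_left U V) ((cut_le_right U V).trans h)

/-- `j_* j^* M` for the inclusion `j` of `U` -/
def extendModules (M : X.Modules) : X.Modules :=
  (Scheme.Modules.pushforward U.ι).obj (M.restrict U.ι)

/-- The sections of `j_* j^* M` over `W` are those of `M` over `U ∩ W`. -/
def extendSections (M : X.Modules) (W : X.Opens) : Γ(extendModules U M, W) ≃+ Γ(M, cut U W) :=
  AddEquiv.refl _

lemma extendSections_smul (M : X.Modules) (W : X.Opens) (a : Γ(X, W))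
    (s : Γ(extendModules U M, W)) :
    extendSections U M W (a • s) = resO (cut_le_right U W) a • extendSections U M W s := by
  change (show Γ(X, cut U W) from (U.ι.appIso (U.ι ⁻¹ᵁ W)).inv (U.ι.app W a)) •
    extendSections U M W s = _
  congr 1
  rw [Scheme.Opens.ι_appIso, Scheme.Opens.ι_app]
  rfl

lemma extendSections_res (M : X.Modules) {V W : X.Opens} (h : V ≤ W)
    (s : Γ(extendModules U M, W)) :
    extendSections U M V (resM _ h s) = resM M (cut_mono U h) (extendSections U M W s) := rfl

/-- The map into `j_* j^* N` given by maps from sections over `W` to sections over `U ∩ W`. -/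
def homExtend {M N : X.Modules} (φ : ∀ W : X.Opens, Γ(M, W) →+ Γ(N, cut U W))
    (hφ : ∀ (W : X.Opens) (a : Γ(X, W)) (s : Γ(M, W)),
      φ W (a • s) = resO (cut_le_right U W) a • φ W s)
    (hres : ∀ (V W : X.Opens) (h : V ≤ W) (s : Γ(M, W)),
      φ V (resM M h s) = resM N (cut_mono U h) (φ W s)) : M ⟶ extendModules U N :=
  homOfLinear (fun W =>
    { toFun s := (extendSections U N W).symm (φ W s)
      map_add' s t := by rw [map_add, map_add]
      map_smul' a s := by
        rw [AddEquiv.symm_apply_eq, extendSections_smul, AddEquiv.apply_symm_apply, hφ]; rfl })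
    (fun W V h s => by
      change (extendSections U N V).symm (φ V (resM M h s)) = _
      rw [AddEquiv.symm_apply_eq, hres]
      rfl)

variable (X) in
/-- The structure sheaf as a module. -/
def structureModules : X.Modules := SheafOfModules.unit X.ringCatSheaf

/-- The sections of the structure sheaf as a module are the functions. -/
def structureSections (W : X.Opens) : Γ(structureModules X, W) ≃ₗ[Γ(X, W)] Γ(X, W) where
  toFun s := s
  invFun s := s
  left_inv _ := rfl
  right_inv _ := rfl
  map_add' _ _ := rfl
  map_smul' _ _ := rfl

lemma structureSections_res {V W : X.Opens} (h : V ≤ W) (s : Γ(structureModules X, W)) :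
    structureSections V (resM _ h s) = resO h (structureSections W s) := rfl

end Cut

section Pullback

variable {X Y : Scheme.{u}} (f : X ⟶ Y) (M : Y.Modules)

/-- The pullback of a section. -/
def pullbackSection {V : Y.Opens} (s : Γ(M, V)) :
    Γ((Scheme.Modules.pullback f).obj M, f ⁻¹ᵁ V) :=
  ((Scheme.Modules.pullbackPushforwardAdjunction f).unit.app M).app V s

lemma pullbackSection_add {V : Y.Opens} (s t : Γ(M, V)) :
    pullbackSection f M (s + t) = pullbackSection f M s + pullbackSection f M t :=
  map_add _ s t

lemma pullbackSection_sum {V : Y.Opens} {ι : Type*} (S : Finset ι) (s : ι → Γ(M, V)) :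
    pullbackSection f M (∑ i ∈ S, s i) = ∑ i ∈ S, pullbackSection f M (s i) :=
  map_sum (((Scheme.Modules.pullbackPushforwardAdjunction f).unit.app M).app V).hom s S

lemma pullbackSection_smul {V : Y.Opens} (a : Γ(Y, V)) (s : Γ(M, V)) :
    pullbackSection f M (a • s) = f.app V a • pullbackSection f M s :=
  Scheme.Modules.Hom.app_smul _ a s

lemma pullbackSection_res {V W : Y.Opens} (h : W ≤ V) (s : Γ(M, V)) :
    pullbackSection f M (resM M h s) = resM _ (f.preimage_mono h) (pullbackSection f M s) :=
  app_resM ((Scheme.Modules.pullbackPushforwardAdjunction f).unit.app M) h s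

lemma pullbackSection_app {N : Y.Modules} (β : M ⟶ N) {V : Y.Opens} (s : Γ(M, V)) :
    pullbackSection f N (β.app V s) =
      ((Scheme.Modules.pullback f).map β).app (f ⁻¹ᵁ V) (pullbackSection f M s) :=
  congr(($((Scheme.Modules.pullbackPushforwardAdjunction f).unit.naturality β)).app V s)

variable {f M} in
/-- Morphisms out of the pullback are determined by pulled back sections. -/
lemma pullback_hom_ext {N : X.Modules} {φ ψ : (Scheme.Modules.pullback f).obj M ⟶ N}
    (h : ∀ (V : Y.Opens) (s : Γ(M, V)), φ.app (f ⁻¹ᵁ V) (pullbackSection f M s) =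
      ψ.app (f ⁻¹ᵁ V) (pullbackSection f M s)) : φ = ψ := by
  apply ((Scheme.Modules.pullbackPushforwardAdjunction f).homEquiv _ _).injective
  refine hom_ext_sections fun V s => ?_
  rw [Adjunction.homEquiv_unit, Adjunction.homEquiv_unit]
  exact h V s

/-- The map out of the pullback that corresponds by adjunction to a map into the pushforward. -/
def pullbackDesc {N : X.Modules} (φ : M ⟶ (Scheme.Modules.pushforward f).obj N) :
    (Scheme.Modules.pullback f).obj M ⟶ N :=
  ((Scheme.Modules.pullbackPushforwardAdjunction f).homEquiv _ _).symm φ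

lemma pullbackDesc_app {N : X.Modules} (φ : M ⟶ (Scheme.Modules.pushforward f).obj N)
    {V : Y.Opens} (s : Γ(M, V)) :
    (pullbackDesc f M φ).app (f ⁻¹ᵁ V) (pullbackSection f M s) = φ.app V s := by
  have h := ((Scheme.Modules.pullbackPushforwardAdjunction f).homEquiv _ _).apply_symm_apply φ
  rw [Adjunction.homEquiv_unit] at h
  exact congr(($h).app V s)

variable {r : ℕ}

/-- The pullback of a frame is a frame. The pullback functor is only known as a left adjoint, so the
coordinates of sections over `U = f⁻¹ V` are obtained as maps from the pullback to `j_* 𝒪_U`, with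
`j` the inclusion of `U`, adjoint to the coordinates with respect to `e`. Recombining the
coordinates gives the restriction to `U`, since this can be tested on pulled back sections. -/
theorem IsFrame.pullback {f : X ⟶ Y} {M : Y.Modules} {V : Y.Opens} {e : Fin r → Γ(M, V)}
    (he : IsFrame M V e) :
    IsFrame ((Scheme.Modules.pullback f).obj M) (f ⁻¹ᵁ V) (fun i => pullbackSection f M (e i)) := by
  let G := (Scheme.Modules.pullback f).obj M
  let U := f ⁻¹ᵁ V
  -- `cut U (f⁻¹ W)` lies over `cut V W`
  have hcut (W : Y.Opens) : cut U (f ⁻¹ᵁ W) ≤ f ⁻¹ᵁ (cut V W) := by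
    intro x hx
    exact le_cut (X := Y) V (inf_le_left : V ⊓ W ≤ V) inf_le_right
      (show f x ∈ V ⊓ W from ⟨cut_le_left U _ hx, cut_le_right U _ hx⟩)
  -- the `i`-th coordinate `f^* M → j_* j^* 𝒪_X`
  let δ (i : Fin r) : M ⟶ (Scheme.Modules.pushforward f).obj
      (extendModules U (structureModules X)) := homOfLinear (fun W =>
    { toFun := fun s => (extendSections U (structureModules X) (f ⁻¹ᵁ W)).symm
        ((structureSections _).symm (resO (hcut W) (f.app (cut V W)
          (he.coord (cut_le_left V W) (resM M (cut_le_right V W) s) i))))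
      map_add' := fun s t => by
        simp only [map_add, Pi.add_apply]; rfl
      map_smul' := fun a s => by
        change (_ : Γ(extendModules U (structureModules X), f ⁻¹ᵁ W)) =
          f.app W a • (_ : Γ(extendModules U (structureModules X), f ⁻¹ᵁ W))
        rw [AddEquiv.symm_apply_eq, extendSections_smul, AddEquiv.apply_symm_apply, ← map_smul]
        congr 1
        rw [resM_smul, map_smul, Pi.smul_apply, smul_eq_mul, map_mul, map_mul, app_resO, resO_resO]
        rfl })
    (fun W W' h s => by
      change (extendSections U (structureModules X) (f ⁻¹ᵁ W')).symm _ =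
        resM (extendModules U (structureModules X)) (f.preimage_mono h)
          ((extendSections U (structureModules X) (f ⁻¹ᵁ W)).symm
        ((structureSections _).symm (resO (hcut W) (f.app (cut V W)
          (he.coord (cut_le_left V W) (resM M (cut_le_right V W) s) i)))))
      rw [AddEquiv.symm_apply_eq, extendSections_res]
      change _ = resM _ _ ((structureSections _).symm _)
      rw [LinearEquiv.symm_apply_eq, structureSections_res]
      change _ = resO _ (resO _ _)
      rw [resM_resM, ← resM_resM M (cut_le_right V W) (cut_mono V h), he.coord_res, app_resO,
        resO_resO, resO_resO])
  let c (i : Fin r) := pullbackDesc f M (δ i)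
  -- value of coordinate functions
  let γ (W : X.Opens) (z : Γ(G, W)) (i : Fin r) : Γ(X, cut U W) :=
    structureSections _ (extendSections U _ W ((c i).app W z))
  have hγ_unit (W : Y.Opens) (s : Γ(M, W)) (i : Fin r) : γ (f ⁻¹ᵁ W) (pullbackSection f M s) i =
      resO (hcut W) (f.app (cut V W)
          (he.coord (cut_le_left V W) (resM M (cut_le_right V W) s) i)) := by
    change structureSections _ (extendSections U _ _ ((c i).app _ _)) = _
    rw [pullbackDesc_app]
    rfl
  have hγ_smul (W : X.Opens) (a : Γ(X, W)) (z : Γ(G, W)) (i : Fin r) :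
      γ W (a • z) i = resO (cut_le_right U W) a * γ W z i := by
    change structureSections _ (extendSections U _ W ((c i).app W (a • z))) = _
    rw [Scheme.Modules.Hom.app_smul, extendSections_smul, map_smul]
    rfl
  have hγ_add (W : X.Opens) (z z' : Γ(G, W)) (i : Fin r) :
      γ W (z + z') i = γ W z i + γ W z' i := by
    change structureSections _ (extendSections U _ W ((c i).app W (z + z'))) = _
    rw [map_add, map_add, map_add]
  have hγ_sum (W : X.Opens) (z : Fin r → Γ(G, W)) (i : Fin r) :
      γ W (∑ j, z j) i = ∑ j, γ W (z j) i := by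
    change structureSections _ (extendSections U _ W ((c i).app W (∑ j, z j))) = _
    rw [map_sum, map_sum, map_sum]
  have hγ_res (W W' : X.Opens) (h : W' ≤ W) (z : Γ(G, W)) (i : Fin r) :
      γ W' (resM G h z) i = resO (cut_mono U h) (γ W z i) := by
    change structureSections _ (extendSections U _ W' ((c i).app W' (resM G h z))) = _
    rw [app_resM, extendSections_res, structureSections_res]
  -- the frame maps to the standard basis
  have hγ_frame (W : X.Opens) (h : W ≤ U) (i j : Fin r) :
      γ W (resM G h (pullbackSection f M (e i))) j = (Pi.single i 1 : Fin r → Γ(X, cut U W)) j := by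
    rw [hγ_res, hγ_unit, he.coord_frame, Pi.single_apply, Pi.single_apply]
    split_ifs <;> simp
  -- restriction agrees with recombining coordinates
  let ρ : G ⟶ extendModules U G := homExtend U (fun W => resM G (cut_le_right U W))
    (fun W a s => resM_smul _ _ _ _) (fun V W h s => by rw [resM_resM, resM_resM])
  let σ : G ⟶ extendModules U G := homExtend U
    (fun W => AddMonoidHom.mk' (fun z => ∑ i, γ W z i •
      resM G (cut_le_left U W) (pullbackSection f M (e i)))
      (fun z z' => by simp only [hγ_add, add_smul, Finset.sum_add_distrib]))
    (fun W a s => by simp only [AddMonoidHom.mk'_apply, hγ_smul, mul_smul, Finset.smul_sum])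
    (fun V W h s => by simp [hγ_res])
  have hρσ : ρ = σ := by
    refine pullback_hom_ext fun W s => ?_
    apply (extendSections U G (f ⁻¹ᵁ W)).injective
    change resM G (cut_le_right U _) (pullbackSection f M s) = ∑ i, γ _ (pullbackSection f M s) i •
      resM G (cut_le_left U _) (pullbackSection f M (e i))
    have h1 : resM G (cut_le_right U (f ⁻¹ᵁ W)) (pullbackSection f M s) =
        resM G (hcut W) (pullbackSection f M (resM M (cut_le_right V W) s)) := by
      rw [pullbackSection_res, resM_resM]
    rw [h1, ← he.sum_coord (cut_le_left V W) (resM M (cut_le_right V W) s), pullbackSection_sum,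
      map_sum]
    refine Finset.sum_congr rfl fun i _ => ?_
    rw [pullbackSection_smul, resM_smul, pullbackSection_res, resM_resM, hγ_unit]
  intro W h
  have hle : W ≤ cut U W := le_cut U h le_rfl
  refine ⟨?_, fun z => ⟨fun i => resO hle (γ W z i), ?_⟩⟩
  · intro a b hab
    ext j
    have hcoord (a : Fin r → Γ(X, W)) :
        resO hle (γ W (∑ i, a i • resM G h (pullbackSection f M (e i))) j) = a j := by
      rw [hγ_sum]
      simp only [hγ_smul, hγ_frame, Pi.single_apply]
      simp
    rw [← hcoord a, ← hcoord b]
    exact congrArg (fun z => resO hle (γ W z j)) hab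
  · have h1 : extendSections U G W (ρ.app W z) = extendSections U G W (σ.app W z) := by rw [hρσ]
    change resM G (cut_le_right U W) z = ∑ i, γ W z i •
      resM G (cut_le_left U W) (pullbackSection f M (e i)) at h1
    have h2 := congrArg (resM G hle) h1
    simp only [resM_resM, resM_self, map_sum, resM_smul] at h2
    exact h2.symm

end Pullback

/-! ### The relative Frobenius on opens and functions -/

section FrobeniusSections

variable (k : Type u) [Field k] [IsAlgClosed k] (p : ℕ) [hp : Fact p.Prime] [CharP k p]
  {C : Scheme.{u}} [C.Over (Spec (.of k))]

variable (C) in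
/-- The projection `C^{(p)} ⟶ C`. It is an isomorphism of schemes, though not over `k`, as the
Frobenius of `k` is bijective. -/
def twistFst : frobeniusTwist k p C ⟶ C :=
  Limits.pullback.fst (C ↘ Spec (.of k)) (Spec.map (CommRingCat.ofHom (frobenius k p)))

instance : IsIso (twistFst k p C) := by
  have : IsIso (CommRingCat.ofHom (frobenius k p)) := by
    have h : Function.Bijective (frobenius k p) := PerfectRing.bijective_frobenius
    exact (RingEquiv.ofBijective _ h).toCommRingCatIso.isIso_hom
  have : IsIso (Spec.map (CommRingCat.ofHom (frobenius k p))) := inferInstance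
  exact MorphismProperty.pullback_fst (P := .isomorphisms Scheme) _ _ this

omit [IsAlgClosed k] in
lemma relFrobenius_fst : relFrobenius k p C ≫ twistFst k p C = absFrobenius k p C :=
  Limits.pullback.lift_fst _ _ _

/-- The open subset of `C^{(p)}` that corresponds to an open subset of `C`. -/
def twistOpen (U : C.Opens) : (frobeniusTwist k p C).Opens := twistFst k p C ⁻¹ᵁ U

omit [IsAlgClosed k] in
lemma preimage_twistOpen (U : C.Opens) : relFrobenius k p C ⁻¹ᵁ (twistOpen k p U) = U := by
  have h := congrArg (fun f => f ⁻¹ᵁ U) (relFrobenius_fst k p (C := C))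
  exact h

lemma exists_twistOpen_eq (V : (frobeniusTwist k p C).Opens) : ∃ U : C.Opens, twistOpen k p U = V :=
  ⟨(inv (twistFst k p C)) ⁻¹ᵁ V, by
    change (twistFst k p C ≫ inv (twistFst k p C)) ⁻¹ᵁ V = V
    rw [IsIso.hom_inv_id]; rfl⟩

lemma twistOpen_preimage (V : (frobeniusTwist k p C).Opens) :
    twistOpen k p (relFrobenius k p C ⁻¹ᵁ V) = V := by
  obtain ⟨U, rfl⟩ := exists_twistOpen_eq k p V
  rw [preimage_twistOpen]

lemma relFrobenius_surjective : Function.Surjective (relFrobenius k p C) := by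
  intro y
  have h (x : C) : (twistFst k p C) (relFrobenius k p C x) = x := by
    change (relFrobenius k p C ≫ twistFst k p C) x = x
    rw [relFrobenius_fst]
    rfl
  refine ⟨twistFst k p C y, ?_⟩
  have hinj : Function.Injective (twistFst k p C) :=
    (twistFst k p C).homeomorph.injective
  exact hinj (h _)

omit [IsAlgClosed k] in
lemma relFrobenius_app_fst (U : C.Opens) (a : Γ(C, U)) :
    (relFrobenius k p C).app (twistOpen k p U) ((twistFst k p C).app U a) =
      (resO (preimage_twistOpen k p U).le a) ^ p := by
  have h := congr($(Scheme.Hom.congr_app (relFrobenius_fst k p (C := C)) U) a)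
  refine Eq.trans h ?_
  exact map_pow (resO (preimage_twistOpen k p U).le) a p

/-- Pulled back functions are `p`-th powers. -/
lemma exists_pow_eq_relFrobenius_app {V : (frobeniusTwist k p C).Opens}
    (a : Γ(frobeniusTwist k p C, V)) : ∃ b, (relFrobenius k p C).app V a = b ^ p := by
  obtain ⟨U, rfl⟩ := exists_twistOpen_eq k p V
  obtain ⟨a, rfl⟩ : ∃ a', (twistFst k p C).app U a' = a :=
    ⟨(inv ((twistFst k p C).app U)) a,
      congr($(IsIso.inv_hom_id ((twistFst k p C).app U)) a)⟩
  exact ⟨_, relFrobenius_app_fst k p U a⟩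

omit [IsAlgClosed k] in
lemma exists_relFrobenius_app_eq_pow (U : C.Opens) (b : Γ(C, U)) :
    ∃ a : Γ(frobeniusTwist k p C, twistOpen k p U),
      (relFrobenius k p C).app (twistOpen k p U) a =
        (resO (preimage_twistOpen k p U).le b) ^ p :=
  ⟨_, relFrobenius_app_fst k p U b⟩

lemma relFrobenius_app_injective [IsReduced C] (V : (frobeniusTwist k p C).Opens) :
    Function.Injective ((relFrobenius k p C).app V) := by
  refine (injective_iff_map_eq_zero ((relFrobenius k p C).app V).hom).mpr fun a ha => ?_
  obtain ⟨U, rfl⟩ := exists_twistOpen_eq k p V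
  obtain ⟨a, rfl⟩ : ∃ a', (twistFst k p C).app U a' = a :=
    ⟨(inv ((twistFst k p C).app U)) a,
      congr($(IsIso.inv_hom_id ((twistFst k p C).app U)) a)⟩
  have h0 := (relFrobenius_app_fst k p U a).symm.trans ha
  have h1 : resO (preimage_twistOpen k p U).le a = 0 := eq_zero_of_pow_eq_zero h0
  have h2 := congrArg (resO (preimage_twistOpen k p U).ge) h1
  rw [resO_resO, resO_self, map_zero] at h2
  rw [h2]
  exact map_zero _

end FrobeniusSections

section Generic

variable {C : Scheme.{u}} [IsIntegral C]

lemma genericPoint_mem {U : C.Opens} {x : C} (hx : x ∈ U) : genericPoint C ∈ U :=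
  ((genericPoint_spec C).mem_open_set_iff U.isOpen).mpr ⟨x, trivial, hx⟩

lemma dense_of_mem {U : C.Opens} {x : C} (hx : x ∈ U) : Dense (U : Set C) :=
  U.isOpen.dense ⟨x, hx⟩

lemma genericPoint_mem_of_dense {U : C.Opens} (hU : Dense (U : Set C)) : genericPoint C ∈ U := by
  obtain ⟨x, hx⟩ := hU.nonempty
  exact genericPoint_mem hx

lemma resO_injective {U V : C.Opens} (h : V ≤ U) {x : C} (hx : x ∈ V) :
    Function.Injective (resO h) := by
  have : Nonempty U := ⟨⟨x, h hx⟩⟩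
  have : Nonempty V := ⟨⟨x, hx⟩⟩
  intro a b hab
  apply Scheme.germToFunctionField_injective C U
  have h1 (a : Γ(C, U)) : C.germToFunctionField U a = C.germToFunctionField V (resO h a) :=
    (TopCat.Presheaf.germ_res_apply C.presheaf (homOfLE h) (genericPoint C) (genericPoint_mem hx)
      a).symm
  rw [h1, h1, hab]

omit [IsIntegral C] in
lemma exists_affine_le {U : C.Opens} {x : C} (hx : x ∈ U) :
    ∃ V : C.Opens, IsAffineOpen V ∧ V ≤ U ∧ x ∈ V := by
  obtain ⟨_, ⟨V, hV, rfl⟩, hxV, hVU⟩ := C.isBasis_affineOpens.exists_subset_of_mem_open hx U.isOpen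
  exact ⟨V, hV, hVU, hxV⟩

end Generic

attribute [local instance] sectionsAlgebra

/-! ### Connections, flat connections and horizontal sections -/

section Basic

variable {k : Type u} [Field k] {C : Scheme.{u}} [C.Over (Spec (.of k))] {E : C.Modules} {r : ℕ}

lemma formSections_res_tmul {V W : C.Opens} (h : W ≤ V) (s : Γ(E, V)) (ω : Ω[Γ(C, V)⁄k]) :
    FormSections.res k E h (s ⊗ₜ ω) = resM E h s ⊗ₜ kaehlerMap (resAlgHom k h) ω := rfl

lemma kaehlerMap_res_D {V W : C.Opens} (h : W ≤ V) (a : Γ(C, V)) :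
    kaehlerMap (resAlgHom k h) (KaehlerDifferential.D k Γ(C, V) a) =
      KaehlerDifferential.D k Γ(C, W) (resO h a) :=
  kaehlerMap_D _ _

lemma resO_algebraMap {V W : C.Opens} (h : W ≤ V) (a : k) :
    resO h (algebraMap k Γ(C, V) a) = algebraMap k Γ(C, W) a :=
  (resAlgHom k h).commutes a

namespace Connection

variable {U : C.Opens} (c : Connection k E U)

lemma nabla_res {V W : C.Opens} (hV : IsAffineOpen V) (hW : IsAffineOpen W) (hVU : V ≤ U)
    (h : W ≤ V) (s : Γ(E, V)) :
    c.nabla W hW (h.trans hVU) (resM E h s) = FormSections.res k E h (c.nabla V hV hVU s) :=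
  c.res_nabla V W hV hW hVU h s

/-- The restriction of a connection to a smaller open subset. -/
def restrict {W : C.Opens} (h : W ≤ U) : Connection k E W where
  nabla V hV hVW := c.nabla V hV (hVW.trans h)
  leibniz V hV hVW := c.leibniz V hV (hVW.trans h)
  res_nabla V W' hV hW hVW := c.res_nabla V W' hV hW (hVW.trans h)

lemma nabla_sum {V : C.Opens} (hV : IsAffineOpen V) (hVU : V ≤ U) (a : Fin r → Γ(C, V))
    (e : Fin r → Γ(E, V)) (he : ∀ i, c.nabla V hV hVU (e i) = 0) :
    c.nabla V hV hVU (∑ i, a i • e i) = ∑ i, e i ⊗ₜ KaehlerDifferential.D k Γ(C, V) (a i) := by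
  rw [map_sum]
  exact Finset.sum_congr rfl fun i _ => by rw [c.leibniz, he, smul_zero, zero_add]

lemma covariant_apply {V : C.Opens} (hV : IsAffineOpen V) (hVU : V ≤ U)
    (D : Derivation k Γ(C, V) Γ(C, V)) (s : Γ(E, V)) :
    c.covariant hV hVU D s = contract Γ(E, V) D (c.nabla V hV hVU s) := rfl

lemma contract_tmul {V : C.Opens} (D : Derivation k Γ(C, V) Γ(C, V)) (s : Γ(E, V))
    (ω : Ω[Γ(C, V)⁄k]) :
    contract Γ(E, V) D (s ⊗ₜ ω) = D.liftKaehlerDifferential ω • s := by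
  simp [contract]

lemma covariant_smul {V : C.Opens} (hV : IsAffineOpen V) (hVU : V ≤ U)
    (D : Derivation k Γ(C, V) Γ(C, V)) (a : Γ(C, V)) (s : Γ(E, V)) :
    c.covariant hV hVU D (a • s) = D a • s + a • c.covariant hV hVU D s := by
  rw [covariant_apply, c.leibniz, map_add, map_smul, contract_tmul, covariant_apply]
  simp [add_comm]

/-- Along a coordinate, `∇ s = ∇_{d/dt} s ⊗ dt`. -/
lemma nabla_eq_covariant {V : C.Opens} (hV : IsAffineOpen V) (hVU : V ≤ U)
    (x : Coordinate k Γ(C, V)) (s : Γ(E, V)) : c.nabla V hV hVU s =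
      c.covariant hV hVU x.D s ⊗ₜ KaehlerDifferential.D k Γ(C, V) x.t := by
  rw [covariant_apply]
  generalize c.nabla V hV hVU s = z
  induction z using TensorProduct.induction_on with
  | zero => simp
  | add z w hz hw => rw [map_add, TensorProduct.add_tmul, ← hz, ← hw]
  | tmul m ω =>
    rw [contract_tmul, TensorProduct.smul_tmul, ← x.span ω]

lemma nabla_eq_zero_iff {V : C.Opens} (hV : IsAffineOpen V) (hVU : V ≤ U)
    (x : Coordinate k Γ(C, V)) (s : Γ(E, V)) :
    c.nabla V hV hVU s = 0 ↔ c.covariant hV hVU x.D s = 0 := by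
  refine ⟨fun h => by rw [covariant_apply, h, map_zero], fun h => ?_⟩
  rw [c.nabla_eq_covariant hV hVU x, h, TensorProduct.zero_tmul]

/-- Covariant derivatives along compatible vector fields are compatible with restriction. -/
lemma covariant_res {V W : C.Opens} (hV : IsAffineOpen V) (hW : IsAffineOpen W) (hVU : V ≤ U)
    (h : W ≤ V) (D : Derivation k Γ(C, V) Γ(C, V)) (D' : Derivation k Γ(C, W) Γ(C, W))
    (hD : ∀ a, D' (resO h a) = resO h (D a)) (s : Γ(E, V)) :
    c.covariant hW (h.trans hVU) D' (resM E h s) = resM E h (c.covariant hV hVU D s) := by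
  rw [covariant_apply, covariant_apply, c.nabla_res hV hW hVU h]
  have hlift (ω : Ω[Γ(C, V)⁄k]) : D'.liftKaehlerDifferential (kaehlerMap (resAlgHom k h) ω) =
      resO h (D.liftKaehlerDifferential ω) := by
    have hω : ω ∈ Submodule.span Γ(C, V) (Set.range (KaehlerDifferential.D k Γ(C, V))) := by
      rw [KaehlerDifferential.span_range_derivation]; trivial
    induction hω using Submodule.span_induction with
    | mem ω hω =>
      obtain ⟨a, rfl⟩ := hω
      rw [kaehlerMap_res_D, Derivation.liftKaehlerDifferential_comp_D,
        Derivation.liftKaehlerDifferential_comp_D, hD]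
    | zero => simp
    | add x y _ _ hx hy => simp only [map_add, hx, hy]
    | smul a x _ hx =>
      rw [kaehlerMap_smul, map_smul, map_smul, hx, smul_eq_mul, smul_eq_mul, map_mul]
      rfl
  generalize c.nabla V hV hVU s = z
  induction z using TensorProduct.induction_on with
  | zero => simp
  | add z w hz hw => simp only [map_add, hz, hw]
  | tmul m ω => rw [formSections_res_tmul, contract_tmul, contract_tmul, resM_smul, hlift]

end Connection

/-- The connection for which a given frame is horizontal: it differentiates the coordinates. -/
def IsFrame.flatConnection {U : C.Opens} {e : Fin r → Γ(E, U)} (he : IsFrame E U e) :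
    Connection k E U where
  nabla V _ h := AddMonoidHom.mk' (fun s => ∑ i, resM E h (e i) ⊗ₜ
      KaehlerDifferential.D k Γ(C, V) (he.coord h s i)) (fun s t => by
        simp only [map_add, Pi.add_apply, TensorProduct.tmul_add, Finset.sum_add_distrib])
  leibniz V hV h a s := by
    conv_rhs => enter [2, 2]; rw [← he.sum_coord h s]
    simp only [AddMonoidHom.mk'_apply, map_smul, Pi.smul_apply, smul_eq_mul, Derivation.leibniz,
      TensorProduct.tmul_add, TensorProduct.tmul_smul, Finset.sum_add_distrib, Finset.smul_sum,
      TensorProduct.sum_tmul, TensorProduct.smul_tmul']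
  res_nabla V W hV hW hVU h s := by
    rw [AddMonoidHom.mk'_apply, AddMonoidHom.mk'_apply, map_sum]
    refine Finset.sum_congr rfl fun i _ => ?_
    rw [formSections_res_tmul, resM_resM, kaehlerMap_res_D, ← he.coord_res hVU h]
    rfl

lemma IsFrame.flatConnection_nabla {U : C.Opens} {e : Fin r → Γ(E, U)} (he : IsFrame E U e)
    (V : C.Opens) (hV : IsAffineOpen V) (h : V ≤ U) (s : Γ(E, V)) :
    (he.flatConnection (k := k)).nabla V hV h s = ∑ i, resM E h (e i) ⊗ₜ
      KaehlerDifferential.D k Γ(C, V) (he.coord h s i) := rfl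

lemma IsFrame.flatConnection_covariant {U : C.Opens} {e : Fin r → Γ(E, U)} (he : IsFrame E U e)
    {V : C.Opens} (hV : IsAffineOpen V) (h : V ≤ U) (D : Derivation k Γ(C, V) Γ(C, V))
    (a : Fin r → Γ(C, V)) :
    (he.flatConnection (k := k)).covariant hV h D (∑ i, a i • resM E h (e i)) =
      ∑ i, D (a i) • resM E h (e i) := by
  rw [Connection.covariant_apply, he.flatConnection_nabla, he.coord_sum, map_sum]
  exact Finset.sum_congr rfl fun i _ => by
    rw [Connection.contract_tmul, Derivation.liftKaehlerDifferential_comp_D]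

lemma IsFrame.flatConnection_pCurvature {U : C.Opens} {e : Fin r → Γ(E, U)} (he : IsFrame E U e)
    (p : ℕ) [Fact p.Prime] [CharP k p] {V : C.Opens} (hV : IsAffineOpen V) (h : V ≤ U)
    (D : Derivation k Γ(C, V) Γ(C, V)) (s : Γ(E, V)) :
    (he.flatConnection (k := k)).pCurvature p hV h D s = 0 := by
  rw [← he.sum_coord h s]
  have hiter (n : ℕ) (a : Fin r → Γ(C, V)) :
      ((he.flatConnection (k := k)).covariant hV h D)^[n] (∑ i, a i • resM E h (e i)) =
        ∑ i, (D^[n] (a i)) • resM E h (e i) := by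
    induction n with
    | zero => rfl
    | succ n ih =>
      rw [Function.iterate_succ_apply', ih, he.flatConnection_covariant]
      simp only [Function.iterate_succ_apply']
  rw [Connection.pCurvature, hiter, he.flatConnection_covariant, sub_eq_zero]
  simp only [derivationPow_apply]

end Basic

section Horizontal

variable {k : Type u} [Field k] {C : Scheme.{u}} [C.Over (Spec (.of k))] [IsIntegral C]
  {E : C.Modules} {r : ℕ}

/-- The restriction of a partial connection to a smaller dense open subset. -/
def PartialConnection.restrict (P : PartialConnection k E) {W : C.Opens} (hW : W ≤ P.domain)
    (hd : Dense (W : Set C)) : PartialConnection k E where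
  domain := W
  dense_domain := hd
  conn := P.conn.restrict hW

omit [IsIntegral C] in
lemma PartialConnection.mk_restrict (P : PartialConnection k E) {W : C.Opens} (hW : W ≤ P.domain)
    (hd : Dense (W : Set C)) : (Quotient.mk _ (P.restrict hW hd) : RationalConnection k E) =
      Quotient.mk _ P :=
  Quotient.sound ⟨W, hd, le_rfl, hW, fun _ _ _ => rfl⟩

/-- Horizontality can be tested on any representative, on some neighbourhood of the generic
point. -/
lemma isHorizontal_mk_iff (P : PartialConnection k E) {U : C.Opens} (s : Γ(E, U)) :
    RationalConnection.IsHorizontal (Quotient.mk _ P) s ↔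
      ∃ (W : C.Opens) (hW : W ≤ P.domain), genericPoint C ∈ W ∧
        ∀ (V : C.Opens) (hV : IsAffineOpen V) (hVW : V ≤ W) (hVU : V ≤ U),
          P.conn.nabla V hV (hVW.trans hW) (resM E hVU s) = 0 := by
  constructor
  · rintro ⟨Q, hQ, h⟩
    obtain ⟨W, hW, hWQ, hWP, hWn⟩ := Quotient.exact hQ
    refine ⟨W, hWP, genericPoint_mem_of_dense hW, fun V hV hVW hVU => ?_⟩
    rw [← hWn V hV hVW]
    exact h V hV _ hVU
  · rintro ⟨W, hW, hWd, h⟩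
    exact ⟨P.restrict hW (dense_of_mem hWd), P.mk_restrict hW _, fun V hV hVW hVU =>
      h V hV hVW hVU⟩

/-- It suffices to test horizontality on a nonempty affine open subset. -/
lemma isHorizontal_of_nabla_eq_zero (P : PartialConnection k E) {U : C.Opens} (s : Γ(E, U))
    {V : C.Opens} (hV : IsAffineOpen V) (hVP : V ≤ P.domain) (hVU : V ≤ U) {x : C} (hx : x ∈ V)
    (h : P.conn.nabla V hV hVP (resM E hVU s) = 0) :
    RationalConnection.IsHorizontal (Quotient.mk _ P) s := by
  rw [isHorizontal_mk_iff]
  refine ⟨V, hVP, genericPoint_mem hx, fun V' hV' hVV hVU' => ?_⟩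
  have := P.conn.nabla_res hV hV' hVP hVV (resM E hVU s)
  rw [h, map_zero, resM_resM] at this
  exact this

namespace RationalConnection

variable (c : RationalConnection k E)

lemma isHorizontal_zero (U : C.Opens) : c.IsHorizontal (0 : Γ(E, U)) := by
  obtain ⟨P, rfl⟩ := Quotient.exists_rep c
  rw [isHorizontal_mk_iff]
  exact ⟨P.domain, le_rfl, genericPoint_mem_of_dense P.dense_domain, fun _ _ _ _ => by
    rw [map_zero, map_zero]⟩

variable {c}

lemma IsHorizontal.add {U : C.Opens} {s t : Γ(E, U)} (hs : c.IsHorizontal s)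
    (ht : c.IsHorizontal t) : c.IsHorizontal (s + t) := by
  obtain ⟨P, rfl⟩ := Quotient.exists_rep c
  rw [isHorizontal_mk_iff] at *
  obtain ⟨W, hW, hη, h⟩ := hs
  obtain ⟨W', hW', hη', h'⟩ := ht
  refine ⟨W ⊓ W', inf_le_left.trans hW, ⟨hη, hη'⟩, fun V hV hVW hVU => ?_⟩
  rw [map_add, map_add, h V hV (hVW.trans inf_le_left), h' V hV (hVW.trans inf_le_right), add_zero]

lemma IsHorizontal.pow_smul (p : ℕ) [CharP k p] {U : C.Opens} {s : Γ(E, U)}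
    (hs : c.IsHorizontal s) (a : Γ(C, U)) : c.IsHorizontal (a ^ p • s) := by
  obtain ⟨P, rfl⟩ := Quotient.exists_rep c
  rw [isHorizontal_mk_iff] at *
  obtain ⟨W, hW, hη, h⟩ := hs
  refine ⟨W, hW, hη, fun V hV hVW hVU => ?_⟩
  rw [resM_smul, P.conn.leibniz, h V hV hVW hVU, map_pow, derivation_pow_prime p, smul_zero,
    TensorProduct.tmul_zero, add_zero]

lemma IsHorizontal.res {U V : C.Opens} (h : V ≤ U) {s : Γ(E, U)} (hs : c.IsHorizontal s) :
    c.IsHorizontal (resM E h s) := by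
  obtain ⟨P, rfl⟩ := Quotient.exists_rep c
  rw [isHorizontal_mk_iff] at *
  obtain ⟨W, hW, hη, h'⟩ := hs
  refine ⟨W, hW, hη, fun V' hV' hVW hVU => ?_⟩
  rw [resM_resM]
  exact h' V' hV' hVW _

/-- A section is horizontal if its restriction to a nonempty open subset is. -/
lemma IsHorizontal.of_res {U V : C.Opens} (h : V ≤ U) {x : C} (hx : x ∈ V) {s : Γ(E, U)}
    (hs : c.IsHorizontal (resM E h s)) : c.IsHorizontal s := by
  obtain ⟨P, rfl⟩ := Quotient.exists_rep c
  have hs' := (isHorizontal_mk_iff P _).mp hs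
  obtain ⟨W, hW, hη, h'⟩ := hs'
  obtain ⟨V', hV', hle, hη'⟩ := exists_affine_le
    (show genericPoint C ∈ W ⊓ V from ⟨hη, genericPoint_mem hx⟩)
  refine isHorizontal_of_nabla_eq_zero P s hV' (hle.trans (inf_le_left.trans hW))
    (hle.trans (inf_le_right.trans h)) hη' ?_
  have := h' V' hV' (hle.trans inf_le_left) (hle.trans inf_le_right)
  rwa [resM_resM] at this

lemma isHorizontal_of_isEmpty {U : C.Opens} (hU : ∀ x, x ∉ U) (s : Γ(E, U)) :
    c.IsHorizontal s := by
  have hU' : U = ⊥ := by ext x; simpa using hU x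
  subst hU'
  have : Subsingleton Γ(E, (⊥ : C.Opens)) := Module.subsingleton Γ(C, (⊥ : C.Opens)) _
  rw [Subsingleton.elim s 0]
  exact c.isHorizontal_zero _

end RationalConnection

end Horizontal

/-! ### Pre-kernel maps on sections -/

namespace PreKernelMap

variable {k : Type u} [Field k] [IsAlgClosed k] {p : ℕ} [hp : Fact p.Prime] [CharP k p]
  {C : Scheme.{u}} [C.Over (Spec (.of k))] {r : ℕ} {E : C.Modules}
  (K : PreKernelMap k p r E)

omit [IsAlgClosed k] in
lemma onSections_eq (V : (frobeniusTwist k p C).Opens) (f : Γ(K.bundle, V)) :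
    K.onSections V f = K.φ.app _ (pullbackSection (relFrobenius k p C) K.bundle f) := rfl

omit [IsAlgClosed k] in
lemma onSections_add (V : (frobeniusTwist k p C).Opens) (f g : Γ(K.bundle, V)) :
    K.onSections V (f + g) = K.onSections V f + K.onSections V g := by
  rw [onSections_eq, pullbackSection_add, map_add]; rfl

omit [IsAlgClosed k] in
lemma onSections_smul (V : (frobeniusTwist k p C).Opens) (a : Γ(frobeniusTwist k p C, V))
    (f : Γ(K.bundle, V)) :
    K.onSections V (a • f) = (relFrobenius k p C).app V a • K.onSections V f := by
  rw [onSections_eq, pullbackSection_smul, Scheme.Modules.Hom.app_smul]; rfl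

omit [IsAlgClosed k] in
lemma onSections_sum (V : (frobeniusTwist k p C).Opens) {ι : Type*} (S : Finset ι)
    (f : ι → Γ(K.bundle, V)) :
    K.onSections V (∑ i ∈ S, f i) = ∑ i ∈ S, K.onSections V (f i) := by
  rw [onSections_eq, pullbackSection_sum, map_sum]; rfl

omit [IsAlgClosed k] in
lemma onSections_res {V W : (frobeniusTwist k p C).Opens} (h : W ≤ V) (f : Γ(K.bundle, V)) :
    K.onSections W (resM _ h f) =
      resM E ((relFrobenius k p C).preimage_mono h) (K.onSections V f) := by
  rw [onSections_eq, pullbackSection_res, app_resM]; rfl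

omit [IsAlgClosed k] in
lemma exists_bundle_frame (y : frobeniusTwist k p C) :
    ∃ (V : (frobeniusTwist k p C).Opens) (_ : y ∈ V) (f : Fin r → Γ(K.bundle, V)),
      IsFrame K.bundle V f := by
  obtain ⟨V, hV, f, hf⟩ := K.isVectorBundle y
  exact ⟨V, hV, f, hf⟩

omit [IsAlgClosed k] in
lemma injective_app (U : C.Opens) : Function.Injective (K.φ.app U) := by
  have := K.mono
  exact injective_of_mono K.φ U

lemma onSections_injective [IsReduced C] (V : (frobeniusTwist k p C).Opens) :
    Function.Injective (K.onSections V) := by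
  intro s t hst
  refine eq_of_locally_eq _ _ _ fun y hy => ?_
  obtain ⟨V', hyV', f, hf⟩ := K.exists_bundle_frame y
  refine ⟨V ⊓ V', inf_le_left, ⟨hy, hyV'⟩, ?_⟩
  apply (hf.coord (inf_le_right : V ⊓ V' ≤ V')).injective
  ext i
  apply relFrobenius_app_injective k p (V ⊓ V')
  have key (s : Γ(K.bundle, V)) := congrArg (pullbackSection (relFrobenius k p C) K.bundle)
    (hf.sum_coord (inf_le_right : V ⊓ V' ≤ V') (resM K.bundle inf_le_left s))
  simp only [pullbackSection_sum, pullbackSection_smul, pullbackSection_res] at key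
  have heq : pullbackSection (relFrobenius k p C) K.bundle s =
    pullbackSection (relFrobenius k p C) K.bundle t := K.injective_app _ hst
  have h2 := (hf.pullback (f := relFrobenius k p C) _
    ((relFrobenius k p C).preimage_mono (inf_le_right : V ⊓ V' ≤ V'))).injective
    ((key s).trans ((congrArg _ heq).trans (key t).symm))
  exact congrFun h2 i

variable [IsIntegral C]

omit [IsAlgClosed k] in
/-- Generically, `φ` maps a frame of the bundle to a frame of `E`: the determinant of the image with
respect to a frame of `E` is nonzero since `φ` is injective, and it is invertible on a nonempty open
subset. -/
lemma exists_image_frame (hE : IsVectorBundle r E) :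
    ∃ (V : (frobeniusTwist k p C).Opens) (f : Fin r → Γ(K.bundle, V))
    (_ : IsFrame K.bundle V f) (W : C.Opens) (_ : genericPoint C ∈ W)
    (h : W ≤ relFrobenius k p C ⁻¹ᵁ V),
      IsFrame E W (fun i => resM E h (K.onSections V (f i))) := by
  let η := genericPoint C
  obtain ⟨V, hV, f, hf⟩ := K.exists_bundle_frame (relFrobenius k p C η)
  obtain ⟨U, hU, e, he⟩ := hE η
  let W₀ : C.Opens := relFrobenius k p C ⁻¹ᵁ V ⊓ U
  have hη : η ∈ W₀ := ⟨hV, hU⟩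
  have : Nonempty W₀ := ⟨⟨η, hη⟩⟩
  have he₀ := IsFrame.mono he (inf_le_right : W₀ ≤ U)
  let s (i : Fin r) : Γ(E, W₀) := resM E inf_le_left (K.onSections V (f i))
  let A : Matrix (Fin r) (Fin r) Γ(C, W₀) := Matrix.of fun i j => he₀.coord le_rfl (s i) j
  have hdet : A.det ≠ 0 := by
    intro h0
    obtain ⟨v, hv0, hv⟩ := Matrix.exists_vecMul_eq_zero_iff.mpr h0
    apply hv0
    have hsum : ∑ i, v i • s i = 0 := by
      apply (he₀.coord le_rfl).injective
      rw [map_zero, ← hv, map_sum]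
      ext j
      simp [Matrix.vecMul, dotProduct, A]
    apply (hf.pullback (f := relFrobenius k p C) W₀ inf_le_left).injective
    apply K.injective_app
    simp only [map_sum, Scheme.Modules.Hom.app_smul, app_resM, Pi.zero_apply, zero_smul,
      Finset.sum_const_zero, map_zero]
    exact hsum
  refine ⟨V, f, hf, C.basicOpen A.det, ?_, (C.basicOpen_le A.det).trans inf_le_left, ?_⟩
  · by_contra hη'
    apply hdet
    rw [← basicOpen_eq_bot_iff]
    by_contra hne
    obtain ⟨x, hx⟩ := (TopologicalSpace.Opens.ne_bot_iff_nonempty _).mp hne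
    exact hη' (genericPoint_mem hx)
  · have := IsFrame.of_isUnit_res he₀ s (C.basicOpen_le A.det)
      (C.toRingedSpace.isUnit_res_basicOpen A.det)
    simpa only [s, resM_resM] using this

end PreKernelMap

/-! ### The induced rational connection -/

namespace PreKernelMap

variable {k : Type u} [Field k] [IsAlgClosed k] {p : ℕ} [hp : Fact p.Prime] [CharP k p]
  {C : Scheme.{u}} [C.Over (Spec (.of k))] {r : ℕ} {E : C.Modules}
  (K : PreKernelMap k p r E) [IsIntegral C]

/-- The connection for which a given frame is horizontal, as a partial connection. -/
def _root_.CurveConn.IsFrame.flatPartialConnection {U : C.Opens} {e : Fin r → Γ(E, U)}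
    (he : IsFrame E U e) (hU : genericPoint C ∈ U) : PartialConnection k E where
  domain := U
  dense_domain := dense_of_mem hU
  conn := he.flatConnection

/-- The connection for which the image of a frame of `𝓕` is horizontal is induced by `φ`: sections
of `F⁻¹ 𝓕` have `p`-th powers as coordinates. -/
lemma induces_flat {V : (frobeniusTwist k p C).Opens} {f : Fin r → Γ(K.bundle, V)}
    (hf : IsFrame K.bundle V f) {W : C.Opens} (hη : genericPoint C ∈ W)
    (h : W ≤ relFrobenius k p C ⁻¹ᵁ V)
    (he : IsFrame E W (fun i => resM E h (K.onSections V (f i)))) :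
    K.Induces (Quotient.mk _ (he.flatPartialConnection hη)) := by
  intro V' s
  rw [isHorizontal_mk_iff]
  refine ⟨W, le_rfl, hη, fun U hU hUW hUV => ?_⟩
  change he.flatConnection.nabla U hU hUW _ = 0
  have hUinf : U ≤ relFrobenius k p C ⁻¹ᵁ (V' ⊓ V) := fun x hx => ⟨hUV hx, h (hUW hx)⟩
  have h1 := congrArg (fun t => resM E hUinf (K.onSections _ t))
    (hf.sum_coord (inf_le_right : V' ⊓ V ≤ V) (resM K.bundle inf_le_left s))
  simp only [onSections_sum, onSections_smul, onSections_res, resM_resM, map_sum, resM_smul] at h1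
  rw [← h1]
  have h2 := he.coord_sum hUW (fun i => resO hUinf ((relFrobenius k p C).app (V' ⊓ V)
    (hf.coord (inf_le_right : V' ⊓ V ≤ V) (resM K.bundle inf_le_left s) i)))
  simp only [resM_resM] at h2
  rw [he.flatConnection_nabla, h2]
  refine Finset.sum_eq_zero fun i _ => ?_
  obtain ⟨b, hb⟩ := exists_pow_eq_relFrobenius_app k p
    (hf.coord (inf_le_right : V' ⊓ V ≤ V) (resM K.bundle inf_le_left s) i)
  beta_reduce
  rw [hb, map_pow, derivation_pow_prime p, TensorProduct.tmul_zero]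

variable {K}

omit [IsAlgClosed k] in
/-- Induced connections are unique, as a connection is determined by a horizontal frame. -/
lemma Induces.eq (hE : IsVectorBundle r E) {c c' : RationalConnection k E} (h : K.Induces c)
    (h' : K.Induces c') : c = c' := by
  obtain ⟨P, rfl⟩ := Quotient.exists_rep c
  obtain ⟨P', rfl⟩ := Quotient.exists_rep c'
  obtain ⟨V, f, hf, W, hη, hW, he⟩ := K.exists_image_frame hE
  choose U hU hUη hUn using fun i => (isHorizontal_mk_iff P _).mp (h V (f i))
  choose U' hU' hU'η hU'n using fun i => (isHorizontal_mk_iff P' _).mp (h' V (f i))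
  let W₀ : C.Opens := W ⊓ (P.domain ⊓ P'.domain) ⊓ Finset.univ.inf (fun i => U i ⊓ U' i)
  have hη₀ : genericPoint C ∈ W₀ := by
    refine ⟨⟨hη, genericPoint_mem_of_dense P.dense_domain,
      genericPoint_mem_of_dense P'.dense_domain⟩, ?_⟩
    rw [Opens.coe_finset_inf]
    simp [hUη, hU'η]
  refine Quotient.sound ⟨W₀, dense_of_mem hη₀, inf_le_left.trans (inf_le_right.trans inf_le_left),
    inf_le_left.trans (inf_le_right.trans inf_le_right), fun A hA hAW => ?_⟩
  have hAi (i : Fin r) : A ≤ U i ⊓ U' i :=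
    hAW.trans (inf_le_right.trans (Finset.inf_le (Finset.mem_univ i)))
  have hAW' : A ≤ W := hAW.trans (inf_le_left.trans inf_le_left)
  ext s
  have hs := he.sum_coord hAW' s
  simp only [resM_resM] at hs
  rw [← hs, Connection.nabla_sum _ hA _ _ _ fun i => hUn i A hA ((hAi i).trans inf_le_left)
      (hAW'.trans hW), Connection.nabla_sum _ hA _ _ _ fun i => hU'n i A hA
      ((hAi i).trans inf_le_right) (hAW'.trans hW)]

theorem existsUnique_induces (hE : IsVectorBundle r E) (K : PreKernelMap k p r E) :
    ∃! c : RationalConnection k E, K.Induces c := by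
  obtain ⟨V, f, hf, W, hη, hW, he⟩ := K.exists_image_frame hE
  exact ⟨_, K.induces_flat hf hη hW he, fun c hc => hc.eq hE (K.induces_flat hf hη hW he)⟩

theorem Induces.hasVanishingPCurvature (hE : IsVectorBundle r E) {c : RationalConnection k E}
    (h : K.Induces c) : c.HasVanishingPCurvature p := by
  obtain ⟨V, f, hf, W, hη, hW, he⟩ := K.exists_image_frame hE
  exact ⟨_, (K.induces_flat hf hη hW he).eq hE h,
    fun V hV hVU D s => he.flatConnection_pCurvature p hV hVU D s⟩

/-- Where `φ` is surjective, the image of a frame is a frame, so the connection has no pole. -/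
theorem Induces.not_isPole (hE : IsVectorBundle r E) {c : RationalConnection k E}
    (h : K.Induces c) {x : C} (hx : K.IsSurjectiveAt x) : ¬ c.IsPole x := by
  obtain ⟨V, hV, f, hf⟩ := K.exists_bundle_frame (relFrobenius k p C x)
  obtain ⟨U, hU, e, he⟩ := hE x
  -- local preimages of the sections of a frame of `E`
  have hloc (i : Fin r) : ∃ (W : C.Opens) (_ : x ∈ W) (hWU : W ≤ U)
      (t : Γ((Scheme.Modules.pullback (relFrobenius k p C)).obj K.bundle, W)),
      K.φ.app W t = resM E hWU (e i) := by
    obtain ⟨g, hg⟩ := hx (E.presheaf.germ U x hU (e i))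
    obtain ⟨W, hxW, t, rfl⟩ := TopCat.Presheaf.exists_germ_eq _ g
    have hg' := (TopCat.Presheaf.stalkFunctor_map_germ_apply W x hxW
      (Scheme.Modules.Hom.mapPresheaf K.φ) t).symm.trans hg
    obtain ⟨W', hxW', i₁, i₂, hW'⟩ := TopCat.Presheaf.germ_eq E.presheaf x hxW hU _ _ hg'
    refine ⟨W', hxW', i₂.le, resM _ i₁.le t, ?_⟩
    rw [app_resM]
    exact hW'
  choose W hxW hWU t ht using hloc
  let W₀ : C.Opens := relFrobenius k p C ⁻¹ᵁ V ⊓ U ⊓ Finset.univ.inf W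
  have hx₀ : x ∈ W₀ := by
    refine ⟨⟨hV, hU⟩, ?_⟩
    rw [Opens.coe_finset_inf]
    simp [hxW]
  have hW₀V : W₀ ≤ relFrobenius k p C ⁻¹ᵁ V := inf_le_left.trans inf_le_left
  have hW₀U : W₀ ≤ U := inf_le_left.trans inf_le_right
  have hW₀i (i : Fin r) : W₀ ≤ W i := inf_le_right.trans (Finset.inf_le (Finset.mem_univ i))
  have he₀ := IsFrame.mono he hW₀U
  let s (i : Fin r) : Γ(E, W₀) := resM E hW₀V (K.onSections V (f i))
  have hfr : IsFrame E W₀ s := by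
    refine he₀.of_matrix s ?_
    let A : Matrix (Fin r) (Fin r) Γ(C, W₀) := Matrix.of fun i j => he₀.coord le_rfl (s i) j
    have hpull := hf.pullback (f := relFrobenius k p C)
    -- the coordinates of preimages of the frame `e` give an inverse matrix
    let B : Matrix (Fin r) (Fin r) Γ(C, W₀) := Matrix.of fun i j =>
      hpull.coord hW₀V (resM _ (hW₀i i) (t i)) j
    have hBA : B * A = 1 := by
      ext i j
      have h1 := congrArg (K.φ.app W₀) (hpull.sum_coord hW₀V (resM _ (hW₀i i) (t i)))
      simp only [map_sum, Scheme.Modules.Hom.app_smul, app_resM, ht, resM_resM] at h1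
      have h2 := congrArg (he₀.coord le_rfl) h1
      have h3 : he₀.coord le_rfl (resM E ((hW₀i i).trans (hWU i)) (e i)) = Pi.single i 1 := by
        rw [← he₀.coord_frame le_rfl i, resM_self]
      rw [h3, map_sum] at h2
      have h4 := congrFun h2 j
      simp only [map_smul, Finset.sum_apply, Pi.smul_apply, smul_eq_mul] at h4
      rw [Matrix.mul_apply, Matrix.one_apply]
      rw [Pi.single_apply] at h4
      simp only [eq_comm (a := i)]
      exact h4
    exact (Matrix.isUnit_iff_isUnit_det A).mp (IsUnit.of_mul_eq_one_right B hBA)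
  intro hpole
  exact hpole (hfr.flatPartialConnection (genericPoint_mem hx₀))
    ((K.induces_flat hf (genericPoint_mem hx₀) hW₀V hfr).eq hE h) hx₀

end PreKernelMap

/-! ### Charts and generic coordinates -/

section Charts

variable {k : Type u} [Field k] {C : Scheme.{u}} [C.Over (Spec (.of k))]

lemma algebraMap_sections (V : C.Opens) : algebraMap k Γ(C, V) =
    ((C ↘ Spec (.of k)).appLE ⊤ V le_top).hom.comp (Scheme.ΓSpecIso (.of k)).inv.hom := rfl

lemma finiteType_sections [LocallyOfFiniteType (C ↘ Spec (.of k))] {V : C.Opens}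
    (hV : IsAffineOpen V) : Algebra.FiniteType k Γ(C, V) := by
  have h1 := HasRingHomProperty.appLE @LocallyOfFiniteType (C ↘ Spec (.of k)) inferInstance
    ⟨⊤, isAffineOpen_top _⟩ ⟨V, hV⟩ le_top
  have h2 : (Scheme.ΓSpecIso (.of k)).inv.hom.FiniteType :=
    RingHom.FiniteType.of_surjective _
      (Scheme.ΓSpecIso (.of k)).symm.commRingCatIsoToRingEquiv.surjective
  rw [← RingHom.finiteType_algebraMap, algebraMap_sections]
  exact h1.comp h2

lemma formallyEtale_res {V W : C.Opens} (hV : IsAffineOpen V) (hW : IsAffineOpen W) (h : W ≤ V) :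
    (resO h).FormallyEtale := by
  have h1 := HasRingHomProperty.appLE @Etale (𝟙 C) inferInstance ⟨V, hV⟩ ⟨W, hW⟩ h
  have h2 : ((𝟙 C : C ⟶ C).appLE V W h).hom = resO h := by
    simp [Scheme.Hom.appLE]
    rfl
  rw [h2] at h1
  exact h1.1

lemma exists_coordinate_res {V W : C.Opens} (hV : IsAffineOpen V) (hW : IsAffineOpen W)
    (h : W ≤ V) (x : Coordinate k Γ(C, V)) : ∃ x' : Coordinate k Γ(C, W),
      x'.t = resO h x.t ∧ ∀ a, x'.D (resO h a) = resO h (x.D a) := by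
  let _ : Algebra Γ(C, V) Γ(C, W) := (resO h).toAlgebra
  have : Algebra.FormallyEtale Γ(C, V) Γ(C, W) := formallyEtale_res hV hW h
  have : IsScalarTower k Γ(C, V) Γ(C, W) :=
    IsScalarTower.of_algebraMap_eq fun a => (resO_algebraMap h a).symm
  exact ⟨x.ofFormallyEtale Γ(C, W), rfl, x.ofFormallyEtale_D Γ(C, W)⟩

lemma exists_coordinate_nhds [SmoothOfRelativeDimension 1 (C ↘ Spec (.of k))] (x : C) :
    ∃ V : C.Opens, IsAffineOpen V ∧ x ∈ V ∧ Nonempty (Coordinate k Γ(C, V)) := by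
  obtain ⟨U, hU, V, hV, hxV, e, h⟩ :=
    SmoothOfRelativeDimension.exists_isStandardSmoothOfRelativeDimension (n := 1)
      (f := C ↘ Spec (.of k)) x
  have hUtop : U = ⊤ := by
    ext y
    have : Subsingleton (Spec (CommRingCat.of k)) :=
      inferInstanceAs (Subsingleton (PrimeSpectrum k))
    rw [Subsingleton.elim y ((C ↘ Spec (.of k)) x)]
    simpa using e hxV
  subst hUtop
  refine ⟨V, hV, hxV, ?_⟩
  have h2 : RingHom.IsStandardSmoothOfRelativeDimension 1 (algebraMap k Γ(C, V)) :=
    RingHom.isStandardSmoothOfRelativeDimension_respectsIso.2 _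
      (Scheme.ΓSpecIso (.of k)).symm.commRingCatIsoToRingEquiv h
  have : Algebra.IsStandardSmoothOfRelativeDimension 1 k Γ(C, V) := by
    rwa [RingHom.isStandardSmoothOfRelativeDimension_algebraMap] at h2
  exact exists_coordinate

/-- The points of a smooth curve have arbitrarily small affine neighbourhoods on which there are a
coordinate and a frame of a given vector bundle. -/
lemma exists_chart [SmoothOfRelativeDimension 1 (C ↘ Spec (.of k))] {r : ℕ} {E : C.Modules}
    (hE : IsVectorBundle r E) {x : C} {U : C.Opens} (hx : x ∈ U) :
    ∃ V : C.Opens, IsAffineOpen V ∧ x ∈ V ∧ V ≤ U ∧ Nonempty (Coordinate k Γ(C, V)) ∧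
      ∃ e : Fin r → Γ(E, V), IsFrame E V e := by
  obtain ⟨V₁, hV₁, hx₁, ⟨t⟩⟩ := exists_coordinate_nhds (k := k) x
  obtain ⟨V₂, hx₂, e, he⟩ := hE x
  obtain ⟨V, hV, hle, hxV⟩ := exists_affine_le (show x ∈ V₁ ⊓ (V₂ ⊓ U) from ⟨hx₁, hx₂, hx⟩)
  obtain ⟨t', -, -⟩ := exists_coordinate_res hV₁ hV (hle.trans inf_le_left) t
  exact ⟨V, hV, hxV, hle.trans (inf_le_right.trans inf_le_right), ⟨t'⟩, _,
    IsFrame.mono he (hle.trans (inf_le_right.trans inf_le_left))⟩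

end Charts

section FunctionField

variable {k : Type u} [Field k] {C : Scheme.{u}} [C.Over (Spec (.of k))] [IsIntegral C]

/-- The germ of a function at the generic point. -/
def genericGerm {U : C.Opens} (hU : genericPoint C ∈ U) : Γ(C, U) →+* C.functionField :=
  (C.presheaf.germ U (genericPoint C) hU).hom

lemma genericGerm_res {U V : C.Opens} (h : V ≤ U) (hV : genericPoint C ∈ V) (a : Γ(C, U)) :
    genericGerm hV (resO h a) = genericGerm (h hV) a :=
  TopCat.Presheaf.germ_res_apply C.presheaf (homOfLE h) (genericPoint C) hV a

lemma genericGerm_injective {U : C.Opens} (hU : genericPoint C ∈ U) :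
    Function.Injective (genericGerm hU) :=
  germ_injective_of_isIntegral C _ hU

variable (k C) in
/-- The `k`-algebra structure on the function field. -/
abbrev functionFieldAlgebra : Algebra k C.functionField :=
  ((genericGerm (C := C) (U := ⊤) trivial).comp (algebraMap k Γ(C, ⊤))).toAlgebra

attribute [local instance] functionFieldAlgebra

lemma genericGerm_algebraMap {U : C.Opens} (hU : genericPoint C ∈ U) (a : k) :
    genericGerm hU (algebraMap k Γ(C, U) a) = algebraMap k C.functionField a := by
  rw [← resO_algebraMap (le_top : U ≤ ⊤), genericGerm_res]
  rfl

lemma exists_coordinate_functionField {V : C.Opens} (hV : IsAffineOpen V)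
    (hη : genericPoint C ∈ V) (x : Coordinate k Γ(C, V)) : ∃ y : Coordinate k C.functionField,
      y.t = genericGerm hη x.t ∧ ∀ a, y.D (genericGerm hη a) = genericGerm hη (x.D a) := by
  have : Nonempty V := ⟨⟨_, hη⟩⟩
  have := functionField_isFractionRing_of_isAffineOpen C V hV
  have : Algebra.FormallyEtale Γ(C, V) C.functionField :=
    Algebra.FormallyEtale.of_isLocalization (nonZeroDivisors Γ(C, V))
  have : IsScalarTower k Γ(C, V) C.functionField :=
    IsScalarTower.of_algebraMap_eq fun a => (genericGerm_algebraMap hη a).symm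
  exact ⟨x.ofFormallyEtale C.functionField, rfl, x.ofFormallyEtale_D C.functionField⟩

lemma coordinate_D_genericGerm {V : C.Opens} (hV : IsAffineOpen V)
    (hη : genericPoint C ∈ V) (x : Coordinate k Γ(C, V)) (y : Coordinate k C.functionField)
    (h : y.t = genericGerm hη x.t) (a : Γ(C, V)) :
    y.D (genericGerm hη a) = genericGerm hη (x.D a) := by
  obtain ⟨y', hy't, hy'D⟩ := exists_coordinate_functionField hV hη x
  rw [← hy'D, y'.derivation_apply y.D, hy't, ← h, y.D_t, smul_eq_mul, mul_one]

variable {E : C.Modules} {r : ℕ}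

/-- The coordinates of a section with respect to a frame, as elements of the function field. -/
def IsFrame.genericCoord {V : C.Opens} {e : Fin r → Γ(E, V)} (he : IsFrame E V e) {W : C.Opens}
    (h : W ≤ V) (hη : genericPoint C ∈ W) : Γ(E, W) →+ (Fin r → C.functionField) :=
  AddMonoidHom.mk' (fun s i => genericGerm hη (he.coord h s i)) (fun s t => by
    ext i; simp)

namespace IsFrame

variable {V : C.Opens} {e : Fin r → Γ(E, V)} (he : IsFrame E V e)

lemma genericCoord_apply {W : C.Opens} (h : W ≤ V) (hη : genericPoint C ∈ W) (s : Γ(E, W))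
    (i : Fin r) : he.genericCoord h hη s i = genericGerm hη (he.coord h s i) := rfl

lemma genericCoord_smul {W : C.Opens} (h : W ≤ V) (hη : genericPoint C ∈ W) (a : Γ(C, W))
    (s : Γ(E, W)) : he.genericCoord h hη (a • s) = genericGerm hη a • he.genericCoord h hη s := by
  ext i; simp [genericCoord_apply]

lemma genericCoord_res {W W' : C.Opens} (h : W ≤ V) (h' : W' ≤ W) (hη : genericPoint C ∈ W')
    (s : Γ(E, W)) : he.genericCoord (h'.trans h) hη (resM E h' s) =
      he.genericCoord h (h' hη) s := by
  ext i
  rw [genericCoord_apply, genericCoord_apply, he.coord_res, genericGerm_res]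

lemma genericCoord_injective {W : C.Opens} (h : W ≤ V) (hη : genericPoint C ∈ W) :
    Function.Injective (he.genericCoord h hη) := by
  intro s t hst
  apply (he.coord h).injective
  ext i
  exact genericGerm_injective hη (congrFun hst i)

lemma genericCoord_frame {W : C.Opens} (h : W ≤ V) (hη : genericPoint C ∈ W) (i : Fin r) :
    he.genericCoord h hη (resM E h (e i)) = Pi.single i 1 := by
  ext j
  rw [genericCoord_apply, he.coord_frame, Pi.single_apply, Pi.single_apply]
  split_ifs <;> simp

end IsFrame

variable (p : ℕ) [hp : Fact p.Prime] [CharP k p]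

omit [IsIntegral C] in
/-- A section at which the `p`-curvature vanishes is a combination of horizontal sections; as
`(d/dt) ^ p = 0`, this is Cartier's descent argument for `∇_{d/dt}`. -/
lemma Connection.mem_span_horizontal {U : C.Opens} (c : Connection k E U) {V : C.Opens}
    (hV : IsAffineOpen V) (hVU : V ≤ U) (x : Coordinate k Γ(C, V)) (s : Γ(E, V))
    (hs : c.pCurvature p hV hVU x.D s = 0) :
    s ∈ Submodule.span Γ(C, V) {u : Γ(E, V) | c.nabla V hV hVU u = 0} := by
  have h0 : c.covariant hV hVU (derivationPow p x.D) s = 0 := by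
    rw [x.derivationPow_D p, covariant_apply]
    have : contract Γ(E, V) (0 : Derivation k Γ(C, V) Γ(C, V)) = 0 := by
      have h0 : (0 : Derivation k Γ(C, V) Γ(C, V)).liftKaehlerDifferential = 0 :=
        Derivation.liftKaehlerDifferential_unique _ _ (by ext a; simp)
      rw [contract, h0, LinearMap.lTensor_zero, LinearMap.comp_zero]
    rw [this]; rfl
  rw [Connection.pCurvature, h0, sub_zero] at hs
  have := x.mem_span_of_iterate_eq_zero p (c.covariant hV hVU x.D)
    (c.covariant_smul hV hVU x.D) hs
  simpa only [c.nabla_eq_zero_iff hV hVU x] using this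

/-- A rational connection with vanishing `p`-curvature is, in coordinates with respect to a frame,
given by an operator `T` on `K ^ r` for the function field `K`, whose kernel spans `K ^ r` and
describes the horizontal sections. -/
theorem RationalConnection.exists_horizontal_operator
    {c : RationalConnection k E} (hc : c.HasVanishingPCurvature p) {V : C.Opens}
    (hV : IsAffineOpen V) (hη : genericPoint C ∈ V) (x : Coordinate k Γ(C, V))
    {e : Fin r → Γ(E, V)} (he : IsFrame E V e) :
    ∃ (y : Coordinate k C.functionField)
      (T : (Fin r → C.functionField) →+ (Fin r → C.functionField)),
      (∀ (a : C.functionField) v, T (a • v) = y.D a • v + a • T v) ∧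
      Submodule.span C.functionField {v | T v = 0} = ⊤ ∧
      ∀ (W : C.Opens) (h : W ≤ V) (hW : genericPoint C ∈ W) (s : Γ(E, W)),
        c.IsHorizontal s ↔ T (he.genericCoord h hW s) = 0 := by
  obtain ⟨P, rfl, hP⟩ := hc
  obtain ⟨y, hyt, hyD⟩ := exists_coordinate_functionField hV hη x
  obtain ⟨V₁, hV₁, hle₁, hη₁⟩ := exists_affine_le
    (show genericPoint C ∈ V ⊓ P.domain from ⟨hη, genericPoint_mem_of_dense P.dense_domain⟩)
  have hV₁V := hle₁.trans inf_le_left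
  have hV₁P := hle₁.trans inf_le_right
  obtain ⟨x₁, hx₁t, hx₁D⟩ := exists_coordinate_res hV hV₁ hV₁V x
  let ω (j i : Fin r) : C.functionField := he.genericCoord hV₁V hη₁
    (P.conn.covariant hV₁ hV₁P x₁.D (resM E hV₁V (e j))) i
  let T : (Fin r → C.functionField) →+ (Fin r → C.functionField) :=
    AddMonoidHom.mk' (fun v i => y.D (v i) + ∑ j, v j * ω j i) (fun v w => by
      ext i
      simp only [Pi.add_apply, map_add, add_mul, Finset.sum_add_distrib]
      ring)
  have hT (v i) : T v i = y.D (v i) + ∑ j, v j * ω j i := rfl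
  have hTL (a : C.functionField) (v) : T (a • v) = y.D a • v + a • T v := by
    ext i
    simp only [hT, Pi.smul_apply, Pi.add_apply, smul_eq_mul, Derivation.leibniz, mul_add,
      Finset.mul_sum, mul_assoc]
    ring
  -- `T` computes the covariant derivative along `d/dt` in coordinates
  have hcov (W : C.Opens) (hWaff : IsAffineOpen W) (h : W ≤ V₁) (hW : genericPoint C ∈ W) :
      ∃ x' : Coordinate k Γ(C, W), ∀ s : Γ(E, W), he.genericCoord (h.trans hV₁V) hW
        (P.conn.covariant hWaff (h.trans hV₁P) x'.D s) =
          T (he.genericCoord (h.trans hV₁V) hW s) := by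
    obtain ⟨x', hx't, hx'D⟩ := exists_coordinate_res hV₁ hWaff h x₁
    refine ⟨x', fun s => ?_⟩
    have hyx' : y.t = genericGerm hW x'.t := by
      rw [hx't, genericGerm_res, hx₁t, genericGerm_res, hyt]
    have hs := he.sum_coord (h.trans hV₁V) s
    have hterm (j : Fin r) (a : Γ(C, W)) : he.genericCoord (h.trans hV₁V) hW
        (P.conn.covariant hWaff (h.trans hV₁P) x'.D (a • resM E (h.trans hV₁V) (e j))) =
        T (he.genericCoord (h.trans hV₁V) hW (a • resM E (h.trans hV₁V) (e j))) := by
      rw [Connection.covariant_smul, map_add, he.genericCoord_smul, he.genericCoord_smul,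
        he.genericCoord_smul, hTL, he.genericCoord_frame,
        coordinate_D_genericGerm hWaff hW x' y hyx']
      congr 2
      rw [← resM_resM E hV₁V h, P.conn.covariant_res hV₁ hWaff hV₁P h x₁.D x'.D hx'D,
        he.genericCoord_res hV₁V h hW]
      ext i
      rw [hT]
      simp [Pi.single_apply, ω]
      split_ifs <;> simp
    rw [← hs]
    simp only [map_sum, hterm]
  refine ⟨y, T, hTL, ?_, fun W h hW s => ⟨fun hs => ?_, fun hs => ?_⟩⟩
  · rw [eq_top_iff, ← (Pi.basisFun C.functionField (Fin r)).span_eq, Submodule.span_le]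
    rintro _ ⟨i, rfl⟩
    obtain ⟨x', hx'⟩ := hcov V₁ hV₁ le_rfl hη₁
    have hmem := P.conn.mem_span_horizontal p hV₁ hV₁P x' (resM E hV₁V (e i))
      (hP V₁ hV₁ hV₁P x'.D _)
    rw [Pi.basisFun_apply, ← he.genericCoord_frame hV₁V hη₁ i]
    generalize resM E hV₁V (e i) = s at hmem
    induction hmem using Submodule.span_induction with
    | mem u hu =>
      refine Submodule.subset_span ?_
      change T _ = 0
      rw [← hx', (P.conn.nabla_eq_zero_iff hV₁ hV₁P x' u).mp hu, map_zero]
    | zero => rw [map_zero]; exact zero_mem _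
    | add u v _ _ hu hv => rw [map_add]; exact add_mem hu hv
    | smul a u _ hu => rw [he.genericCoord_smul]; exact Submodule.smul_mem _ _ hu
  · obtain ⟨U, hUP, hηU, hU⟩ := (isHorizontal_mk_iff P s).mp hs
    obtain ⟨V₂, hV₂, hle₂, hη₂⟩ := exists_affine_le
      (show genericPoint C ∈ V₁ ⊓ (U ⊓ W) from ⟨hη₁, hηU, hW⟩)
    obtain ⟨x', hx'⟩ := hcov V₂ hV₂ (hle₂.trans inf_le_left) hη₂
    have h0 := hU V₂ hV₂ (hle₂.trans (inf_le_right.trans inf_le_left))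
      (hle₂.trans (inf_le_right.trans inf_le_right))
    have h1 := (P.conn.nabla_eq_zero_iff hV₂ ((hle₂.trans inf_le_left).trans hV₁P) x' _).mp h0
    rw [← he.genericCoord_res h (hle₂.trans (inf_le_right.trans inf_le_right)) hη₂, ← hx', h1,
      map_zero]
  · obtain ⟨V₂, hV₂, hle₂, hη₂⟩ := exists_affine_le
      (show genericPoint C ∈ V₁ ⊓ W from ⟨hη₁, hW⟩)
    obtain ⟨x', hx'⟩ := hcov V₂ hV₂ (hle₂.trans inf_le_left) hη₂
    refine isHorizontal_of_nabla_eq_zero P s hV₂ ((hle₂.trans inf_le_left).trans hV₁P)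
      (hle₂.trans inf_le_right) hη₂ ?_
    rw [P.conn.nabla_eq_zero_iff hV₂ _ x']
    apply he.genericCoord_injective ((hle₂.trans inf_le_left).trans hV₁V) hη₂
    rw [hx', map_zero, ← hs]
    congr 1
    exact he.genericCoord_res h (hle₂.trans inf_le_right) hη₂ s

end FunctionField

attribute [local instance] functionFieldAlgebra

/-! ### The sheaf of horizontal sections -/

section HorizontalSheaf

variable {k : Type u} [Field k] [IsAlgClosed k] (p : ℕ) [hp : Fact p.Prime] [CharP k p]
  {C : Scheme.{u}} [C.Over (Spec (.of k))] [IsIntegral C] {E : C.Modules} {r : ℕ}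

omit [IsIntegral C] in
lemma mem_basicOpen_of_notMem {V : C.Opens} {x : C} (hx : x ∈ V) {m : Ideal Γ(C, V)}
    (hm : (IsLocalRing.maximalIdeal (C.presheaf.stalk x)).comap (C.presheaf.germ V x hx).hom ≤ m)
    {g : Γ(C, V)} (hg : g ∉ m) : x ∈ C.basicOpen g := by
  rw [Scheme.mem_basicOpen _ _ _ hx]
  by_contra h
  exact hg (hm h)

/-- Every point has a neighbourhood with linearly independent horizontal sections of which all
horizontal sections are, locally, combinations with `p`-th powers as coefficients. -/
theorem RationalConnection.exists_horizontal_frame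
    [SmoothOfRelativeDimension 1 (C ↘ Spec (.of k))] (hE : IsVectorBundle r E)
    {c : RationalConnection k E} (hc : c.HasVanishingPCurvature p) (x : C) :
    ∃ (U : C.Opens) (_ : x ∈ U) (f : Fin r → Γ(E, U)), (∀ i, c.IsHorizontal (f i)) ∧
      (∀ (W : C.Opens) (h : W ≤ U) (a : Fin r → Γ(C, W)), ∑ i, a i • resM E h (f i) = 0 → a = 0) ∧
      ∀ (W : C.Opens) (h : W ≤ U) (s : Γ(E, W)), c.IsHorizontal s → ∀ z ∈ W,
        ∃ (W' : C.Opens) (h' : W' ≤ W) (b : Fin r → Γ(C, W')), z ∈ W' ∧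
          resM E h' s = ∑ i, b i ^ p • resM E (h'.trans h) (f i) := by
  have : Smooth (C ↘ Spec (.of k)) := SmoothOfRelativeDimension.smooth 1 _
  obtain ⟨V, hV, hxV, -, ⟨t⟩, e, he⟩ := exists_chart (k := k) hE (show x ∈ (⊤ : C.Opens) from trivial)
  have hη : genericPoint C ∈ V := genericPoint_mem hxV
  obtain ⟨y, T, hT, hspan, hTiff⟩ := exists_horizontal_operator p hc hV hη t he
  have : Nonempty V := ⟨⟨_, hη⟩⟩
  have := functionField_isFractionRing_of_isAffineOpen C V hV
  have : IsScalarTower k Γ(C, V) C.functionField :=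
    IsScalarTower.of_algebraMap_eq fun a => (genericGerm_algebraMap hη a).symm
  have : Algebra.FiniteType k Γ(C, V) := finiteType_sections hV
  obtain ⟨m, hm, hqm⟩ := Ideal.exists_le_maximal
    ((IsLocalRing.maximalIdeal (C.presheaf.stalk x)).comap (C.presheaf.germ V x hxV).hom)
    (Ideal.IsPrime.ne_top inferInstance)
  obtain ⟨f, g, hg, hf, hind, hgen⟩ := t.exists_horizontal_lattice_basis p y T hT hspan m
  have hxg := mem_basicOpen_of_notMem hxV hqm hg
  have hgV := C.basicOpen_le g
  have hηg : genericPoint C ∈ C.basicOpen g := genericPoint_mem hxg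
  let f' (i : Fin r) : Γ(E, C.basicOpen g) := (he.coord hgV).symm (fun j => resO hgV (f i j))
  have hf' (W : C.Opens) (h : W ≤ C.basicOpen g) (i j : Fin r) :
      he.coord (h.trans hgV) (resM E h (f' i)) j = resO (h.trans hgV) (f i j) := by
    rw [he.coord_res hgV h, LinearEquiv.apply_symm_apply, resO_resO]
  have hf'K (W : C.Opens) (h : W ≤ C.basicOpen g) (hW : genericPoint C ∈ W) (i : Fin r) :
      he.genericCoord (h.trans hgV) hW (resM E h (f' i)) =
        algebraMap Γ(C, V) C.functionField ∘ f i := by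
    ext j
    rw [he.genericCoord_apply, hf', genericGerm_res]
    rfl
  refine ⟨C.basicOpen g, hxg, f', fun i => ?_, fun W h a ha => ?_, fun W h s hs z hz => ?_⟩
  · rw [hTiff _ hgV hηg, ← resM_self E le_rfl (f' i), hf'K _ le_rfl hηg, hf]
  · ext i
    by_cases hW : ∃ z, z ∈ W
    · obtain ⟨z, hz⟩ := hW
      have hηW := genericPoint_mem hz
      apply genericGerm_injective hηW
      have h1 := congrArg (he.genericCoord (h.trans hgV) hηW) ha
      simp only [map_sum, he.genericCoord_smul, map_zero, hf'K W h hηW] at h1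
      rw [Fintype.linearIndependent_iff.mp hind _ h1 i, Pi.zero_apply, map_zero]
    · have hW' : W = ⊥ := by ext z; simpa using fun hz => hW ⟨z, hz⟩
      subst hW'
      exact Subsingleton.elim _ _
  · obtain ⟨a, haW, hza⟩ := hV.exists_basicOpen_le ⟨z, hz⟩ (hgV (h hz))
    have haV := C.basicOpen_le a
    have hηa : genericPoint C ∈ C.basicOpen a := genericPoint_mem hza
    have := hV.isLocalization_basicOpen a
    have hAa (b : Γ(C, V)) : algebraMap Γ(C, V) Γ(C, C.basicOpen a) b = resO haV b := rfl
    obtain ⟨⟨_, n, rfl⟩, hn⟩ := IsLocalization.exist_integer_multiples_of_finite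
      (Submonoid.powers a) (fun i => he.coord haV (resM E haW s) i)
    choose q hq using hn
    simp only [hAa, Algebra.smul_def] at hq
    -- the coordinates of `a ^ (n * p) • s` are regular on `V`
    let q' : Fin r → Γ(C, V) := (a ^ n) ^ (p - 1) • q
    have hq' (i : Fin r) : resO haV (q' i) =
        resO haV (a ^ n) ^ p * he.coord haV (resM E haW s) i := by
      change resO haV ((a ^ n) ^ (p - 1) * q i) = _
      rw [map_mul, hq, map_pow (resO haV) (a ^ n), ← mul_assoc, ← pow_succ,
        Nat.sub_add_cancel hp.out.one_le]
    have hTq' : T (algebraMap Γ(C, V) C.functionField ∘ q') = 0 := by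
      have h1 := (hTiff _ haV hηa _).mp ((hs.res haW).pow_smul p (resO haV (a ^ n)))
      rw [← h1]
      congr 1
      ext i
      rw [he.genericCoord_apply, map_smul, Pi.smul_apply, smul_eq_mul, ← hq', genericGerm_res]
      rfl
    obtain ⟨d, hd⟩ := hgen q' hTq'
    have hua : IsUnit (resO haV a) := RingedSpace.isUnit_res_basicOpen _ a
    have hug : IsUnit (resO haV g) := by
      have h1 : IsUnit (resO hgV g) := RingedSpace.isUnit_res_basicOpen _ g
      have h2 := h1.map (resO (haW.trans h))
      rwa [resO_resO] at h2
    obtain ⟨w, hw⟩ := (hug.mul (hua.pow n)).exists_left_inv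
    refine ⟨C.basicOpen a, haW, fun i => w * resO haV (d i), hza, ?_⟩
    apply (he.coord haV).injective
    ext j
    have hdj := congrArg (resO haV) (congrFun hd j)
    simp only [Pi.smul_apply, smul_eq_mul, Finset.sum_apply, map_mul, map_pow, hq', map_sum] at hdj
    simp only [map_sum, map_smul, Finset.sum_apply, Pi.smul_apply, smul_eq_mul,
      hf' _ (haW.trans h), mul_pow, mul_assoc, ← Finset.mul_sum, ← hdj]
    calc _ = (w * (resO haV g * resO haV a ^ n)) ^ p * he.coord haV (resM E haW s) j := by
          rw [hw, one_pow, one_mul]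
      _ = _ := by ring

/-- The sheaf of horizontal sections, a submodule of `F_* E`. It is stable under multiplication with
functions on `C^{(p)}`, which are `p`-th powers on `C`. -/
def RationalConnection.horizontalSheaf (c : RationalConnection k E) :
    SubModules ((Scheme.Modules.pushforward (relFrobenius k p C)).obj E) where
  carrier V :=
    { carrier := {s | c.IsHorizontal (show Γ(E, relFrobenius k p C ⁻¹ᵁ V) from s)}
      add_mem' := fun ha hb => IsHorizontal.add ha hb
      zero_mem' := c.isHorizontal_zero _
      smul_mem' := fun a s hs => by
        obtain ⟨b, hb⟩ := exists_pow_eq_relFrobenius_app k p a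
        change c.IsHorizontal ((relFrobenius k p C).app V a •
          (show Γ(E, relFrobenius k p C ⁻¹ᵁ V) from s))
        rw [hb]
        exact IsHorizontal.pow_smul p hs b }
  res_mem h _ hs := IsHorizontal.res ((relFrobenius k p C).preimage_mono h) hs
  of_local {U} s h := by
    by_cases hU : ∃ x, x ∈ relFrobenius k p C ⁻¹ᵁ U
    · obtain ⟨x, hx⟩ := hU
      obtain ⟨V, hV, hxV, hs⟩ := h (relFrobenius k p C x) hx
      exact IsHorizontal.of_res ((relFrobenius k p C).preimage_mono hV) hxV hs
    · exact isHorizontal_of_isEmpty (fun x hx => hU ⟨x, hx⟩) _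

namespace RationalConnection

variable (c : RationalConnection k E)

/-- The inclusion of the horizontal sections over `V` into the sections of `E` over `F⁻¹ V`. -/
def horizontalIncl (V : (frobeniusTwist k p C).Opens) :
    Γ((c.horizontalSheaf p).toModules, V) →+ Γ(E, relFrobenius k p C ⁻¹ᵁ V) :=
  ((c.horizontalSheaf p).ι.app V).hom

lemma horizontalIncl_smul (V : (frobeniusTwist k p C).Opens) (a : Γ(frobeniusTwist k p C, V))
    (s : Γ((c.horizontalSheaf p).toModules, V)) : c.horizontalIncl p V (a • s) =
      (relFrobenius k p C).app V a • c.horizontalIncl p V s := rfl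

lemma horizontalIncl_res {V W : (frobeniusTwist k p C).Opens} (h : W ≤ V)
    (s : Γ((c.horizontalSheaf p).toModules, V)) : c.horizontalIncl p W (resM _ h s) =
      resM E ((relFrobenius k p C).preimage_mono h) (c.horizontalIncl p V s) := rfl

lemma horizontalIncl_injective (V : (frobeniusTwist k p C).Opens) :
    Function.Injective (c.horizontalIncl p V) := fun _ _ h =>
  ((c.horizontalSheaf p).sectionsEquiv V).injective (Subtype.ext h)

lemma mem_range_horizontalIncl (V : (frobeniusTwist k p C).Opens)
    (s : Γ(E, relFrobenius k p C ⁻¹ᵁ V)) :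
    s ∈ Set.range (c.horizontalIncl p V) ↔ c.IsHorizontal s :=
  ⟨fun ⟨t, ht⟩ => ht ▸ ((c.horizontalSheaf p).sectionsEquiv V t).2,
    fun h => ⟨((c.horizontalSheaf p).sectionsEquiv V).symm ⟨s, h⟩, rfl⟩⟩

variable {c}

/-- The sheaf of horizontal sections has frames locally, and these are independent over the functions
on `C`, not only over those on `C^{(p)}`. -/
lemma exists_horizontalSheaf_frame
    [SmoothOfRelativeDimension 1 (C ↘ Spec (.of k))] (hE : IsVectorBundle r E)
    (hc : c.HasVanishingPCurvature p) (y : frobeniusTwist k p C) :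
    ∃ (V : (frobeniusTwist k p C).Opens) (_ : y ∈ V)
      (f : Fin r → Γ((c.horizontalSheaf p).toModules, V)), IsFrame _ V f ∧
      ∀ (W : C.Opens) (h : W ≤ relFrobenius k p C ⁻¹ᵁ V) (a : Fin r → Γ(C, W)),
        ∑ i, a i • resM E h (c.horizontalIncl p V (f i)) = 0 → a = 0 := by
  obtain ⟨x, rfl⟩ := relFrobenius_surjective k p y
  obtain ⟨U, hxU, f, hf, hind, hgen⟩ := exists_horizontal_frame p hE hc x
  have hU := preimage_twistOpen k p U
  choose f' hf' using fun i => (c.mem_range_horizontalIncl p (twistOpen k p U) _).mpr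
    ((hf i).res hU.le)
  have hind' (W : C.Opens) (h : W ≤ relFrobenius k p C ⁻¹ᵁ (twistOpen k p U))
      (a : Fin r → Γ(C, W)) (ha : ∑ i, a i • resM E h (c.horizontalIncl p _ (f' i)) = 0) :
      a = 0 := by
    simp only [hf', resM_resM] at ha
    exact hind W _ a ha
  refine ⟨twistOpen k p U, (hU.ge hxU :), f', ?_, hind'⟩
  refine IsFrame.of_local (fun V h a ha => ?_) (fun V h s y hy => ?_)
  · have h1 := congrArg (c.horizontalIncl p V) ha
    simp only [map_sum, horizontalIncl_smul, horizontalIncl_res, map_zero] at h1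
    have h2 := hind' _ _ _ h1
    ext i
    exact relFrobenius_app_injective k p V ((congrFun h2 i).trans (map_zero _).symm)
  · obtain ⟨z, rfl⟩ := relFrobenius_surjective k p y
    obtain ⟨W', h', b, hz, hb⟩ := hgen _ (((relFrobenius k p C).preimage_mono h).trans hU.le) _
      ((c.mem_range_horizontalIncl p V _).mp ⟨s, rfl⟩) z hy
    choose a ha using fun i => exists_relFrobenius_app_eq_pow k p W' (b i)
    have hW'V : twistOpen k p W' ≤ V := by
      rw [← twistOpen_preimage k p V]
      exact (twistFst k p C).preimage_mono h'
    refine ⟨twistOpen k p W', hW'V, a, ((preimage_twistOpen k p W').ge hz :), ?_⟩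
    apply c.horizontalIncl_injective p
    have h1 := congrArg (resM E (preimage_twistOpen k p W').le) hb
    simp only [map_sum, resM_smul, resM_resM, map_pow] at h1
    simp only [map_sum, horizontalIncl_smul, horizontalIncl_res, hf', ha, resM_resM]
    exact h1

/-- The horizontal sections of a connection with vanishing `p`-curvature form a kernel map. -/
theorem exists_isKernelOf
    [SmoothOfRelativeDimension 1 (C ↘ Spec (.of k))] (hE : IsVectorBundle r E)
    (hc : c.HasVanishingPCurvature p) : ∃ K : PreKernelMap k p r E, K.IsKernelOf c := by
  let H := c.horizontalSheaf p
  let φ := pullbackDesc (relFrobenius k p C) H.toModules H.ι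
  have hφ (V : (frobeniusTwist k p C).Opens) (s : Γ(H.toModules, V)) :
      φ.app _ (pullbackSection (relFrobenius k p C) H.toModules s) = c.horizontalIncl p V s :=
    pullbackDesc_app _ _ _ s
  have hmono : Mono φ := by
    refine mono_of_injective φ fun U s t hst => eq_of_locally_eq _ _ _ fun x hx => ?_
    obtain ⟨V, hV, f, hf, hind⟩ := exists_horizontalSheaf_frame p hE hc (relFrobenius k p C x)
    have hfp := hf.pullback (f := relFrobenius k p C)
    refine ⟨U ⊓ relFrobenius k p C ⁻¹ᵁ V, inf_le_left, ⟨hx, hV⟩, ?_⟩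
    apply (hfp.coord inf_le_right).injective
    rw [← sub_eq_zero, ← map_sub, ← map_sub]
    apply hind _ inf_le_right
    have h1 := congrArg (φ.app _) (hfp.sum_coord inf_le_right (resM _ inf_le_left (s - t)))
    have h0 : φ.app U (s - t) = 0 := by rw [map_sub, hst, sub_self]
    rw [app_resM, h0, map_zero, map_sum] at h1
    rw [← h1]
    refine Finset.sum_congr rfl fun i _ => ?_
    rw [Scheme.Modules.Hom.app_smul, app_resM, hφ]
  have hbundle : IsVectorBundle r H.toModules := fun y => by
    obtain ⟨V, hV, f, hf, -⟩ := exists_horizontalSheaf_frame p hE hc y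
    exact ⟨V, hV, f, hf⟩
  let K : PreKernelMap k p r E := ⟨H.toModules, hbundle, φ, hmono⟩
  refine ⟨K, fun V s => ?_⟩
  have hK : K.onSections V = c.horizontalIncl p V := funext fun s => hφ V s
  rw [hK, c.mem_range_horizontalIncl p V s]

end RationalConnection

end HorizontalSheaf

/-! ### The correspondence -/

section PCurvature

variable {k : Type u} [Field k] (p : ℕ) [hp : Fact p.Prime] [CharP k p]
  {C : Scheme.{u}} [C.Over (Spec (.of k))] {E : C.Modules} {r : ℕ}

lemma Connection.pCurvature_res {U : C.Opens} (c : Connection k E U) {V W : C.Opens}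
    (hV : IsAffineOpen V) (hW : IsAffineOpen W) (hVU : V ≤ U) (h : W ≤ V)
    (D : Derivation k Γ(C, V) Γ(C, V)) (D' : Derivation k Γ(C, W) Γ(C, W))
    (hD : ∀ a, D' (resO h a) = resO h (D a)) (s : Γ(E, V)) :
    c.pCurvature p hW (h.trans hVU) D' (resM E h s) = resM E h (c.pCurvature p hV hVU D s) := by
  have hDp (a) : derivationPow p D' (resO h a) = resO h (derivationPow p D a) := by
    rw [derivationPow_apply, derivationPow_apply]
    exact Function.Semiconj.iterate_right (f := resO h) (fun a => (hD a).symm) p a |>.symm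
  have hiter : (c.covariant hW (h.trans hVU) D')^[p] (resM E h s) =
      resM E h ((c.covariant hV hVU D)^[p] s) :=
    (Function.Semiconj.iterate_right (f := resM E h)
      (fun s => (c.covariant_res hV hW hVU h D D' hD s).symm) p s).symm
  rw [pCurvature, pCurvature, map_sub, hiter, c.covariant_res hV hW hVU h _ _ hDp]

variable [IsIntegral C]

lemma IsFrame.resM_injective {V W : C.Opens} {e : Fin r → Γ(E, V)} (he : IsFrame E V e)
    (h : W ≤ V) {x : C} (hx : x ∈ W) : Function.Injective (resM E h) := by
  intro s t hst
  apply (he.coord le_rfl).injective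
  ext i
  apply resO_injective h hx
  rw [← he.coord_res, ← he.coord_res, hst]

/-- The vanishing of the `p`-curvature propagates from a dense open subset to every open subset
where the connection is defined. -/
lemma PartialConnection.pCurvature_eq_zero {P : PartialConnection k E}
    (hP : RationalConnection.HasVanishingPCurvature (Quotient.mk _ P) p) {V : C.Opens}
    (hV : IsAffineOpen V) (hVP : V ≤ P.domain) (x : Coordinate k Γ(C, V)) {e : Fin r → Γ(E, V)}
    (he : IsFrame E V e) {z : C} (hz : z ∈ V) (s : Γ(E, V)) :
    P.conn.pCurvature p hV hVP x.D s = 0 := by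
  obtain ⟨Q, hQ, hQp⟩ := hP
  obtain ⟨W, hW, hWQ, hWP, hn⟩ := Quotient.exact hQ
  obtain ⟨V', hV', hle, hη⟩ := exists_affine_le
    (show genericPoint C ∈ V ⊓ W from ⟨genericPoint_mem hz, genericPoint_mem_of_dense hW⟩)
  obtain ⟨x', -, hx'⟩ := exists_coordinate_res hV hV' (hle.trans inf_le_left) x
  apply he.resM_injective (hle.trans inf_le_left) hη
  rw [← P.conn.pCurvature_res p hV hV' hVP (hle.trans inf_le_left) x.D x'.D hx', map_zero,
    ← hQp V' hV' ((hle.trans inf_le_right).trans hWQ) x'.D (resM E (hle.trans inf_le_left) s)]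
  simp only [Connection.pCurvature, Connection.covariant, hn V' hV' (hle.trans inf_le_right)]

end PCurvature

section Correspondence

variable {k : Type u} [Field k] [IsAlgClosed k] {p : ℕ} [hp : Fact p.Prime] [CharP k p]
  {C : Scheme.{u}} [C.Over (Spec (.of k))] [IsIntegral C] {E : C.Modules} {r : ℕ}

namespace PreKernelMap

omit [IsAlgClosed k] in
/-- Where the connection is defined, horizontal sections span `E` locally, so `φ` is surjective. -/
theorem IsKernelOf.isSurjectiveAt [SmoothOfRelativeDimension 1 (C ↘ Spec (.of k))]
    (hE : IsVectorBundle r E) {c : RationalConnection k E} (hc : c.HasVanishingPCurvature p)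
    {K : PreKernelMap k p r E} (hK : K.IsKernelOf c) {x : C} (hx : ¬ c.IsPole x) :
    K.IsSurjectiveAt x := by
  simp only [RationalConnection.IsPole, not_forall, not_not] at hx
  obtain ⟨P, rfl, hxP⟩ := hx
  intro g
  obtain ⟨U, hxU, s, rfl⟩ := TopCat.Presheaf.exists_germ_eq _ g
  obtain ⟨V, hV, hxV, hle, ⟨t⟩, e, he⟩ := exists_chart (k := k) hE
    (show x ∈ U ⊓ P.domain from ⟨hxU, hxP⟩)
  have hVP := hle.trans inf_le_right
  have hVU := hle.trans inf_le_left
  have hspan := P.conn.mem_span_horizontal p hV hVP t (resM E hVU s)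
    (PartialConnection.pCurvature_eq_zero p hc hV hVP t he hxV _)
  have hrange : resM E hVU s ∈ LinearMap.range (appLinear K.φ V) := by
    refine Submodule.span_le.mpr (fun u hu => ?_) hspan
    have hu' := (isHorizontal_of_nabla_eq_zero P u hV hVP le_rfl hxV
      (by rw [resM_self]; exact hu)).res (preimage_twistOpen k p V).le
    obtain ⟨f, hf⟩ := (hK (twistOpen k p V) _).mp hu'
    refine ⟨resM _ (preimage_twistOpen k p V).ge
      (pullbackSection (relFrobenius k p C) K.bundle f), ?_⟩
    change K.φ.app V _ = _
    rw [app_resM, ← onSections_eq, hf, resM_resM, resM_self]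
  obtain ⟨τ, hτ⟩ := hrange
  refine ⟨((Scheme.Modules.pullback (relFrobenius k p C)).obj K.bundle).presheaf.germ V x hxV τ, ?_⟩
  refine (TopCat.Presheaf.stalkFunctor_map_germ_apply V x hxV
    (Scheme.Modules.Hom.mapPresheaf K.φ) τ).trans ?_
  refine (congrArg (TopCat.Presheaf.germ E.presheaf V x hxV) hτ).trans ?_
  exact TopCat.Presheaf.germ_res_apply E.presheaf (homOfLE hVU) x hxV s

omit [IsAlgClosed k] [IsIntegral C] in
lemma onSections_app_of_map_comp {K K' : PreKernelMap k p r E} (β : K.bundle ⟶ K'.bundle)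
    (h : (Scheme.Modules.pullback (relFrobenius k p C)).map β ≫ K'.φ = K.φ)
    (V : (frobeniusTwist k p C).Opens) (f : Γ(K.bundle, V)) :
    K'.onSections V (β.app V f) = K.onSections V f := by
  rw [onSections_eq, onSections_eq, pullbackSection_app, ← h]
  rfl

omit [IsAlgClosed k] [IsIntegral C] in
lemma map_comp_of_onSections_app {K K' : PreKernelMap k p r E} (β : K.bundle ⟶ K'.bundle)
    (h : ∀ (V : (frobeniusTwist k p C).Opens) (f : Γ(K.bundle, V)),
      K'.onSections V (β.app V f) = K.onSections V f) :
    (Scheme.Modules.pullback (relFrobenius k p C)).map β ≫ K'.φ = K.φ := by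
  refine pullback_hom_ext fun V s => ?_
  rw [← onSections_eq, ← h, onSections_eq, pullbackSection_app]
  rfl

lemma exists_hom_of_range_subset {K K' : PreKernelMap k p r E}
    (h : ∀ V f, K.onSections V f ∈ Set.range (K'.onSections V)) :
    ∃ β : K.bundle ⟶ K'.bundle, ∀ V f, K'.onSections V (β.app V f) = K.onSections V f := by
  choose g hg using h
  refine ⟨homOfLinear (fun V =>
    { toFun := g V
      map_add' := fun s t => K'.onSections_injective V (by
        rw [onSections_add, hg, hg, hg, onSections_add])
      map_smul' := fun a s => K'.onSections_injective V (by
        rw [RingHom.id_apply, onSections_smul, hg, hg, onSections_smul]) })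
    (fun V W hWV s => K'.onSections_injective W ?_), hg⟩
  change K'.onSections W (g W _) = K'.onSections W (resM _ hWV (g V s))
  rw [onSections_res, hg, hg, onSections_res]

/-- Two kernel maps of a connection differ by the isomorphism of their bundles that identifies both
with the sheaf of horizontal sections. -/
theorem IsKernelOf.exists_iso {c : RationalConnection k E} {K K' : PreKernelMap k p r E}
    (hK : K.IsKernelOf c) (hK' : K'.IsKernelOf c) : ∃ β : K.bundle ≅ K'.bundle,
      (Scheme.Modules.pullback (relFrobenius k p C)).map β.hom ≫ K'.φ = K.φ := by
  obtain ⟨β, hβ⟩ := exists_hom_of_range_subset (K := K) (K' := K')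
    fun V f => (hK' V _).mp ((hK V _).mpr ⟨f, rfl⟩)
  obtain ⟨β', hβ'⟩ := exists_hom_of_range_subset (K := K') (K' := K)
    fun V f => (hK V _).mp ((hK' V _).mpr ⟨f, rfl⟩)
  refine ⟨⟨β, β', hom_ext_sections fun V s => ?_, hom_ext_sections fun V s => ?_⟩,
    map_comp_of_onSections_app β hβ⟩
  · exact K.onSections_injective V ((hβ' V _).trans (hβ V _))
  · exact K'.onSections_injective V ((hβ V _).trans (hβ' V _))

omit [IsAlgClosed k] [IsIntegral C] in
lemma IsKernelOf.of_iso {c : RationalConnection k E} {K K' : PreKernelMap k p r E}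
    (hK : K.IsKernelOf c) (β : K.bundle ≅ K'.bundle)
    (h : (Scheme.Modules.pullback (relFrobenius k p C)).map β.hom ≫ K'.φ = K.φ) :
    K'.IsKernelOf c := by
  intro V s
  rw [hK V s]
  have hβ (f : Γ(K'.bundle, V)) : β.hom.app V (β.inv.app V f) = f :=
    congr(($(β.inv_hom_id)).app V f)
  constructor
  · rintro ⟨f, rfl⟩
    exact ⟨β.hom.app V f, onSections_app_of_map_comp β.hom h V f⟩
  · rintro ⟨f, rfl⟩
    exact ⟨β.inv.app V f, by rw [← onSections_app_of_map_comp β.hom h, hβ]⟩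

omit [IsAlgClosed k] [IsIntegral C] in
lemma IsKernelOf.induces {c : RationalConnection k E} {K : PreKernelMap k p r E}
    (hK : K.IsKernelOf c) : K.Induces c := fun V f => (hK V _).mpr ⟨f, rfl⟩

omit [IsAlgClosed k] in
lemma IsKernelMap.isKernelOf_iff (hE : IsVectorBundle r E) {K : PreKernelMap k p r E}
    (hK : K.IsKernelMap) {c : RationalConnection k E} : K.IsKernelOf c ↔ K.Induces c := by
  refine ⟨fun h => h.induces, fun h => ?_⟩
  obtain ⟨c', hi, hk⟩ := hK
  rwa [h.eq hE hi]

end PreKernelMap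

omit [IsAlgClosed k] in
lemma RationalConnection.isHorizontal_transport_iff (c : RationalConnection k E) (α : E ≅ E)
    {U : C.Opens} (s : Γ(E, U)) :
    (c.transport α).IsHorizontal s ↔ c.IsHorizontal (α.inv.app U s) := by
  obtain ⟨P, rfl⟩ := Quotient.exists_rep c
  change IsHorizontal (Quotient.mk _ (P.transport α)) s ↔ _
  rw [isHorizontal_mk_iff, isHorizontal_mk_iff]
  have hα (V : C.Opens) : appLinear α.inv V ∘ₗ appLinear α.hom V = LinearMap.id :=
    LinearMap.ext fun t => congr(($(α.hom_inv_id)).app V t)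
  have key (V : C.Opens) (hV : IsAffineOpen V) (hVP : V ≤ P.domain) (hVU : V ≤ U) :
      (P.transport α).conn.nabla V hV hVP (resM E hVU s) = 0 ↔
        P.conn.nabla V hV hVP (resM E hVU (α.inv.app U s)) = 0 := by
    rw [← app_resM]
    change LinearMap.rTensor _ (appLinear α.hom V)
      (P.conn.nabla V hV hVP (α.inv.app V (resM E hVU s))) = 0 ↔ _
    refine ⟨fun h => ?_, fun h => by rw [h, map_zero]⟩
    have h1 := congrArg (LinearMap.rTensor _ (appLinear α.inv V)) h
    rwa [← LinearMap.comp_apply, ← LinearMap.rTensor_comp, hα, LinearMap.rTensor_id, map_zero] at h1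
  exact exists_congr fun W => exists_congr fun hW => and_congr_right fun _ =>
    forall₄_congr fun V hV hVW hVU => key V hV (hVW.trans hW) hVU

omit [IsAlgClosed k] in
lemma PreKernelMap.IsKernelOf.postcomp {c : RationalConnection k E} {K : PreKernelMap k p r E}
    (hK : K.IsKernelOf c) (α : E ≅ E) : (K.postcomp α).IsKernelOf (c.transport α) := by
  intro V s
  rw [c.isHorizontal_transport_iff, hK V]
  have h1 (t : Γ(E, relFrobenius k p C ⁻¹ᵁ V)) : α.inv.app _ (α.hom.app _ t) = t :=
    congr(($(α.hom_inv_id)).app _ t)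
  have h2 (t : Γ(E, relFrobenius k p C ⁻¹ᵁ V)) : α.hom.app _ (α.inv.app _ t) = t :=
    congr(($(α.inv_hom_id)).app _ t)
  constructor
  · rintro ⟨f, hf⟩
    exact ⟨f, (congrArg (α.hom.app _) hf).trans (h2 s)⟩
  · rintro ⟨f, rfl⟩
    exact ⟨f, (h1 _).symm⟩

variable [SmoothOfRelativeDimension 1 (C ↘ Spec (.of k))]

/-- The class of kernel maps given by the horizontal sections of a rational connection with
vanishing `p`-curvature. -/
def kernelMapClass (hE : IsVectorBundle r E)
    (c : {c : RationalConnection k E // c.HasVanishingPCurvature p}) : KernelMapClass k p r E :=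
  KernelMap.toClass ⟨(RationalConnection.exists_isKernelOf p hE c.2).choose, c.1,
    (RationalConnection.exists_isKernelOf p hE c.2).choose_spec.induces,
    (RationalConnection.exists_isKernelOf p hE c.2).choose_spec⟩

lemma kernelMapClass_eq_iff (hE : IsVectorBundle r E)
    (c : {c : RationalConnection k E // c.HasVanishingPCurvature p}) (K : KernelMap k p r E) :
    kernelMapClass hE c = K.toClass ↔ K.1.IsKernelOf c.1 := by
  have h := (RationalConnection.exists_isKernelOf p hE c.2).choose_spec
  constructor
  · intro heq
    obtain ⟨β, hβ⟩ := Quotient.exact heq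
    exact h.of_iso β hβ
  · exact fun hK => Quotient.sound (h.exists_iso hK)

lemma kernelMapClass_bijective (hE : IsVectorBundle r E) :
    Function.Bijective (kernelMapClass (k := k) (p := p) hE) := by
  constructor
  · intro c c' h
    obtain ⟨K, hK⟩ := Quotient.exists_rep (kernelMapClass hE c)
    have h1 := (kernelMapClass_eq_iff hE c K).mp hK.symm
    have h2 := (kernelMapClass_eq_iff hE c' K).mp (h.symm.trans hK.symm)
    exact Subtype.ext (h1.induces.eq hE h2.induces)
  · intro κ
    obtain ⟨K, rfl⟩ := Quotient.exists_rep κ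
    obtain ⟨c, hi, hk⟩ := K.2
    exact ⟨⟨c, hi.hasVanishingPCurvature hE⟩, (kernelMapClass_eq_iff hE _ K).mpr hk⟩

end Correspondence

end CurveConn

end

open CategoryTheory AlgebraicGeometry CurveConn in
theorem mainTheorem3 {k : Type u} [Field k] [IsAlgClosed k] (p : ℕ) [Fact p.Prime] [CharP k p]
    (C : Scheme.{u}) [C.Over (Spec (.of k))] [IsIntegral C] [IsSeparated (C ↘ Spec (.of k))]
    [QuasiCompact (C ↘ Spec (.of k))] [SmoothOfRelativeDimension 1 (C ↘ Spec (.of k))]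
    (r : ℕ) (E : C.Modules) (hE : IsVectorBundle r E) :
    -- every pre-kernel map induces a unique rational connection
    (∀ K : PreKernelMap k p r E, ∃! c : RationalConnection k E, K.Induces c) ∧
    -- (i) the one-to-one correspondence, given by taking the kernel of a connection in one
    -- direction and the connection induced by a kernel map in the other
    ∃ Φ : {c : RationalConnection k E // c.HasVanishingPCurvature p} ≃ KernelMapClass k p r E,
      (∀ c (K : KernelMap k p r E), Φ c = K.toClass ↔ K.1.IsKernelOf c.1) ∧
      (∀ c (K : KernelMap k p r E), Φ.symm K.toClass = c ↔ K.1.Induces c.1) ∧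
      -- (ii) the poles are the points where `φ` fails to be surjective
      (∀ c (K : KernelMap k p r E), Φ c = K.toClass →
        ∀ x : C, c.1.IsPole x ↔ ¬ K.1.IsSurjectiveAt x) ∧
      -- (iii) transport of connections corresponds to composing `φ` with automorphisms of `E`
      (∀ c (K : KernelMap k p r E), Φ c = K.toClass → ∀ α : E ≅ E,
        ∃ (hc : (c.1.transport α).HasVanishingPCurvature p)
          (hK : (K.1.postcomp α).IsKernelMap),
          Φ ⟨c.1.transport α, hc⟩ = KernelMap.toClass ⟨K.1.postcomp α, hK⟩) := by
  refine ⟨PreKernelMap.existsUnique_induces hE, Equiv.ofBijective _ (kernelMapClass_bijective hE),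
    kernelMapClass_eq_iff hE, fun c K => ?_, fun c K hcK x => ?_, fun c K hcK α => ?_⟩
  · rw [Equiv.symm_apply_eq, eq_comm, ← PreKernelMap.IsKernelMap.isKernelOf_iff hE K.2]
    exact kernelMapClass_eq_iff hE c K
  · have hK := (kernelMapClass_eq_iff hE c K).mp hcK
    exact ⟨fun h hx => hK.induces.not_isPole hE hx h,
      not_imp_comm.mp (hK.isSurjectiveAt hE c.2)⟩
  · have hK := ((kernelMapClass_eq_iff hE c K).mp hcK).postcomp α
    exact ⟨hK.induces.hasVanishingPCurvature hE, ⟨_, hK.induces, hK⟩,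
      (kernelMapClass_eq_iff hE _ _).mpr hK⟩
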